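/- Let $n\ge 2$ and $p>n$. For a bounded domain (non-empty, open, connected set) $\Omega\subset\mathbb R^n$ with Lipschitz boundary let $|\partial\Omega|$ be the $(n-1)$-dimensional Hausdorff measure of $\partial\Omega$, let $$D(\Omega)=\sup_{x\in\mathbb R^n,\,r>0}\frac{|\partial\Omega\cap B(x,r)|}{\omega_{n-1}r^{n-1}}$$ be its $(n-1)$-distortion ($\omega_{n-1}$ is the volume of the unit ball of $\mathbb R^{n-1}$), and let $$\sigma_{p,k}(\Omega)=\inf_{F\in\Gamma_k}\ \sup_{u\in F}\ \frac{\int_\Omega|\nabla u|^p\,dx}{\int_{\partial\Omega}|u|^p\,d\sigma}$$ be the variational eigenvalues of the Steklov $p$-Laplacian. Here $u$ on $\partial\Omega$ is the trace, the quotient is $+\infty$ if its denominator vanishes, and $\Gamma_k$ is the class of symmetric sets $F\subset W^{1,p}(\Omega)\setminus\{0\}$ such that $F\cap\{u:\|u\|_{L^p(\partial\Omega)}=1\}$ is compact and the Krasnoselskii genus of $F$ (the least positive integer $\ell$ for which there is a continuous odd map $F\to\mathbb R^\ell\setminus\{0\}$, or $\infty$ if there is none) is at least $k$. Put $$\beta=\frac{p-n(n+p-np)}{p-n},\qquad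 \alpha=\beta-n+1,$$ and for $j\in\mathbb N$, $j\ge1$, put $m(j)=[j^{\beta-1}]+1$. Divide the upper face $[0,\tfrac1j]^{n-1}\times\{\tfrac1j\}$ of the cube $Q_j=(0,\tfrac1j)^n$ into $m(j)^{n-1}$ closed $(n-1)$-dimensional cubes of side $\tfrac1{jm(j)}$, and on each of them, as base, place the closed pyramid of height $j^{-\alpha}$ whose vertex lies above the center of the base (outside $Q_j$). Let $\Omega_j$ be the interior of the union of $\overline{Q_j}$ and all these pyramids. Then: 1. every $\Omega_j$, $j\ge1$, is a bounded domain with Lipschitz boundary; 2. $|\partial\Omega_j|\to 2$ as $j\to\infty$; 3. there is a constant $C(p,n)>0$ depending only on $p$ and $n$ such that $\sigma_{p,2}(\Omega_j)\ge C(p,n)\,j^{p-n}$ for all $j\ge1$; in particular $\sigma_{p,2}(\Omega_j)\to\infty$; 4. there are constants $c_1,c_2>0$ depending only on $p$ and $n$ such that $c_1 j^{n-1}\le D(\Omega_j)\le c_2 j^{n-1}$ for all $j\ge1$; 5. (the distortion is necessary in the upper bound $|\partial\Omega|^{\frac{p-1}{n-1}}\sigma_{p,k}(\Omega)\le C\,D(\Omega)^{\frac{p-n}{n-1}}k^{\frac{p-1}{n-1}}$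 for $p>n$, and its exponent is sharp) for no real number $q<\frac{p-n}{n-1}$ (in particular not for $q=0$) is there a constant $C$ such that $|\partial\Omega|^{\frac{p-1}{n-1}}\sigma_{p,2}(\Omega)\le C\,D(\Omega)^{q}$ for all bounded domains $\Omega\subset\mathbb R^n$ with Lipschitz boundary. -/

import Mathlib

open MeasureTheory Set Filter Topology
open scoped ENNReal NNReal ContDiff

noncomputable section

namespace Steklov

/-- Euclidean space `ℝⁿ`. -/
abbrev E (n : ℕ) : Type := EuclideanSpace ℝ (Fin n)

/-! ### Bounded Lipschitz domains, boundary measure, distortion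

The dimension of the ambient space is written `n = d + 1`, so that boundaries have dimension
`n - 1 = d`. -/

/-- `Ω` is a bounded domain (non-empty, open, connected) with Lipschitz boundary: near each of its
boundary points, `Ω` is the strict epigraph, in the direction of some unit vector `ν`, of a
Lipschitz function `g` on the hyperplane orthogonal to `ν` (`y - ⟪ν, y⟫ ν` is the projection of `y`
to this hyperplane, so only the restriction of `g` to the hyperplane matters). -/
structure IsBoundedLipschitzDomain {n : ℕ} (Ω : Set (E n)) : Prop where
  isOpen : IsOpen Ω
  isConnected : IsConnected Ω
  isBounded : Bornology.IsBounded Ω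
  lipschitz_boundary : ∀ x ∈ frontier Ω, ∃ ν : E n, ‖ν‖ = 1 ∧
    ∃ (K : ℝ≥0) (g : E n → ℝ), LipschitzWith K g ∧
      ∃ U ∈ 𝓝 x, ∀ y ∈ U, (y ∈ Ω ↔ g (y - inner ℝ ν y • ν) < inner ℝ ν y)

/-- The surface measure on `∂Ω`: the `(n-1)`-dimensional Hausdorff measure of `ℝⁿ`, `n = d + 1`
(normalized as usual, so that it is Lebesgue measure on hyperplanes), restricted to `∂Ω`. -/
def boundaryMeasure {d : ℕ} (Ω : Set (E (d + 1))) : Measure (E (d + 1)) :=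
  (Measure.euclideanHausdorffMeasure d).restrict (frontier Ω)

/-- `|∂Ω|`. -/
def perimeter {d : ℕ} (Ω : Set (E (d + 1))) : ℝ≥0∞ := boundaryMeasure Ω univ

/-- The `(n-1)`-distortion
`D(Ω) = sup_{x ∈ ℝⁿ, r > 0} |∂Ω ∩ B(x, r)| / (ω_{n-1} r^{n-1})`, where `n = d + 1` and `ω_d` is the
volume of the unit ball of `ℝᵈ`. -/
def distortion {d : ℕ} (Ω : Set (E (d + 1))) : ℝ≥0∞ :=
  ⨆ (x : E (d + 1)) (r : ℝ) (_ : 0 < r),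
    boundaryMeasure Ω (Metric.ball x r) /
      (volume (Metric.ball (0 : E d) 1) * ENNReal.ofReal r ^ d)

/-! ### The Sobolev space and traces -/

instance fact_one_le_ofReal {p : ℝ} [hp : Fact (1 < p)] : Fact (1 ≤ ENNReal.ofReal p) :=
  ⟨ENNReal.one_le_ofReal.2 hp.out.le⟩

/-- Pairs `(u, G)` with `u ∈ Lᵖ(Ω)` and `G ∈ Lᵖ(Ω; ℝⁿ)`, with the norm
`(‖u‖ₚᵖ + ‖G‖ₚᵖ)^(1/p)`. -/
abbrev LpPair {n : ℕ} (Ω : Set (E n)) (p : ℝ) : Type :=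
  WithLp (ENNReal.ofReal p)
    (Lp ℝ (ENNReal.ofReal p) (volume.restrict Ω) ×
      Lp (E n) (ENNReal.ofReal p) (volume.restrict Ω))

/-- `W^{1,p}(Ω)`, each function `u` being recorded together with its weak gradient `∇u` (which it
determines): the set of pairs `(u, G)` in `Lᵖ(Ω) × Lᵖ(Ω; ℝⁿ)` such that
`∫_Ω u ∂ᵢφ = - ∫_Ω Gᵢ φ` for all `φ ∈ C_c^∞(Ω)` and all `i`. The norm of the ambient space
restricts to the usual norm `(∫_Ω |∇u|ᵖ + |u|ᵖ)^(1/p)` of `W^{1,p}(Ω)`. -/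
def sobolevSpace {n : ℕ} (Ω : Set (E n)) (p : ℝ) : Set (LpPair Ω p) :=
  {w | ∀ φ : E n → ℝ, ContDiff ℝ ∞ φ → HasCompactSupport φ → tsupport φ ⊆ Ω → ∀ i : Fin n,
    ∫ x in Ω, w.fst x * fderiv ℝ φ x (EuclideanSpace.single i 1) =
      - ∫ x in Ω, w.snd x i * φ x}

/-- The boundary values of `u : Ω → ℝ`: `(Tu)(x) = lim_{r → 0⁺} ⨍_{Ω ∩ B(x, r)} u` for `x ∈ ∂Ω`.
For `u ∈ W^{1,p}(Ω)` on a bounded Lipschitz domain, the limit exists at almost every point of `∂Ω`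
and gives the trace of `u`; where `u` has a representative that is continuous on the closure of `Ω`
(everywhere, if `p > n`), `Tu` is the restriction of this representative to `∂Ω`. -/
def trace {n : ℕ} (Ω : Set (E n)) (u : E n → ℝ) (x : E n) : ℝ :=
  limUnder (𝓝[>] (0 : ℝ)) fun r => ⨍ y in Ω ∩ Metric.ball x r, u y

/-! ### Variational eigenvalues of the Steklov `p`-Laplacian -/

variable {d : ℕ} (Ω : Set (E (d + 1))) (p : ℝ)

/-- `∫_Ω |∇u|ᵖ dx`. -/
def energy (w : LpPair Ω p) : ℝ≥0∞ :=
  ∫⁻ x in Ω, ‖w.snd x‖ₑ ^ p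

/-- `‖u‖ᵖ` in `Lᵖ(∂Ω)`, that is, `∫_{∂Ω} |u|ᵖ dσ`. -/
def boundaryEnergy (w : LpPair Ω p) : ℝ≥0∞ :=
  ∫⁻ x, ‖trace Ω (fun y => w.fst y) x‖ₑ ^ p ∂(boundaryMeasure Ω)

/-- The Rayleigh quotient `∫_Ω |∇u|ᵖ / ∫_{∂Ω} |u|ᵖ`, with values in `[0, ∞]` (it is `∞` where only
the denominator vanishes). -/
def rayleigh (w : LpPair Ω p) : ℝ≥0∞ := energy Ω p w / boundaryEnergy Ω p w

/-- The Krasnoselskii genus of a subset `F` of a topological vector space: the least positive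
integer `ℓ` such that there is a continuous odd map `F → ℝ^ℓ ∖ {0}` (and `∞` if there is none). -/
def genus {V : Type*} [TopologicalSpace V] [Neg V] (F : Set V) : ℕ∞ :=
  ⨅ (ℓ : ℕ) (_ : 1 ≤ ℓ ∧ ∃ f : V → E ℓ, ContinuousOn f F ∧
    (∀ u ∈ F, f (-u) = - f u) ∧ ∀ u ∈ F, f u ≠ 0), (ℓ : ℕ∞)

/-- The class `Γ_k` of the symmetric sets `F ⊆ W^{1,p}(Ω) ∖ {0}` of genus at least `k` with compact
intersection with `{u : ‖u‖_{Lᵖ(∂Ω)} = 1}`. -/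
def admissible [Fact (1 < p)] (k : ℕ) : Set (Set (LpPair Ω p)) :=
  {F | F ⊆ sobolevSpace Ω p \ {0} ∧
    IsCompact (F ∩ {w | boundaryEnergy Ω p w = 1}) ∧
    (∀ w ∈ F, -w ∈ F) ∧ (k : ℕ∞) ≤ genus F}

/-- The variational eigenvalue `σ_{p,k}(Ω) = inf_{F ∈ Γ_k} sup_{u ∈ F} R_p(u)`. -/
def steklovEigenvalue [Fact (1 < p)] (k : ℕ) : ℝ≥0∞ :=
  ⨅ F ∈ admissible Ω p k, ⨆ w ∈ F, rayleigh Ω p w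

/-! ### Cubes with pyramids

Here `n = d + 1`, the first `n - 1` coordinates of `x` are the `x ℓ.castSucc`, `ℓ : Fin d`, and the
last one is `x (Fin.last d)`. -/

/-- `α = β - n + 1`. -/
def pyramidExponent (d : ℕ) (β : ℝ) : ℝ := β - ((d : ℝ) + 1) + 1

/-- `m(j) = [j^(β-1)] + 1`. -/
def subdivisions (β : ℝ) (j : ℕ) : ℕ := ⌊(j : ℝ) ^ (β - 1)⌋₊ + 1

/-- The closure of the cube `Q_j = (0, 1/j)ⁿ`. -/
def closedCube (d : ℕ) (j : ℕ) : Set (E (d + 1)) :=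
  {x | ∀ i, x i ∈ Icc (0 : ℝ) (1 / j)}

/-- The number `c_i = (1/2 + i) / (j m(j))`. -/
def baseCenter (β : ℝ) (j : ℕ) (i : ℕ) : ℝ :=
  1 / (j * subdivisions β j) * (1 / 2 + i)

/-- The closure of the `(n-1)`-dimensional cube with center `(c_{i_1}, …, c_{i_{n-1}}, 1/j)` and
side `1 / (j m(j))` in the upper face of the cube `Q_j`. -/
def closedBase (d : ℕ) (β : ℝ) (j : ℕ) (i : Fin d → Fin (subdivisions β j)) : Set (E (d + 1)) :=
  {x | (∀ ℓ : Fin d, x ℓ.castSucc ∈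
      Icc (baseCenter β j (i ℓ) - 1 / (2 * j * subdivisions β j))
        (baseCenter β j (i ℓ) + 1 / (2 * j * subdivisions β j))) ∧
    x (Fin.last d) = 1 / j}

/-- The vertex `(c_{i_1}, …, c_{i_{n-1}}, 1/j + 1/j^α)`. -/
def apex (d : ℕ) (β : ℝ) (j : ℕ) (i : Fin d → Fin (subdivisions β j)) : E (d + 1) :=
  WithLp.toLp 2 (Fin.snoc (α := fun _ => ℝ) (fun ℓ : Fin d => baseCenter β j (i ℓ))
    (1 / (j : ℝ) + 1 / (j : ℝ) ^ pyramidExponent d β))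

/-- The closed pyramid with the given base and vertex. -/
def closedPyramid (d : ℕ) (β : ℝ) (j : ℕ) (i : Fin d → Fin (subdivisions β j)) : Set (E (d + 1)) :=
  convexHull ℝ (insert (apex d β j i) (closedBase d β j i))

/-- The domain `Ω_j` (for the parameter `β`): the interior of the union of the closed cube and all
the closed pyramids on its upper face. -/
def pyramidDomain (d : ℕ) (β : ℝ) (j : ℕ) : Set (E (d + 1)) :=
  interior (closedCube d j ∪ ⋃ i : Fin d → Fin (subdivisions β j), closedPyramid d β j i)

/-- The choice `β = (p - n (n + p - n p)) / (p - n)`, with `n = d + 1`. -/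
def betaChoice (d : ℕ) (p : ℝ) : ℝ :=
  (p - ((d : ℝ) + 1) * (((d : ℝ) + 1) + p - ((d : ℝ) + 1) * p)) / (p - ((d : ℝ) + 1))

/-- The domain `Ω_j` in dimension `n = d + 1` for the exponent `p > n`. -/
def counterDomain (d : ℕ) (p : ℝ) (j : ℕ) : Set (E (d + 1)) :=
  pyramidDomain d (betaChoice d p) j

end Steklov

end

open Steklov

namespace Steklov

/-! ### A Morrey estimate for weakly differentiable functions on convex sets -/

/-! Write `n = d + 1`. For `j ≥ 1` the domain is a `spikyBox` with cube side `a = 1/j`, pyramid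
height `h = j^(d-β)` and mesh `s = 1/(j m(j))`, so its roof is a graph whose slope is everywhere
`2h/s`, which is about `2 j^d`. The area of the roof is `√(1 + (2h/s)²) a^d`, which tends to `2`,
while the other faces have total area `O(j^(-d))`. Since projections to hyperplanes do not increase
distances, the distortion is comparable to the slope, that is, to `j^d`.

The eigenvalue bound rests on Morrey's inequality, `HasWeakGradient.ae_abs_sub_ballWeight_le`: on a
convex set of diameter at most `R` containing a ball of radius `ρ`, a Sobolev function differs from
its weighted mean over the ball by at most `C R ρ^(-n/p) ‖∇u‖_p`. A set of genus at least two
contains a function `u` of weighted mean zero over the cube, because that mean is a continuous odd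
functional. Hence `|u| ≤ C a^(1-n/p) ‖∇u‖_p` on the cube. Each pyramid, extended by a box reaching
down into the cube, is convex, has diameter of order `h` and contains a ball of radius `s/2`;
comparison on the overlap with the cube adds an error `C h s^(-n/p) ‖∇u‖_p`. The exponent `β` is so
large that this error is at most of order `a^(1-n/p) ‖∇u‖_p` (`exists_spikyConst_le`). So `|u| ≤ C
j^(n/p-1) ‖∇u‖_p` throughout (`ae_abs_le_of_mean_zero`). The trace inherits this bound, the
perimeter is bounded, and therefore the Rayleigh quotient of `u` is at least `c j^(p-n)`.

With perimeter at least `2`, distortion of order `j^d` and eigenvalue at least `c j^(p-n)`, an upper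
bound by the distortion to a power `q < (p-n)/d` fails for large `j`.

Morrey's inequality itself is proved without smooth approximation: averages of `u` against dilations
of a bump about `x` are differentiable in the scale `t`, their derivative is `O(t^(-n/p))`, which is
integrable at `0` since `p > n`, and they tend to `u x` at Lebesgue points. -/

/-- `G` is the weak gradient of `u` on `D`. -/
def HasWeakGradient {n : ℕ} (D : Set (E n)) (u : E n → ℝ) (G : E n → E n) : Prop :=
  ∀ φ : E n → ℝ, ContDiff ℝ ∞ φ → HasCompactSupport φ → tsupport φ ⊆ D → ∀ i : Fin n,
    ∫ x in D, u x * fderiv ℝ φ x (EuclideanSpace.single i 1) = - ∫ x in D, G x i * φ x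

lemma HasWeakGradient.mono {n : ℕ} {D Ω : Set (E n)} {u : E n → ℝ} {G : E n → E n}
    (h : HasWeakGradient Ω u G) (hD : D ⊆ Ω) (hΩ : MeasurableSet Ω) : HasWeakGradient D u G := by
  intro φ h1 h2 h3 i
  have := h φ h1 h2 (h3.trans hD) i
  rwa [setIntegral_eq_of_subset_of_forall_sdiff_eq_zero hΩ hD,
    setIntegral_eq_of_subset_of_forall_sdiff_eq_zero hΩ hD] at this
  · intro x hx
    rw [image_eq_zero_of_notMem_tsupport fun hx' => hx.2 (h3 hx'), mul_zero]
  · intro x hx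
    have : fderiv ℝ φ x = 0 :=
      image_eq_zero_of_notMem_tsupport fun hx' => hx.2 (h3 (tsupport_fderiv_subset ℝ hx'))
    simp [this]

lemma integrable_mul_of_continuous {n : ℕ} {D : Set (E n)} {f φ : E n → ℝ}
    (hf : IntegrableOn f D) (hφ : Continuous φ) (hc : HasCompactSupport φ) :
    IntegrableOn (fun x => f x * φ x) D := by
  obtain ⟨C, hC⟩ := hφ.bounded_above_of_compact_support hc
  exact hf.mul_bdd hφ.aestronglyMeasurable (.of_forall hC)

lemma sum_smul_single {n : ℕ} (v : E n) : ∑ i, v i • EuclideanSpace.single i (1 : ℝ) = v := by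
  ext k
  simp [Pi.single_apply]

/-- Testing the weak gradient with the vector field `z ↦ ψ z • (z - x)`. -/
lemma HasWeakGradient.integral_radial {n : ℕ} {D : Set (E n)} {u : E n → ℝ} {G : E n → E n}
    (h : HasWeakGradient D u G) (hu : IntegrableOn u D) (hG : IntegrableOn G D) (x : E n)
    {ψ : E n → ℝ} (h1 : ContDiff ℝ ∞ ψ) (h2 : HasCompactSupport ψ) (h3 : tsupport ψ ⊆ D) :
    ∫ z in D, u z * (n * ψ z + fderiv ℝ ψ z (z - x)) = - ∫ z in D, inner ℝ (G z) (z - x) * ψ z := by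
  have hcoord (i : Fin n) : ContDiff ℝ ∞ fun z : E n => z i - x i := by fun_prop
  have hsm (i : Fin n) : ContDiff ℝ ∞ fun z : E n => ψ z * (z i - x i) := h1.mul (hcoord i)
  have hcs (i : Fin n) : HasCompactSupport fun z : E n => ψ z * (z i - x i) := h2.mul_right
  have hts (i : Fin n) : tsupport (fun z : E n => ψ z * (z i - x i)) ⊆ D :=
    (tsupport_mul_subset_left (f := ψ)).trans h3
  have hd (i : Fin n) (z : E n) :
      fderiv ℝ (fun z : E n => ψ z * (z i - x i)) z (EuclideanSpace.single i 1) =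
        ψ z + (z i - x i) * fderiv ℝ ψ z (EuclideanSpace.single i 1) := by
    have h5 : HasFDerivAt (fun z : E n => z i - x i) (EuclideanSpace.proj i : E n →L[ℝ] ℝ) z :=
      ((EuclideanSpace.proj i : E n →L[ℝ] ℝ).hasFDerivAt).sub_const _
    have h6 : fderiv ℝ (fun z : E n => ψ z * (z i - x i)) z = _ := ((h1.differentiable (by simp) z).hasFDerivAt.mul h5).fderiv
    rw [h6]
    simp
  -- The factor `n ψ + Dψ(z - x)` is the divergence of the field `ψ (z - x)`, so the coordinate
  -- identities need only be summed.
  have key (z : E n) : u z * (n * ψ z + fderiv ℝ ψ z (z - x)) =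
      ∑ i, u z * fderiv ℝ (fun z : E n => ψ z * (z i - x i)) z (EuclideanSpace.single i 1) := by
    simp_rw [hd, ← Finset.mul_sum, Finset.sum_add_distrib]
    congr 1
    conv_lhs => rw [← sum_smul_single (z - x)]
    simp
  have key2 (z : E n) : inner ℝ (G z) (z - x) * ψ z = ∑ i, G z i * (ψ z * (z i - x i)) := by
    rw [PiLp.inner_apply, Finset.sum_mul]
    refine Finset.sum_congr rfl fun i _ => ?_
    simp
    ring
  simp_rw [key, key2]
  rw [integral_finsetSum, integral_finsetSum, ← Finset.sum_neg_distrib]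
  · exact Finset.sum_congr rfl fun i _ => h _ (hsm i) (hcs i) (hts i) i
  · intro i _
    refine integrable_mul_of_continuous ?_ (hsm i).continuous (hcs i)
    exact (EuclideanSpace.proj i : E n →L[ℝ] ℝ).integrable_comp hG
  · intro i _
    refine integrable_mul_of_continuous hu ?_ ?_
    · exact ((hsm i).continuous_fderiv (by simp)).clm_apply continuous_const
    · exact (hcs i).fderiv_apply ℝ _

/-! ### Dilations of a bump about a point -/

/-- The mass-preserving dilation `z ↦ t⁻ⁿ φ(x + (z - x) / t)` of `φ` about `x`. -/
noncomputable def dilation {n : ℕ} (φ : E n → ℝ) (x : E n) (t : ℝ) (z : E n) : ℝ :=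
  (t⁻¹) ^ n * φ (x + t⁻¹ • (z - x))

section dilation

variable {n : ℕ} {φ : E n → ℝ} {x : E n} {t : ℝ}

lemma contDiff_dilation (hφ : ContDiff ℝ ∞ φ) : ContDiff ℝ ∞ (dilation φ x t) := by
  unfold dilation
  fun_prop

lemma dilation_ne_zero {z : E n} (h : dilation φ x t z ≠ 0) : φ (x + t⁻¹ • (z - x)) ≠ 0 :=
  right_ne_zero_of_mul h

lemma tsupport_dilation_subset (hφ : HasCompactSupport φ) (ht : 0 < t) :
    tsupport (dilation φ x t) ⊆ (fun y => x + t • (y - x)) '' tsupport φ := by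
  refine closure_minimal ?_ (hφ.isCompact.image (by fun_prop)).isClosed
  intro z hz
  refine ⟨x + t⁻¹ • (z - x), subset_closure (dilation_ne_zero hz), ?_⟩
  simp [smul_smul, ht.ne']

lemma hasCompactSupport_dilation (hφ : HasCompactSupport φ) (ht : 0 < t) :
    HasCompactSupport (dilation φ x t) :=
  (hφ.isCompact.image (by fun_prop : Continuous fun y => x + t • (y - x))).of_isClosed_subset
    (isClosed_tsupport _) (tsupport_dilation_subset hφ ht)

/-- For `t ≤ 1` the support is contracted towards `x`, along segments that stay in the convex set.
This keeps dilated bumps admissible as test functions. -/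
lemma tsupport_dilation_subset_of_convex {D : Set (E n)} (hD : Convex ℝ D) (hx : x ∈ D)
    (hφ : HasCompactSupport φ) (hs : tsupport φ ⊆ D) (ht : 0 < t) (ht1 : t ≤ 1) :
    tsupport (dilation φ x t) ⊆ D := by
  refine (tsupport_dilation_subset hφ ht).trans ?_
  rintro _ ⟨y, hy, rfl⟩
  have := hD hx (hs hy) (sub_nonneg.2 ht1) ht.le (by ring)
  convert this using 1
  module

lemma integral_dilation (ht : 0 < t) : ∫ z, dilation φ x t z = ∫ z, φ z := by
  simp only [dilation]
  rw [integral_const_mul, integral_sub_right_eq_self (fun z => φ (x + t⁻¹ • z)) x,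
    Measure.integral_comp_inv_smul volume (fun z => φ (x + z)) t, integral_add_left_eq_self]
  rw [finrank_euclideanSpace_fin, abs_of_pos (pow_pos ht n), smul_eq_mul, ← mul_assoc, inv_pow,
    inv_mul_cancel₀ (pow_pos ht n).ne', one_mul]

lemma fderiv_dilation (hφ : ContDiff ℝ ∞ φ) (z v : E n) :
    fderiv ℝ (dilation φ x t) z v =
      (t⁻¹) ^ n * (t⁻¹ * fderiv ℝ φ (x + t⁻¹ • (z - x)) v) := by
  have h1 : HasFDerivAt (fun z : E n => x + t⁻¹ • (z - x))
      (t⁻¹ • ContinuousLinearMap.id ℝ (E n)) z :=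
    (((hasFDerivAt_id z).sub_const x).const_smul t⁻¹).const_add x
  have h2 := ((hφ.differentiable (by simp) (x + t⁻¹ • (z - x))).hasFDerivAt.comp z h1).const_mul
    ((t⁻¹) ^ n)
  have h3 : fderiv ℝ (dilation φ x t) z = _ := h2.fderiv
  rw [h3]
  simp

/-- Dilation transports mass along the radial field, so the derivative in `t` is `-t⁻¹` times the
divergence of `φ_t (z - x)`. In this form it can be paired with a weak gradient. -/
lemma hasDerivAt_dilation (hφ : ContDiff ℝ ∞ φ) (ht : 0 < t) (z : E n) :
    HasDerivAt (fun t => dilation φ x t z)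
      (-t⁻¹ * (n * dilation φ x t z + fderiv ℝ (dilation φ x t) z (z - x))) t := by
  have h0 : HasDerivAt (fun t : ℝ => t⁻¹) (-(t ^ 2)⁻¹) t := hasDerivAt_inv ht.ne'
  have h1 : HasDerivAt (fun t : ℝ => x + t⁻¹ • (z - x)) ((-(t ^ 2)⁻¹) • (z - x)) t :=
    (h0.smul_const _).const_add x
  have h2 := (hφ.differentiable (by simp) (x + t⁻¹ • (z - x))).hasFDerivAt.comp_hasDerivAt t h1
  have h3 := (h0.pow n).mul h2
  refine h3.congr_deriv ?_
  rw [fderiv_dilation hφ]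
  simp only [dilation, map_smul, smul_eq_mul, Pi.pow_apply, Function.comp_apply]
  -- The derivative of the power contains `n - 1` with truncated subtraction, so `n = 0` is
  -- separate.
  rcases n with _ | k
  · simp
    ring
  · simp only [Nat.add_sub_cancel, pow_succ]
    push_cast
    field_simp
    ring

lemma dilation_nonneg (h : ∀ z, 0 ≤ φ z) (ht : 0 < t) (z : E n) : 0 ≤ dilation φ x t z :=
  mul_nonneg (by positivity) (h _)

lemma dilation_le {K : ℝ} (h : ∀ z, φ z ≤ K) (ht : 0 < t) (z : E n) :
    dilation φ x t z ≤ (t⁻¹) ^ n * K :=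
  mul_le_mul_of_nonneg_left (h _) (by positivity)

end dilation

/-- Averages of `u` against dilations of a fixed bump are differentiable in the scale. -/
lemma hasDerivAt_integral_dilation {n : ℕ} {D : Set (E n)} {u : E n → ℝ} {G : E n → E n}
    (h : HasWeakGradient D u G) (hu : IntegrableOn u D) (hG : IntegrableOn G D)
    (hDc : Convex ℝ D) (hDm : MeasurableSet D) {R : ℝ} (hR : ∀ y ∈ D, ∀ z ∈ D, ‖y - z‖ ≤ R)
    {φ : E n → ℝ}
    (hφ : ContDiff ℝ ∞ φ) (hφc : HasCompactSupport φ) (hφD : tsupport φ ⊆ D) {x : E n}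
    (hx : x ∈ D) {t : ℝ} (ht : 0 < t) (ht1 : t ≤ 1) :
    HasDerivAt (fun t => ∫ z in D, u z * dilation φ x t z)
      (t⁻¹ * ∫ z in D, inner ℝ (G z) (z - x) * dilation φ x t z) t := by
  have hRnn : 0 ≤ R := (norm_nonneg _).trans (hR x hx x hx)
  obtain ⟨C0, hC0⟩ := hφ.continuous.bounded_above_of_compact_support hφc
  obtain ⟨C1, hC1⟩ := (hφ.continuous_fderiv (by simp)).bounded_above_of_compact_support
    (hφc.fderiv ℝ)
  have hC0nn : 0 ≤ C0 := (norm_nonneg _).trans (hC0 x)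
  have hC1nn : 0 ≤ C1 := (norm_nonneg _).trans (hC1 x)
  have hdil (τ : ℝ) : Continuous (dilation φ x τ) := (contDiff_dilation hφ).continuous
  -- Differentiation under the integral takes place on `τ > t / 2`, where `c` bounds `τ⁻¹`.
  set c := (t / 2)⁻¹ with hc
  have hcpos : 0 < c := by positivity
  have main := hasDerivAt_integral_of_dominated_loc_of_deriv_le
    (μ := volume.restrict D) (x₀ := t) (s := Ioi (t / 2))
    (F := fun τ z => u z * dilation φ x τ z)
    (F' := fun τ z => u z *
      (-τ⁻¹ * (n * dilation φ x τ z + fderiv ℝ (dilation φ x τ) z (z - x))))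
    (bound := fun z => |u z| * (c * (n * (c ^ n * C0) + c ^ n * (c * (C1 * R)))))
    (Ioi_mem_nhds (by linarith)) ?_ ?_ ?_ ?_ ?_ ?_
  · refine main.2.congr_deriv ?_
    -- Integration by parts moves the divergence from the bump to the gradient of `u`; the
    -- assumption `t ≤ 1` is used here.
    have e := h.integral_radial hu hG x (contDiff_dilation hφ (t := t))
      (hasCompactSupport_dilation hφc ht)
      (tsupport_dilation_subset_of_convex hDc hx hφc hφD ht ht1)
    rw [← neg_eq_iff_eq_neg] at e
    rw [← e, ← integral_neg, ← integral_const_mul]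
    congr 1
    ext z
    ring
  · exact .of_forall fun τ => hu.aestronglyMeasurable.mul (hdil τ).aestronglyMeasurable
  · exact integrable_mul_of_continuous hu (hdil t) (hasCompactSupport_dilation hφc ht)
  · refine hu.aestronglyMeasurable.mul (Continuous.aestronglyMeasurable ?_)
    refine continuous_const.mul ((continuous_const.mul (hdil t)).add ?_)
    exact ((contDiff_dilation hφ).continuous_fderiv (by simp)).clm_apply (by fun_prop)
  · refine (ae_restrict_iff' hDm).2 (.of_forall fun z hz τ hτ => ?_)
    have hτ0 : 0 < τ := lt_trans (by positivity) (mem_Ioi.1 hτ)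
    have hτc : τ⁻¹ ≤ c := by
      rw [hc]
      exact inv_anti₀ (by positivity) (mem_Ioi.1 hτ).le
    have hτn : (τ⁻¹) ^ n ≤ c ^ n := by gcongr
    rw [norm_mul, Real.norm_eq_abs]
    gcongr
    rw [norm_mul, norm_neg, Real.norm_of_nonneg (by positivity : 0 ≤ τ⁻¹)]
    gcongr
    refine (norm_add_le _ _).trans ?_
    gcongr
    · rw [norm_mul, dilation, norm_mul, norm_pow, Real.norm_of_nonneg (by positivity : 0 ≤ τ⁻¹)]
      simp only [Real.norm_natCast]
      gcongr
      exact hC0 _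
    · rw [fderiv_dilation hφ, norm_mul, norm_mul, norm_pow,
        Real.norm_of_nonneg (by positivity : 0 ≤ τ⁻¹)]
      gcongr
      exact (ContinuousLinearMap.le_opNorm _ _).trans
        (mul_le_mul (hC1 _) (hR _ hz _ hx) (norm_nonneg _) hC1nn)
  · exact hu.abs.mul_const _
  · exact .of_forall fun z τ hτ => (hasDerivAt_dilation hφ
      (lt_trans (by positivity) (mem_Ioi.1 hτ)) z).const_mul _

/-- Hölder's inequality, together with `ψ^q ≤ T^(q-1) ψ`: a probability density bounded by `T` has
`L^q` norm at most `T^((q-1)/q) = T^(1/p)`. -/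
lemma integral_norm_mul_le {n : ℕ} {D : Set (E n)} {G : E n → E n} {p : ℝ} (hp : 1 < p)
    (hG : MemLp G (ENNReal.ofReal p) (volume.restrict D)) {ψ : E n → ℝ} (hψ : Continuous ψ)
    (hψc : HasCompactSupport ψ) (hψ0 : ∀ z, 0 ≤ ψ z) {T : ℝ} (hT : ∀ z, ψ z ≤ T)
    (h1 : ∫ z, ψ z = 1) :
    ∫ z in D, ‖G z‖ * ψ z ≤ (∫ z in D, ‖G z‖ ^ p) ^ (1 / p) * T ^ (1 / p) := by
  have hT0 : 0 ≤ T := (hψ0 0).trans (hT 0)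
  obtain ⟨q, hq⟩ : ∃ q, p.HolderConjugate q := ⟨_, Real.HolderConjugate.conjExponent hp⟩
  refine (integral_mul_le_Lp_mul_Lq_of_nonneg hq (.of_forall fun z => norm_nonneg _)
    (.of_forall hψ0) hG.norm ((hψ.memLp_of_hasCompactSupport hψc).restrict D)).trans ?_
  have hN : 0 ≤ ∫ z in D, ‖G z‖ ^ p := integral_nonneg fun z => by positivity
  gcongr
  have hint : Integrable ψ := hψ.integrable_of_hasCompactSupport hψc
  have h2 : ∫ z in D, ψ z ^ q ≤ T ^ (q - 1) := by
    calc ∫ z in D, ψ z ^ q ≤ ∫ z in D, T ^ (q - 1) * ψ z := by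
          refine integral_mono_of_nonneg (.of_forall fun z => by have := hψ0 z; positivity)
            (hint.const_mul _).restrict (.of_forall fun z => ?_)
          have : ψ z ^ q = ψ z ^ (q - 1) * ψ z := by
            conv_lhs => rw [← sub_add_cancel q 1,
              Real.rpow_add_one' (hψ0 z) (by simpa using hq.symm.pos.ne')]
          simp only [this]
          have hq1 := hq.symm.lt
          exact mul_le_mul_of_nonneg_right
            (Real.rpow_le_rpow (hψ0 z) (hT z) (by linarith)) (hψ0 z)
      _ = T ^ (q - 1) * ∫ z in D, ψ z := integral_const_mul _ _
      _ ≤ T ^ (q - 1) * 1 := by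
          gcongr
          rw [← h1]
          exact setIntegral_le_integral hint (.of_forall hψ0)
      _ = T ^ (q - 1) := mul_one _
  calc (∫ z in D, ψ z ^ q) ^ (1 / q) ≤ (T ^ (q - 1)) ^ (1 / q) := by
        refine Real.rpow_le_rpow (integral_nonneg fun z => ?_) h2 hq.symm.one_div_nonneg
        have := hψ0 z
        positivity
    _ = T ^ (1 / p) := by
        rw [← Real.rpow_mul hT0]
        congr 1
        have h3 := hq.symm.pos.ne'
        have h4 := hq.inv_add_inv_eq_one
        field_simp
        field_simp at h4
        linarith

/-- A Morrey estimate: on a convex set, a weakly differentiable function with `p`-integrable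
gradient, `p > n`, is close to its weighted average. -/
theorem HasWeakGradient.ae_abs_sub_integral_le {n : ℕ} {D : Set (E n)} {u : E n → ℝ}
    {G : E n → E n} (h : HasWeakGradient D u G) (hu : IntegrableOn u D) {p : ℝ} (hp : 1 < p)
    (hpn : n < p) (hG : MemLp G (ENNReal.ofReal p) (volume.restrict D)) (hDo : IsOpen D)
    (hDc : Convex ℝ D) {R : ℝ} (hR0 : 0 < R) (hR : ∀ y ∈ D, ∀ z ∈ D, ‖y - z‖ ≤ R)
    {φ : E n → ℝ} (hφ : ContDiff ℝ ∞ φ) (hφc : HasCompactSupport φ) (hφD : tsupport φ ⊆ D)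
    (hφ0 : ∀ z, 0 ≤ φ z) {K : ℝ} (hφK : ∀ z, φ z ≤ K) (hφ1 : ∫ z, φ z = 1) :
    ∀ᵐ x ∂(volume.restrict D), |u x - ∫ z in D, u z * φ z| ≤
      (1 - n / p)⁻¹ * (R * K ^ (1 / p) * (∫ z in D, ‖G z‖ ^ p) ^ (1 / p)) := by
  have hp0 : 0 < p := by linarith
  have hK0 : 0 ≤ K := (hφ0 0).trans (hφK 0)
  have hDm := hDo.measurableSet
  have hDfin : volume D < ⊤ := by
    refine (Metric.isBounded_iff.2 ⟨R, fun y hy z hz => ?_⟩ : Bornology.IsBounded D).measure_lt_top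
    rw [dist_eq_norm]
    exact hR y hy z hz
  have : IsFiniteMeasure (volume.restrict D) := ⟨by simpa using hDfin⟩
  have hGi : IntegrableOn G D := hG.integrable (ENNReal.one_le_ofReal.2 hp.le)
  set N := (∫ z in D, ‖G z‖ ^ p) ^ (1 / p) with hN
  have hN0 : 0 ≤ N := by
    have : 0 ≤ ∫ z in D, ‖G z‖ ^ p := integral_nonneg fun z => by positivity
    positivity
  set M := R * K ^ (1 / p) * N with hM
  have hM0 : 0 ≤ M := by positivity
  set γ := 1 - n / p with hγ
  have hγ0 : 0 < γ := by
    rw [hγ, sub_pos, div_lt_one hp0]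
    exact hpn
  have hball {x z : E n} {t : ℝ} (hx : x ∈ D) (ht : 0 < t) (hz : dilation φ x t z ≠ 0) :
      ‖z - x‖ ≤ t * R := by
    have h1 := hR _ (hφD (subset_closure (dilation_ne_zero hz))) _ hx
    rw [add_sub_cancel_left, norm_smul, Real.norm_of_nonneg (by positivity : 0 ≤ t⁻¹)] at h1
    rwa [inv_mul_le_iff₀ ht] at h1
  -- The factor `t⁻¹` cancels against `‖z - x‖ ≤ t R` on the support. Hölder's inequality leaves
  -- `(t⁻ⁿ K)^(1/p)`, hence the exponent `γ - 1 = -n/p`.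
  have hderiv {x : E n} (hx : x ∈ D) {t : ℝ} (ht : 0 < t) :
      ‖t⁻¹ * ∫ z in D, inner ℝ (G z) (z - x) * dilation φ x t z‖ ≤ M * t ^ (γ - 1) := by
    have hc := (contDiff_dilation hφ (x := x) (t := t)).continuous
    have hcs := hasCompactSupport_dilation hφc ht (x := x)
    have hT := dilation_le hφK ht (x := x)
    have h0 := dilation_nonneg hφ0 ht (x := x)
    have e1 := integral_norm_mul_le hp hG hc hcs h0 hT (by rw [integral_dilation ht, hφ1])
    have e2 : ‖∫ z in D, inner ℝ (G z) (z - x) * dilation φ x t z‖ ≤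
        ∫ z in D, (t * R) * (‖G z‖ * dilation φ x t z) := by
      refine norm_integral_le_of_norm_le
        ((integrable_mul_of_continuous hGi.norm hc hcs).const_mul _) (.of_forall fun z => ?_)
      rw [norm_mul, Real.norm_of_nonneg (h0 z), ← mul_assoc]
      by_cases hz : dilation φ x t z = 0
      · simp [hz]
      · refine mul_le_mul_of_nonneg_right ((norm_inner_le_norm _ _).trans ?_) (h0 z)
        rw [mul_comm]
        exact mul_le_mul_of_nonneg_right (hball hx ht hz) (norm_nonneg _)
    rw [integral_const_mul] at e2
    have e3 : ((t⁻¹) ^ n * K) ^ (1 / p) = t ^ (γ - 1) * K ^ (1 / p) := by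
      rw [Real.mul_rpow (by positivity) hK0, ← Real.rpow_natCast, ← Real.rpow_mul (by positivity),
        Real.inv_rpow ht.le, ← Real.rpow_neg ht.le]
      congr 2
      rw [hγ]
      ring
    rw [e3] at e1
    rw [norm_mul, Real.norm_of_nonneg (by positivity : 0 ≤ t⁻¹), inv_mul_le_iff₀ ht]
    calc _ ≤ _ := e2
      _ ≤ t * R * (N * (t ^ (γ - 1) * K ^ (1 / p))) := by gcongr
      _ = _ := by rw [hM]; ring
  have hdiff {x : E n} (hx : x ∈ D) {t : ℝ} (ht : 0 < t) (ht1 : t ≤ 1) :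
      |(∫ z in D, u z * φ z) - ∫ z in D, u z * dilation φ x t z| ≤ γ⁻¹ * M := by
    set A := fun t => ∫ z in D, u z * dilation φ x t z with hA
    have hAd (s : ℝ) (hs : 0 < s) (hs1 : s ≤ 1) :=
      hasDerivAt_integral_dilation h hu hGi hDc hDm hR hφ hφc hφD hx hs hs1
    have hA1 : A 1 = ∫ z in D, u z * φ z := by simp [hA, dilation]
    -- The barrier `γ⁻¹ M (s^γ - t^γ)` is the primitive of the derivative bound vanishing at `t`. It
    -- stays below `γ⁻¹ M` uniformly in `t` because `γ > 0`, that is, `p > n`.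
    have := image_norm_le_of_norm_deriv_right_le_deriv_boundary' (a := t) (b := 1)
      (f := fun s => A s - A t)
      (f' := fun s => s⁻¹ * ∫ z in D, inner ℝ (G z) (z - x) * dilation φ x s z)
      (B := fun s => γ⁻¹ * M * (s ^ γ - t ^ γ)) (B' := fun s => M * s ^ (γ - 1)) ?_ ?_ ?_ ?_ ?_ ?_
      (right_mem_Icc.2 ht1)
    · rw [hA1] at this
      refine this.trans ?_
      have h1 : (1 : ℝ) ^ γ - t ^ γ ≤ 1 := by
        rw [Real.one_rpow]
        linarith [Real.rpow_nonneg ht.le γ]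
      exact mul_le_of_le_one_right (by positivity) h1
    · exact fun s hs => ((hAd s (ht.trans_le hs.1) hs.2).sub_const _).continuousAt.continuousWithinAt
    · exact fun s hs => ((hAd s (ht.trans_le hs.1) hs.2.le).sub_const _).hasDerivWithinAt
    · simp
    · refine continuousOn_const.mul (ContinuousOn.sub (fun s hs => ?_) continuousOn_const)
      exact (Real.continuousAt_rpow_const s γ (.inl (ht.trans_le hs.1).ne')).continuousWithinAt
    · intro s hs
      have h1 := ((Real.hasDerivAt_rpow_const (p := γ) (.inl (ht.trans_le hs.1).ne')).sub_const
        (t ^ γ)).const_mul (γ⁻¹ * M)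
      refine (h1.congr_deriv ?_).hasDerivWithinAt
      field_simp
    · exact fun s hs => hderiv hx (ht.trans_le hs.1)
  set f := D.indicator u with hf
  have hfi : Integrable f := hu.integrable_indicator hDm
  have hleb := IsUnifLocDoublingMeasure.ae_tendsto_average_norm_sub
    (volume : Measure (E n)) hfi.locallyIntegrable 1
  rw [ae_restrict_iff' hDm]
  filter_upwards [hleb] with x hx hxD
  have hδ : Tendsto (fun t : ℝ => t * R) (𝓝[>] 0) (𝓝[>] 0) := by
    refine tendsto_nhdsWithin_iff.2 ⟨?_, ?_⟩
    · have : Tendsto (fun t : ℝ => t * R) (𝓝 0) (𝓝 (0 * R)) := tendsto_id.mul_const R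
      rw [zero_mul] at this
      exact this.mono_left nhdsWithin_le_nhds
    · filter_upwards [self_mem_nhdsWithin] with t ht
      exact mul_pos ht hR0
  have hav := hx (fun _ => x) (fun t : ℝ => t * R) hδ (by
    filter_upwards [self_mem_nhdsWithin] with t ht
    have : 0 < t := ht
    simp only [one_mul]
    exact Metric.mem_closedBall_self (by positivity))
  set V := R ^ n * (volume : Measure (E n)).real (Metric.ball 0 1)
  -- The dilated bump has mass one, is at most `t⁻ⁿ K` and lives in a ball of volume `tⁿ V`. The
  -- error is thus at most `K V` times the mean oscillation over that ball, which tends to zero at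
  -- Lebesgue points.
  have hlim : Tendsto (fun t : ℝ => ∫ z in D, u z * dilation φ x t z) (𝓝[>] 0) (𝓝 (u x)) := by
    rw [tendsto_iff_norm_sub_tendsto_zero]
    have hz := hav.const_mul (K * V)
    rw [mul_zero] at hz
    refine squeeze_zero' (.of_forall fun t => norm_nonneg _) ?_ hz
    filter_upwards [Ioc_mem_nhdsGT (zero_lt_one' ℝ)] with t ht
    have hc := (contDiff_dilation hφ (x := x) (t := t)).continuous
    have hcs := hasCompactSupport_dilation hφc ht.1 (x := x)
    have hT := dilation_le hφK ht.1 (x := x)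
    have h0 := dilation_nonneg hφ0 ht.1 (x := x)
    have hsub := tsupport_dilation_subset_of_convex hDc hxD hφc hφD ht.1 ht.2
    have hone : ∫ z in D, dilation φ x t z = 1 := by
      rw [setIntegral_eq_integral_of_forall_compl_eq_zero, integral_dilation ht.1, hφ1]
      exact fun z hz => image_eq_zero_of_notMem_tsupport fun h => hz (hsub h)
    have e1 : (∫ z in D, u z * dilation φ x t z) - u x =
        ∫ z in D, (u z - u x) * dilation φ x t z := by
      simp_rw [sub_mul]
      rw [integral_sub (integrable_mul_of_continuous hu hc hcs)
        (integrable_mul_of_continuous (integrableOn_const hDfin.ne) hc hcs), integral_const_mul,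
        hone, mul_one]
    have e2 : (∫ z in D, (u z - u x) * dilation φ x t z) =
        ∫ z in Metric.closedBall x (t * R), (f z - f x) * dilation φ x t z := by
      rw [setIntegral_eq_integral_of_forall_compl_eq_zero,
        setIntegral_eq_integral_of_forall_compl_eq_zero]
      · congr 1
        ext z
        by_cases hz : z ∈ D
        · simp [hf, hz, hxD]
        · rw [image_eq_zero_of_notMem_tsupport (f := dilation φ x t) fun h => hz (hsub h)]
          simp
      · intro z hz
        by_contra hne
        refine hz (mem_closedBall_iff_norm.2 (hball hxD ht.1 (right_ne_zero_of_mul hne)))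
      · exact fun z hz => by
          rw [image_eq_zero_of_notMem_tsupport (f := dilation φ x t) fun h => hz (hsub h), mul_zero]
    rw [e1, e2]
    have hfin : IsFiniteMeasure (volume.restrict (Metric.closedBall x (t * R))) :=
      ⟨by simpa using measure_closedBall_lt_top⟩
    calc ‖∫ z in Metric.closedBall x (t * R), (f z - f x) * dilation φ x t z‖
        ≤ ∫ z in Metric.closedBall x (t * R), ((t⁻¹) ^ n * K) * ‖f z - f x‖ := by
          refine norm_integral_le_of_norm_le
            (((hfi.integrableOn.sub (integrable_const _)).norm).const_mul _) (.of_forall fun z => ?_)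
          rw [norm_mul, Real.norm_of_nonneg (h0 z), mul_comm]
          exact mul_le_mul_of_nonneg_right (hT z) (norm_nonneg _)
      _ = K * V * ⨍ z in Metric.closedBall x (t * R), ‖f z - f x‖ := by
          rw [integral_const_mul, setAverage_eq, smul_eq_mul, ← mul_assoc]
          congr 1
          have htR : 0 < t * R := mul_pos ht.1 hR0
          have hpos : 0 < (volume : Measure (E n)).real (Metric.ball 0 1) :=
            ENNReal.toReal_pos (Metric.measure_ball_pos _ _ one_pos).ne' measure_ball_lt_top.ne
          rw [Measure.addHaar_real_closedBall _ _ htR.le, finrank_euclideanSpace_fin]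
          have := ht.1
          simp only [V]
          field_simp
          rw [mul_pow, one_div, inv_pow]
          field_simp
  refine le_of_tendsto ((hlim.sub_const _).abs) ?_
  filter_upwards [Ioc_mem_nhdsGT (zero_lt_one' ℝ)] with t ht
  rw [abs_sub_comm]
  exact hdiff hxD ht.1 ht.2

/-! ### Weights adapted to a ball and the scaled Morrey estimate -/

/-- The factor of `ρ⁻ⁿ` in the upper bound for the weights below. -/
noncomputable def ballWeightConst (n : ℕ) : ℝ :=
  4 ^ n / (volume : Measure (E n)).real (Metric.ball 0 1)

lemma volume_real_ball_pos (n : ℕ) : 0 < (volume : Measure (E n)).real (Metric.ball 0 1) :=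
  ENNReal.toReal_pos (Metric.measure_ball_pos _ _ one_pos).ne' measure_ball_lt_top.ne

lemma ballWeightConst_pos (n : ℕ) : 0 < ballWeightConst n :=
  div_pos (by positivity) (volume_real_ball_pos n)

/-- A smooth probability density supported in the ball of center `c` and radius `ρ`, with the
natural upper bound. -/
structure IsBallWeight {n : ℕ} (c : E n) (ρ : ℝ) (φ : E n → ℝ) : Prop where
  contDiff : ContDiff ℝ ∞ φ
  hasCompactSupport : HasCompactSupport φ
  tsupport_subset : tsupport φ ⊆ Metric.ball c ρ
  nonneg : ∀ z, 0 ≤ φ z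
  le : ∀ z, φ z ≤ ballWeightConst n * (ρ ^ n)⁻¹
  integral_eq_one : ∫ z, φ z = 1

lemma exists_isBallWeight {n : ℕ} (c : E n) {ρ : ℝ} (hρ : 0 < ρ) : ∃ φ, IsBallWeight c ρ φ := by
  -- The outer radius `ρ / 2` keeps the closed support in the open ball; the inner radius `ρ / 4` is
  -- the source of `4 ^ n` in `ballWeightConst`.
  let f : ContDiffBump c := ⟨ρ / 4, ρ / 2, by positivity, by linarith⟩
  refine ⟨f.normed volume, f.contDiff_normed, f.hasCompactSupport_normed, ?_, f.nonneg_normed, ?_,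
    f.integral_normed⟩
  · rw [f.tsupport_normed_eq]
    exact Metric.closedBall_subset_ball (by change ρ / 2 < ρ; linarith)
  · intro z
    refine (f.normed_le_div_measure_closedBall_rIn volume z).trans_eq ?_
    rw [Measure.addHaar_real_closedBall _ _ f.rIn_pos.le, finrank_euclideanSpace_fin]
    change 1 / ((ρ / 4) ^ n * _) = _
    have := volume_real_ball_pos n
    rw [ballWeightConst, div_pow]
    field_simp

/-- The constant in the Morrey estimate. -/
noncomputable def morreyConst (n : ℕ) (p : ℝ) : ℝ :=
  (1 - n / p)⁻¹ * ballWeightConst n ^ (1 / p)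

lemma morreyConst_pos {n : ℕ} {p : ℝ} (hp : 0 < p) (hpn : n < p) : 0 < morreyConst n p := by
  have h1 : 0 < 1 - n / p := by
    rw [sub_pos, div_lt_one hp]
    exact hpn
  have := ballWeightConst_pos n
  unfold morreyConst
  positivity

/-- Diameter and inner radius are kept apart because the pyramids are thin: there `R` is of order
`h` and `ρ` of order `s`. -/
theorem HasWeakGradient.ae_abs_sub_ballWeight_le {n : ℕ} {D : Set (E n)} {u : E n → ℝ}
    {G : E n → E n} (h : HasWeakGradient D u G) (hu : IntegrableOn u D) {p : ℝ} (hp : 1 < p)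
    (hpn : n < p) (hG : MemLp G (ENNReal.ofReal p) (volume.restrict D)) (hDo : IsOpen D)
    (hDc : Convex ℝ D) {R : ℝ} (hR0 : 0 < R) (hR : ∀ y ∈ D, ∀ z ∈ D, ‖y - z‖ ≤ R)
    {c : E n} {ρ : ℝ} (hρ : 0 < ρ) (hcD : Metric.ball c ρ ⊆ D) {φ : E n → ℝ}
    (hφ : IsBallWeight c ρ φ) :
    ∀ᵐ x ∂(volume.restrict D), |u x - ∫ z in D, u z * φ z| ≤
      morreyConst n p * (R * ((ρ ^ n)⁻¹) ^ (1 / p) * (∫ z in D, ‖G z‖ ^ p) ^ (1 / p)) := by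
  have := h.ae_abs_sub_integral_le hu hp hpn hG hDo hDc hR0 hR hφ.contDiff hφ.hasCompactSupport
    (hφ.tsupport_subset.trans hcD) hφ.nonneg hφ.le hφ.integral_eq_one
  convert this using 3
  rw [Real.mul_rpow (ballWeightConst_pos n).le (by positivity), morreyConst]
  ring

/-! ### Existence of the trace -/

/-- The homothety with centre `x` and ratio `t` takes a ball of `D` to a ball of radius `t ρ` inside
the convex set `D ∩ B(x, t R)`. Morrey's estimate there gives an oscillation of order `t ·
t^(-n/p)`, which tends to zero. So `u` is essentially continuous up to the boundary. -/
lemma HasWeakGradient.exists_ae_abs_sub_le {n : ℕ} {D : Set (E n)} {u : E n → ℝ}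
    {G : E n → E n} (h : HasWeakGradient D u G) (hu : IntegrableOn u D) {p : ℝ} (hp : 1 < p)
    (hpn : n < p) (hG : MemLp G (ENNReal.ofReal p) (volume.restrict D)) (hDo : IsOpen D)
    (hDc : Convex ℝ D) (hDb : Bornology.IsBounded D) {x : E n} (hx : x ∈ closure D) {ε : ℝ}
    (hε : 0 < ε) :
    ∃ r > 0, ∃ a : ℝ, ∀ᵐ y ∂(volume.restrict (D ∩ Metric.ball x r)), |u y - a| ≤ ε := by
  have hp0 : 0 < p := by linarith
  obtain ⟨R, hR0, hR⟩ : ∃ R > 0, D ⊆ Metric.ball x R := by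
    obtain ⟨R, hR⟩ := hDb.subset_ball x
    exact ⟨max R 1, by positivity, hR.trans (Metric.ball_subset_ball (le_max_left _ _))⟩
  obtain ⟨c, hc⟩ : D.Nonempty := closure_nonempty_iff.1 ⟨x, hx⟩
  obtain ⟨ρ, hρ, hcD⟩ := Metric.isOpen_iff.1 hDo c hc
  set N := (∫ z in D, ‖G z‖ ^ p) ^ (1 / p) with hN
  have hGint : IntegrableOn (fun z => ‖G z‖ ^ p) D := by
    have := hG.integrable_norm_rpow (by simpa using hp0) ENNReal.ofReal_ne_top
    rwa [ENNReal.toReal_ofReal hp0.le] at this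
  set γ := 1 - n / p with hγ
  have hγ0 : 0 < γ := by
    rw [hγ, sub_pos, div_lt_one hp0]
    exact hpn
  have hlim : Tendsto (fun t : ℝ => morreyConst n p * (2 * R * ((ρ ^ n)⁻¹) ^ (1 / p) * N) * t ^ γ)
      (𝓝[>] 0) (𝓝 0) := by
    have h1 : Tendsto (fun t : ℝ => t ^ γ) (𝓝[>] 0) (𝓝 0) := by
      have := (Real.continuousAt_rpow_const 0 γ (.inr hγ0.le)).tendsto
      rw [Real.zero_rpow hγ0.ne'] at this
      exact this.mono_left nhdsWithin_le_nhds
    simpa using h1.const_mul _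
  obtain ⟨t, htε, ht0, ht1⟩ :=
    ((hlim.eventually (gt_mem_nhds hε)).and (Ioc_mem_nhdsGT (zero_lt_one' ℝ))).exists
  have hpos : 0 < t * R := by positivity
  have hsub : Metric.ball (x + t • (c - x)) (t * ρ) ⊆ D ∩ Metric.ball x (t * R) := by
    intro z hz
    obtain ⟨w, rfl⟩ : ∃ w, z = x + t • (w - x) := ⟨x + t⁻¹ • (z - x), by simp [smul_smul, ht0.ne']⟩
    have hw : w ∈ D := by
      apply hcD
      rw [mem_ball_iff_norm] at hz ⊢
      have e : x + t • (w - x) - (x + t • (c - x)) = t • (w - c) := by module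
      rw [e, norm_smul, Real.norm_of_nonneg ht0.le] at hz
      exact lt_of_mul_lt_mul_left hz ht0.le
    constructor
    · have := hDc.combo_closure_interior_mem_interior hx (hDo.interior_eq.symm ▸ hw)
        (sub_nonneg.2 ht1) ht0 (by ring)
      rw [hDo.interior_eq] at this
      convert this using 1
      module
    · rw [mem_ball_iff_norm, add_sub_cancel_left, norm_smul, Real.norm_of_nonneg ht0.le]
      exact mul_lt_mul_of_pos_left (mem_ball_iff_norm.1 (hR hw)) ht0
  obtain ⟨φ, hφ⟩ := exists_isBallWeight (x + t • (c - x)) (mul_pos ht0 hρ)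
  have hD' : D ∩ Metric.ball x (t * R) ⊆ D := inter_subset_left
  have key := (h.mono hD' hDo.measurableSet).ae_abs_sub_ballWeight_le (hu.mono_set hD') hp hpn
    (hG.mono_measure (Measure.restrict_mono_set _ hD')) (hDo.inter Metric.isOpen_ball)
    (hDc.inter (convex_ball _ _)) (R := 2 * (t * R)) (by positivity) (fun y hy z hz => by
      have h1 := mem_ball_iff_norm.1 hy.2
      have h2 := mem_ball_iff_norm'.1 hz.2
      calc ‖y - z‖ = ‖(y - x) + (x - z)‖ := by congr 1; abel
        _ ≤ _ := norm_add_le _ _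
        _ ≤ _ := by linarith) (mul_pos ht0 hρ) hsub hφ
  refine ⟨t * R, hpos, _, key.mono fun y hy => hy.trans (le_trans ?_ htε.le)⟩
  have hN' : (∫ z in D ∩ Metric.ball x (t * R), ‖G z‖ ^ p) ^ (1 / p) ≤ N := by
    refine Real.rpow_le_rpow (integral_nonneg fun z => by positivity) ?_ (by positivity)
    exact setIntegral_mono_set hGint (.of_forall fun z => by positivity) hD'.eventuallyLE
  have e : (((t * ρ) ^ n)⁻¹) ^ (1 / p) * t = ((ρ ^ n)⁻¹) ^ (1 / p) * t ^ γ := by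
    rw [mul_pow, mul_inv, Real.mul_rpow (by positivity) (by positivity), mul_right_comm, mul_comm]
    congr 1
    rw [Real.inv_rpow (by positivity), ← Real.rpow_natCast, ← Real.rpow_mul ht0.le,
      ← Real.rpow_neg ht0.le, ← Real.rpow_add_one ht0.ne', hγ]
    congr 1
    ring
  have hm := morreyConst_pos hp0 hpn
  calc _ ≤ morreyConst n p * (2 * (t * R) * (((t * ρ) ^ n)⁻¹) ^ (1 / p) * N) := by gcongr
    _ = morreyConst n p * (2 * R * ((((t * ρ) ^ n)⁻¹) ^ (1 / p) * t) * N) := by ring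
    _ = _ := by rw [e]; ring

/-- Near `x`, each piece that touches `x` meets the piece `i₀` in a set of positive measure. A point
of that set compares the two approximating constants, and three errors of `ε / 3` add up. Pieces
away from `x` are avoided by a small radius. -/
lemma exists_ae_abs_sub_le_iUnion {n : ℕ} {ι : Type*} [Finite ι] {D : ι → Set (E n)}
    (hDo : ∀ i, IsOpen (D i)) {u : E n → ℝ} {x : E n} {ε : ℝ}
    (hloc : ∀ i, x ∈ closure (D i) → ∀ ε > 0, ∃ r > 0, ∃ a : ℝ,
      ∀ᵐ y ∂(volume.restrict (D i ∩ Metric.ball x r)), |u y - a| ≤ ε)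
    {i₀ : ι} (hover : ∀ i, x ∈ closure (D i) → x ∈ closure (D i ∩ D i₀)) (hε : 0 < ε) :
    ∃ r > 0, ∃ a : ℝ, ∀ᵐ y ∂(volume.restrict ((⋃ i, D i) ∩ Metric.ball x r)), |u y - a| ≤ ε := by
  have hall (i : ι) : ∃ r > 0, ∃ a : ℝ,
      (∀ᵐ y ∂(volume.restrict (D i ∩ Metric.ball x r)), |u y - a| ≤ ε / 3) ∧
        (x ∉ closure (D i) → D i ∩ Metric.ball x r = ∅) := by
    by_cases hi : x ∈ closure (D i)
    · obtain ⟨r, hr, a, ha⟩ := hloc i hi (ε / 3) (by positivity)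
      exact ⟨r, hr, a, ha, fun h => absurd hi h⟩
    · rw [Metric.mem_closure_iff] at hi
      push Not at hi
      obtain ⟨r, hr, hr'⟩ := hi
      refine ⟨r, hr, 0, ?_⟩
      have : D i ∩ Metric.ball x r = ∅ := by
        ext y
        simp only [mem_inter_iff, Metric.mem_ball', mem_empty_iff_false, iff_false, not_and, not_lt]
        exact hr' y
      simp [this]
  choose r hr a ha hemp using hall
  obtain ⟨r', hr', hrle⟩ : ∃ r' > 0, ∀ i, r' ≤ r i := by
    have : Nonempty ι := ⟨i₀⟩
    obtain ⟨i, hi⟩ := Finite.exists_min r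
    exact ⟨r i, hr i, hi⟩
  refine ⟨r', hr', a i₀, ?_⟩
  rw [iUnion_inter, ae_restrict_iUnion_iff]
  intro i
  by_cases hi : x ∈ closure (D i)
  · have hne : (D i ∩ D i₀ ∩ Metric.ball x r').Nonempty := by
      obtain ⟨y, hy, hxy⟩ := Metric.mem_closure_iff.1 (hover i hi) r' hr'
      exact ⟨y, hy, Metric.mem_ball'.2 hxy⟩
    have hpos := (((hDo i).inter (hDo i₀)).inter Metric.isOpen_ball).measure_pos volume hne
    have h1 : ∀ᵐ y ∂(volume.restrict (D i ∩ D i₀ ∩ Metric.ball x r')),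
        |u y - a i| ≤ ε / 3 ∧ |u y - a i₀| ≤ ε / 3 := by
      refine Filter.Eventually.and ?_ ?_
      · exact ae_restrict_of_ae_restrict_of_subset (inter_subset_inter inter_subset_left
          (Metric.ball_subset_ball (hrle i))) (ha i)
      · exact ae_restrict_of_ae_restrict_of_subset (inter_subset_inter inter_subset_right
          (Metric.ball_subset_ball (hrle i₀))) (ha i₀)
    have : (ae (volume.restrict (D i ∩ D i₀ ∩ Metric.ball x r'))).NeBot :=
      ae_restrict_neBot.2 hpos.ne'
    obtain ⟨y, hy1, hy2⟩ := h1.exists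
    have h2 := ae_restrict_of_ae_restrict_of_subset (inter_subset_inter Subset.rfl
      (Metric.ball_subset_ball (hrle i))) (ha i)
    refine h2.mono fun z hz => ?_
    rw [abs_le] at *
    constructor <;> linarith [hy1.1, hy1.2, hy2.1, hy2.2, hz.1, hz.2]
  · refine ae_restrict_of_ae_restrict_of_subset (t := ∅) ?_ (by simp)
    rw [← hemp i hi]
    exact inter_subset_inter Subset.rfl (Metric.ball_subset_ball (hrle i))

lemma setAverage_mem_closedBall {n : ℕ} {S : Set (E n)} {u : E n → ℝ} {a ε : ℝ}
    (hS : volume S ≠ 0) (hS' : volume S ≠ ⊤) (hu : IntegrableOn u S)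
    (h : ∀ᵐ y ∂(volume.restrict S), |u y - a| ≤ ε) : |(⨍ y in S, u y) - a| ≤ ε :=
  Convex.set_average_mem (convex_closedBall a ε) Metric.isClosed_closedBall hS hS' h hu

lemma volume_inter_ball_ne_zero {n : ℕ} {Ω : Set (E n)} (hΩ : IsOpen Ω) {x : E n}
    (hx : x ∈ closure Ω) {r : ℝ} (hr : 0 < r) : volume (Ω ∩ Metric.ball x r) ≠ 0 := by
  refine ((hΩ.inter Metric.isOpen_ball).measure_pos volume ?_).ne'
  obtain ⟨y, hy, hxy⟩ := Metric.mem_closure_iff.1 hx r hr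
  exact ⟨y, hy, Metric.mem_ball'.2 hxy⟩

/-- Small essential oscillation makes the averages Cauchy. Since `trace` is a `limUnder`, it carries
no information until this limit is known to exist. -/
lemma exists_tendsto_setAverage {n : ℕ} {Ω : Set (E n)} (hΩ : IsOpen Ω) {u : E n → ℝ}
    (hu : IntegrableOn u Ω) {x : E n} (hx : x ∈ closure Ω)
    (h : ∀ ε > 0, ∃ r > 0, ∃ a : ℝ,
      ∀ᵐ y ∂(volume.restrict (Ω ∩ Metric.ball x r)), |u y - a| ≤ ε) :
    ∃ l, Tendsto (fun r => ⨍ y in Ω ∩ Metric.ball x r, u y) (𝓝[>] (0 : ℝ)) (𝓝 l) := by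
  rw [← cauchy_map_iff_exists_tendsto, Metric.cauchy_iff]
  refine ⟨inferInstance, fun ε hε => ?_⟩
  obtain ⟨r, hr, a, ha⟩ := h (ε / 3) (by positivity)
  refine ⟨_, image_mem_map (Ioc_mem_nhdsGT hr), ?_⟩
  have key (s : ℝ) (hs : s ∈ Ioc 0 r) : |(⨍ y in Ω ∩ Metric.ball x s, u y) - a| ≤ ε / 3 :=
    setAverage_mem_closedBall (volume_inter_ball_ne_zero hΩ hx hs.1)
      (measure_lt_top_of_subset inter_subset_right measure_ball_lt_top.ne).ne
      (hu.mono_set inter_subset_left) (ae_restrict_of_ae_restrict_of_subset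
        (inter_subset_inter Subset.rfl (Metric.ball_subset_ball hs.2)) ha)
  rintro _ ⟨s, hs, rfl⟩ _ ⟨t, ht, rfl⟩
  have h1 := abs_le.1 (key s hs)
  have h2 := abs_le.1 (key t ht)
  rw [Real.dist_eq, abs_lt]
  constructor <;> linarith [h1.1, h1.2, h2.1, h2.2]

lemma abs_trace_le {n : ℕ} {Ω : Set (E n)} (hΩ : IsOpen Ω) {u : E n → ℝ}
    (hu : IntegrableOn u Ω) {x : E n} (hx : x ∈ closure Ω)
    (h : ∀ ε > 0, ∃ r > 0, ∃ a : ℝ,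
      ∀ᵐ y ∂(volume.restrict (Ω ∩ Metric.ball x r)), |u y - a| ≤ ε)
    {M : ℝ} (hM : ∀ᵐ y ∂(volume.restrict Ω), |u y| ≤ M) : |trace Ω u x| ≤ M := by
  obtain ⟨l, hl⟩ := exists_tendsto_setAverage hΩ hu hx h
  rw [trace, hl.limUnder_eq]
  refine le_of_tendsto hl.abs ?_
  filter_upwards [self_mem_nhdsWithin] with s hs
  have := setAverage_mem_closedBall (a := 0) (ε := M) (volume_inter_ball_ne_zero hΩ hx hs)
    (measure_lt_top_of_subset inter_subset_right measure_ball_lt_top.ne).ne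
    (hu.mono_set inter_subset_left) (ae_restrict_of_ae_restrict_of_subset inter_subset_left
      (by simpa using hM))
  simpa using this

/-! ### The geometry of cubes with pyramids -/

/-- The distance to the nearest integer. -/
noncomputable def latticeDist (y : ℝ) : ℝ := |y - round y|

lemma latticeDist_nonneg (y : ℝ) : 0 ≤ latticeDist y := abs_nonneg _

lemma latticeDist_le (y : ℝ) (z : ℤ) : latticeDist y ≤ |y - z| := round_le y z

lemma latticeDist_le_half (y : ℝ) : latticeDist y ≤ 1 / 2 := abs_sub_round y

lemma latticeDist_intCast (z : ℤ) : latticeDist z = 0 := by simp [latticeDist]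

lemma latticeDist_natCast (z : ℕ) : latticeDist z = 0 := by simp [latticeDist]

lemma latticeDist_le_add (y z : ℝ) : latticeDist y ≤ latticeDist z + |y - z| := by
  refine (latticeDist_le y (round z)).trans ?_
  have : y - round z = (z - round z) + (y - z) := by ring
  rw [this]
  exact abs_add_le _ _

lemma continuous_latticeDist : Continuous latticeDist := by
  refine (LipschitzWith.of_le_add fun y z => ?_).continuous
  rw [Real.dist_eq]
  exact latticeDist_le_add y z

lemma latticeDist_eq_min {y : ℝ} {i : ℤ} (h1 : i ≤ y) (h2 : y ≤ i + 1) :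
    latticeDist y = min (y - i) (i + 1 - y) := by
  apply le_antisymm
  · refine le_min ?_ ?_
    · have := latticeDist_le y i
      rwa [abs_of_nonneg (by linarith)] at this
    · have := latticeDist_le y (i + 1)
      rw [abs_of_nonpos (by push_cast; linarith)] at this
      push_cast at this
      linarith
  · rw [latticeDist]
    rcases le_or_gt (round y) i with h | h
    · have : (round y : ℝ) ≤ i := by exact_mod_cast h
      exact (min_le_left _ _).trans (le_trans (by linarith) (le_abs_self _))
    · have : (i : ℝ) + 1 ≤ round y := by exact_mod_cast h
      exact (min_le_right _ _).trans (le_trans (by linarith) (neg_le_abs _))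

/-- The open cube `(0, a)ⁿ` with pyramids of height `h` over a grid of mesh size `s` in its upper
face. -/
def spikyBox (d : ℕ) (a h s : ℝ) : Set (E (d + 1)) :=
  {x | (∀ ℓ : Fin d, x ℓ.castSucc ∈ Ioo 0 a) ∧ 0 < x (Fin.last d) ∧
    ∀ ℓ : Fin d, x (Fin.last d) < a + 2 * h * latticeDist (x ℓ.castSucc / s)}

/-- The closed version of `spikyBox`. -/
def closedSpikyBox (d : ℕ) (a h s : ℝ) : Set (E (d + 1)) :=
  {x | (∀ ℓ : Fin d, x ℓ.castSucc ∈ Icc 0 a) ∧ 0 ≤ x (Fin.last d) ∧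
    ∀ ℓ : Fin d, x (Fin.last d) ≤ a + 2 * h * latticeDist (x ℓ.castSucc / s)}

/-- The open cube `(0, a)ⁿ`. -/
def openCube (d : ℕ) (a : ℝ) : Set (E (d + 1)) :=
  {x | (∀ ℓ : Fin d, x ℓ.castSucc ∈ Ioo 0 a) ∧ x (Fin.last d) ∈ Ioo 0 a}

/-- The open pyramid over the cell with index `i`, together with a box of height `h` below it. -/
def spikeCell {d m : ℕ} (a h s : ℝ) (i : Fin d → Fin m) : Set (E (d + 1)) :=
  {x | (∀ ℓ : Fin d, x ℓ.castSucc ∈ Ioo (s * (i ℓ : ℝ)) (s * ((i ℓ : ℝ) + 1)) ∧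
      x (Fin.last d) < a + 2 * h * (x ℓ.castSucc / s - (i ℓ : ℝ)) ∧
      x (Fin.last d) < a + 2 * h * ((i ℓ : ℝ) + 1 - x ℓ.castSucc / s)) ∧
    a - h < x (Fin.last d)}

section

variable {d m : ℕ} {a h s : ℝ}

lemma continuous_coord (k : Fin (d + 1)) : Continuous fun x : E (d + 1) => x k := by fun_prop

lemma isOpen_spikyBox : IsOpen (spikyBox d a h s) := by
  have h1 (k : Fin (d + 1)) := continuous_coord (d := d) k
  have h2 (ℓ : Fin d) : Continuous fun x : E (d + 1) =>
      a + 2 * h * latticeDist (x ℓ.castSucc / s) := by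
    have := continuous_latticeDist
    fun_prop
  simp only [spikyBox, ofPred_and, ofPred_forall]
  refine (isOpen_iInter_of_finite fun ℓ => isOpen_Ioo.preimage (h1 _)).inter
    ((isOpen_Ioi.preimage (h1 _)).inter (isOpen_iInter_of_finite fun ℓ => isOpen_lt (h1 _) (h2 ℓ)))

lemma isClosed_closedSpikyBox : IsClosed (closedSpikyBox d a h s) := by
  have h1 (k : Fin (d + 1)) := continuous_coord (d := d) k
  have h2 (ℓ : Fin d) : Continuous fun x : E (d + 1) =>
      a + 2 * h * latticeDist (x ℓ.castSucc / s) := by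
    have := continuous_latticeDist
    fun_prop
  simp only [closedSpikyBox, ofPred_and, ofPred_forall]
  refine (isClosed_iInter fun ℓ => isClosed_Icc.preimage (h1 _)).inter
    ((isClosed_Ici.preimage (h1 _)).inter (isClosed_iInter fun ℓ => isClosed_le (h1 _) (h2 ℓ)))

lemma spikyBox_subset_closedSpikyBox : spikyBox d a h s ⊆ closedSpikyBox d a h s :=
  fun _ hx => ⟨fun ℓ => Ioo_subset_Icc_self (hx.1 ℓ), hx.2.1.le, fun ℓ => (hx.2.2 ℓ).le⟩

lemma closure_spikyBox_subset : closure (spikyBox d a h s) ⊆ closedSpikyBox d a h s :=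
  closure_minimal spikyBox_subset_closedSpikyBox isClosed_closedSpikyBox

lemma exists_add_smul_mem_of_mem_interior {n : ℕ} {C : Set (E n)} {x : E n} (hx : x ∈ interior C)
    (v : E n) : ∃ δ > 0, x + (δ : ℝ) • v ∈ C := by
  have h1 : Tendsto (fun δ : ℝ => x + δ • v) (𝓝[>] 0) (𝓝 x) := by
    have : Continuous fun δ : ℝ => x + δ • v := by fun_prop
    have := this.tendsto 0
    simp only [zero_smul, add_zero] at this
    exact this.mono_left nhdsWithin_le_nhds
  obtain ⟨δ, h2, h3⟩ := ((h1.eventually (mem_interior_iff_mem_nhds.1 hx)).and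
    self_mem_nhdsWithin).exists
  exact ⟨δ, h3, h2⟩

/-- An interior point can be moved a little in every coordinate direction, so none of the
inequalities can be an equality; the roof inequalities are tested by moving upwards. -/
lemma interior_closedSpikyBox : interior (closedSpikyBox d a h s) = spikyBox d a h s := by
  refine Subset.antisymm (fun x hx => ?_)
    (interior_maximal spikyBox_subset_closedSpikyBox isOpen_spikyBox)
  have hxC := interior_subset hx
  have hp (k : Fin (d + 1)) (c : ℝ) := exists_add_smul_mem_of_mem_interior hx
    (EuclideanSpace.single k c)
  refine ⟨fun ℓ => ⟨lt_of_le_of_ne (hxC.1 ℓ).1 fun h0 => ?_,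
    lt_of_le_of_ne (hxC.1 ℓ).2 fun h0 => ?_⟩,
    lt_of_le_of_ne hxC.2.1 fun h0 => ?_, fun ℓ => lt_of_le_of_ne (hxC.2.2 ℓ) fun h0 => ?_⟩
  · obtain ⟨δ, hδ, hm⟩ := hp ℓ.castSucc (-1)
    have := (hm.1 ℓ).1
    simp at this
    linarith
  · obtain ⟨δ, hδ, hm⟩ := hp ℓ.castSucc 1
    have := (hm.1 ℓ).2
    simp at this
    linarith
  · obtain ⟨δ, hδ, hm⟩ := hp (Fin.last d) (-1)
    have := hm.2.1
    simp at this
    linarith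
  · obtain ⟨δ, hδ, hm⟩ := hp (Fin.last d) 1
    have := hm.2.2 ℓ
    have hne : ℓ.castSucc ≠ Fin.last d := (Fin.castSucc_lt_last ℓ).ne
    simp [hne] at this
    linarith

lemma isOpen_openCube : IsOpen (openCube d a) := by
  have h1 (k : Fin (d + 1)) := continuous_coord (d := d) k
  simp only [openCube, ofPred_and, ofPred_forall]
  exact (isOpen_iInter_of_finite fun ℓ => isOpen_Ioo.preimage (h1 _)).inter
    (isOpen_Ioo.preimage (h1 _))

lemma convex_openCube : Convex ℝ (openCube d a) := by
  intro x hx y hy b c hb hc hbc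
  exact ⟨fun ℓ => convex_Ioo (0 : ℝ) a (hx.1 ℓ) (hy.1 ℓ) hb hc hbc,
    convex_Ioo (0 : ℝ) a hx.2 hy.2 hb hc hbc⟩

lemma isOpen_spikeCell (i : Fin d → Fin m) : IsOpen (spikeCell a h s i) := by
  have h1 (k : Fin (d + 1)) := continuous_coord (d := d) k
  simp only [spikeCell, ofPred_and, ofPred_forall]
  refine (isOpen_iInter_of_finite fun ℓ => (isOpen_Ioo.preimage (h1 _)).inter
    ((isOpen_lt (h1 _) ?_).inter (isOpen_lt (h1 _) ?_))).inter (isOpen_lt continuous_const (h1 _))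
  · fun_prop
  · fun_prop

lemma convex_spikeCell (i : Fin d → Fin m) : Convex ℝ (spikeCell a h s i) := by
  intro x hx y hy b c hb hc hbc
  refine ⟨fun ℓ => ⟨convex_Ioo _ _ (hx.1 ℓ).1 (hy.1 ℓ).1 hb hc hbc, ?_, ?_⟩,
    mem_Ioi.1 (convex_Ioi (a - h) (mem_Ioi.2 hx.2) (mem_Ioi.2 hy.2) hb hc hbc)⟩
  · have h1 := convex_Ioi (0 : ℝ) (sub_pos.2 (hx.1 ℓ).2.1) (sub_pos.2 (hy.1 ℓ).2.1) hb hc hbc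
    rw [mem_Ioi] at h1
    rw [← sub_pos]
    refine h1.trans_eq ?_
    obtain rfl : b = 1 - c := by linarith
    simp
    ring
  · have h1 := convex_Ioi (0 : ℝ) (sub_pos.2 (hx.1 ℓ).2.2) (sub_pos.2 (hy.1 ℓ).2.2) hb hc hbc
    rw [mem_Ioi] at h1
    rw [← sub_pos]
    refine h1.trans_eq ?_
    obtain rfl : b = 1 - c := by linarith
    simp
    ring

lemma closure_spikeCell_subset (i : Fin d → Fin m) : closure (spikeCell a h s i) ⊆
    {x | (∀ ℓ : Fin d, x ℓ.castSucc ∈ Icc (s * (i ℓ : ℝ)) (s * ((i ℓ : ℝ) + 1)) ∧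
      x (Fin.last d) ≤ a + 2 * h * (x ℓ.castSucc / s - (i ℓ : ℝ)) ∧
      x (Fin.last d) ≤ a + 2 * h * ((i ℓ : ℝ) + 1 - x ℓ.castSucc / s)) ∧
    a - h ≤ x (Fin.last d)} := by
  refine closure_minimal (fun x hx => ⟨fun ℓ => ⟨Ioo_subset_Icc_self (hx.1 ℓ).1,
    (hx.1 ℓ).2.1.le, (hx.1 ℓ).2.2.le⟩, hx.2.le⟩) ?_
  have h1 (k : Fin (d + 1)) := continuous_coord (d := d) k
  simp only [ofPred_and, ofPred_forall]
  refine (isClosed_iInter fun ℓ => (isClosed_Icc.preimage (h1 _)).inter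
    ((isClosed_le (h1 _) ?_).inter (isClosed_le (h1 _) ?_))).inter
      (isClosed_le continuous_const (h1 _))
  · fun_prop
  · fun_prop

lemma mem_closure_of_openSegment {n : ℕ} {U : Set (E n)} {x y : E n}
    (h : openSegment ℝ x y ⊆ U) : x ∈ closure U :=
  closure_mono h (segment_subset_closure_openSegment (left_mem_segment ℝ x y))

lemma mem_closure_openCube (ha : 0 < a) {x : E (d + 1)} (h1 : ∀ ℓ : Fin d, x ℓ.castSucc ∈ Icc 0 a)
    (h2 : x (Fin.last d) ∈ Icc 0 a) : x ∈ closure (openCube d a) := by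
  refine mem_closure_of_openSegment (y := WithLp.toLp 2 fun _ => a / 2) ?_
  rintro _ ⟨b, c, hb, hc, hbc, rfl⟩
  have key (t : ℝ) (ht : t ∈ Icc 0 a) : b * t + c * (a / 2) ∈ Ioo 0 a := by
    obtain rfl : b = 1 - c := by linarith
    have := mul_le_mul_of_nonneg_left ht.2 hb.le
    have := mul_nonneg hb.le ht.1
    constructor <;> nlinarith [mul_pos hc ha]
  exact ⟨fun ℓ => key _ (h1 ℓ), key _ h2⟩

/-- The open segment from `x` to a common point lies in both sets by convexity. -/
lemma mem_closure_inter_of_convex {n : ℕ} {U V : Set (E n)} (hU : IsOpen U) (hV : IsOpen V)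
    (hUc : Convex ℝ U) (hVc : Convex ℝ V) (hne : (U ∩ V).Nonempty) {x : E n} (hxU : x ∈ closure U)
    (hxV : x ∈ closure V) : x ∈ closure (U ∩ V) := by
  obtain ⟨y, hyU, hyV⟩ := hne
  refine mem_closure_of_openSegment (y := y) (subset_inter ?_ ?_)
  · have := hUc.openSegment_closure_interior_subset_interior hxU (hU.interior_eq.symm ▸ hyU)
    rwa [hU.interior_eq] at this
  · have := hVc.openSegment_closure_interior_subset_interior hxV (hV.interior_eq.symm ▸ hyV)
    rwa [hV.interior_eq] at this

/-- The index of the cell containing a point. -/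
lemma exists_cell_index (hs : 0 < s) (hm : a = m * s) {t : Fin d → ℝ}
    (ht : ∀ ℓ, t ℓ ∈ Icc 0 a) (hpos : ∀ ℓ, 0 < latticeDist (t ℓ / s)) :
    ∃ i : Fin d → Fin m, ∀ ℓ, t ℓ / s ∈ Ioo (i ℓ : ℝ) ((i ℓ : ℝ) + 1) := by
  have (ℓ : Fin d) : ∃ k : Fin m, t ℓ / s ∈ Ioo (k : ℝ) ((k : ℝ) + 1) := by
    have h0 : 0 ≤ t ℓ / s := div_nonneg (ht ℓ).1 hs.le
    have h1 : t ℓ / s ≤ m := by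
      rw [div_le_iff₀ hs, ← hm]
      exact (ht ℓ).2
    have hne (k : ℕ) : t ℓ / s ≠ k := by
      intro h
      have := hpos ℓ
      rw [h, latticeDist_natCast] at this
      exact lt_irrefl _ this
    refine ⟨⟨⌊t ℓ / s⌋₊, ?_⟩, lt_of_le_of_ne (Nat.floor_le h0) (hne _).symm,
      Nat.lt_floor_add_one _⟩
    rw [Nat.floor_lt h0]
    exact lt_of_le_of_ne h1 (hne m)
  exact ⟨fun ℓ => (this ℓ).choose, fun ℓ => (this ℓ).choose_spec⟩

lemma latticeDist_eq_min_nat {y : ℝ} {i : ℕ} (h1 : i ≤ y) (h2 : y ≤ i + 1) :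
    latticeDist y = min (y - i) (i + 1 - y) :=
  latticeDist_eq_min (i := i) (by exact_mod_cast h1) (by exact_mod_cast h2)

lemma cell_subset (hs : 0 < s) (hm : a = m * s) (k : Fin m) :
    0 ≤ s * (k : ℝ) ∧ s * ((k : ℝ) + 1) ≤ a := by
  refine ⟨by positivity, ?_⟩
  rw [hm, mul_comm]
  have : ((k : ℕ) : ℝ) + 1 ≤ m := by exact_mod_cast k.2
  gcongr

/-- A point at height at least `a` cannot lie over a grid hyperplane, so its cell is determined, and
there `latticeDist` is the minimum of two affine functions. The result is a finite cover by convex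
sets, to which Morrey's estimate applies. -/
lemma spikyBox_eq_union (hs : 0 < s) (hh : 0 < h) (hha : h ≤ a) (hm : a = m * s) :
    spikyBox d a h s = openCube d a ∪ ⋃ i : Fin d → Fin m, spikeCell a h s i := by
  ext x
  constructor
  · intro hx
    rcases lt_or_ge (x (Fin.last d)) a with hlt | hge
    · exact .inl ⟨hx.1, hx.2.1, hlt⟩
    · right
      have hpos (ℓ : Fin d) : 0 < latticeDist (x ℓ.castSucc / s) := by
        have := hx.2.2 ℓ
        by_contra hcon
        have h0 : latticeDist (x ℓ.castSucc / s) = 0 :=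
          le_antisymm (not_lt.1 hcon) (latticeDist_nonneg _)
        rw [h0] at this
        linarith
      obtain ⟨i, hi⟩ := exists_cell_index (t := fun ℓ : Fin d => x ℓ.castSucc) hs hm
        (fun ℓ => Ioo_subset_Icc_self (hx.1 ℓ)) hpos
      refine mem_iUnion.2 ⟨i, fun ℓ => ⟨⟨?_, ?_⟩, ?_⟩, by linarith⟩
      · rw [mul_comm, ← lt_div_iff₀ hs]
        exact (hi ℓ).1
      · rw [mul_comm, ← div_lt_iff₀ hs]
        exact (hi ℓ).2
      · have h1 := hx.2.2 ℓ
        rw [latticeDist_eq_min_nat (hi ℓ).1.le (hi ℓ).2.le] at h1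
        have h2 := mul_le_mul_of_nonneg_left (min_le_left (x ℓ.castSucc / s - (i ℓ : ℝ))
          ((i ℓ : ℝ) + 1 - x ℓ.castSucc / s)) (by positivity : 0 ≤ 2 * h)
        have h3 := mul_le_mul_of_nonneg_left (min_le_right (x ℓ.castSucc / s - (i ℓ : ℝ))
          ((i ℓ : ℝ) + 1 - x ℓ.castSucc / s)) (by positivity : 0 ≤ 2 * h)
        constructor <;> linarith
  · rintro (hx | hx)
    · refine ⟨hx.1, hx.2.1, fun ℓ => hx.2.2.trans_le ?_⟩
      have := latticeDist_nonneg (x ℓ.castSucc / s)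
      have : 0 ≤ 2 * h * latticeDist (x ℓ.castSucc / s) := by positivity
      linarith
    · obtain ⟨i, hi⟩ := mem_iUnion.1 hx
      refine ⟨fun ℓ => ?_, by linarith [hi.2], fun ℓ => ?_⟩
      · have h1 := cell_subset hs hm (i ℓ)
        exact ⟨h1.1.trans_lt (hi.1 ℓ).1.1, (hi.1 ℓ).1.2.trans_le h1.2⟩
      · have h1 : (i ℓ : ℝ) ≤ x ℓ.castSucc / s := by
          rw [le_div_iff₀ hs, mul_comm]
          exact (hi.1 ℓ).1.1.le
        have h2 : x ℓ.castSucc / s ≤ (i ℓ : ℝ) + 1 := by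
          rw [div_le_iff₀ hs, mul_comm]
          exact (hi.1 ℓ).1.2.le
        rw [latticeDist_eq_min_nat h1 h2]
        rcases min_choice (x ℓ.castSucc / s - (i ℓ : ℝ)) ((i ℓ : ℝ) + 1 - x ℓ.castSucc / s) with
          he | he
        · rw [he]
          exact (hi.1 ℓ).2.1
        · rw [he]
          exact (hi.1 ℓ).2.2

lemma toLp_snoc_castSucc (t : Fin d → ℝ) (b : ℝ) (ℓ : Fin d) :
    (WithLp.toLp 2 (Fin.snoc (α := fun _ => ℝ) t b) : E (d + 1)) ℓ.castSucc = t ℓ := by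
  simp

lemma toLp_snoc_last (t : Fin d → ℝ) (b : ℝ) :
    (WithLp.toLp 2 (Fin.snoc (α := fun _ => ℝ) t b) : E (d + 1)) (Fin.last d) = b := by
  simp

/-- Each pyramid is cut out by `a ≤ x_n` and two affine inequalities per horizontal coordinate. Over
its cell these say that `x_n` is at most `a + 2 h` times the distance to the nearest grid
hyperplane, so all pyramids are described by one formula. -/
lemma closedCube_union_closedPyramid {β : ℝ} {j : ℕ} (hd : 1 ≤ d) (hj : 1 ≤ j) :
    (closedCube d j ∪ ⋃ i : Fin d → Fin (subdivisions β j), closedPyramid d β j i) =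
      closedSpikyBox d (1 / j) (1 / (j : ℝ) ^ pyramidExponent d β)
        (1 / (j * subdivisions β j)) := by
  have hj0 : (0 : ℝ) < j := by exact_mod_cast hj
  have hM0 : (0 : ℝ) < subdivisions β j := by
    unfold subdivisions
    positivity
  obtain ⟨s, hs⟩ : ∃ s : ℝ, s = 1 / (j * subdivisions β j) := ⟨_, rfl⟩
  obtain ⟨h, hh⟩ : ∃ h : ℝ, h = 1 / (j : ℝ) ^ pyramidExponent d β := ⟨_, rfl⟩
  obtain ⟨a, ha⟩ : ∃ a : ℝ, a = 1 / j := ⟨_, rfl⟩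
  have hs0 : 0 < s := by rw [hs]; positivity
  have hh0 : 0 < h := by rw [hh]; positivity
  have ha0 : 0 < a := by rw [ha]; positivity
  have ham : a = subdivisions β j * s := by rw [ha, hs]; field_simp
  have hhalf : 1 / (2 * j * (subdivisions β j : ℝ)) = s / 2 := by
    rw [hs]
    field_simp
  have hcenter (k : ℕ) : baseCenter β j k = s * (k + 1 / 2) := by
    rw [baseCenter, ← hs]
    ring
  have hpyr (i : Fin d → Fin (subdivisions β j)) : closedPyramid d β j i =
      {x | (∀ ℓ : Fin d, x (Fin.last d) ≤ a + 2 * h * (x ℓ.castSucc / s - (i ℓ : ℝ)) ∧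
        x (Fin.last d) ≤ a + 2 * h * ((i ℓ : ℝ) + 1 - x ℓ.castSucc / s)) ∧
        a ≤ x (Fin.last d)} := by
    unfold closedPyramid
    apply Subset.antisymm
    · refine convexHull_min ?_ ?_
      · rintro x (rfl | hx)
        · refine ⟨fun ℓ => ?_, ?_⟩
          · rw [apex, toLp_snoc_castSucc, toLp_snoc_last, hcenter, ← hh, ← ha]
            constructor
            · apply le_of_eq
              field_simp
              ring
            · apply le_of_eq
              field_simp
              ring
          · rw [apex, toLp_snoc_last, ← hh, ← ha]
            linarith
        · refine ⟨fun ℓ => ?_, by rw [hx.2, ha]⟩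
          have h1 := hx.1 ℓ
          rw [hx.2, ← ha]
          rw [hcenter, hhalf] at h1
          have h2 : (i ℓ : ℝ) ≤ x ℓ.castSucc / s := by
            rw [le_div_iff₀ hs0]
            linarith [h1.1]
          have h3 : x ℓ.castSucc / s ≤ (i ℓ : ℝ) + 1 := by
            rw [div_le_iff₀ hs0]
            linarith [h1.2]
          constructor
          · have : 0 ≤ 2 * h * (x ℓ.castSucc / s - (i ℓ : ℝ)) :=
              mul_nonneg (by positivity) (by linarith)
            linarith
          · have : 0 ≤ 2 * h * ((i ℓ : ℝ) + 1 - x ℓ.castSucc / s) :=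
              mul_nonneg (by positivity) (by linarith)
            linarith
      · intro x hx y hy b c hb hc hbc
        refine ⟨fun ℓ => ⟨?_, ?_⟩, mem_Ici.1 (convex_Ici a (mem_Ici.2 hx.2) (mem_Ici.2 hy.2) hb hc hbc)⟩
        · have h1 := convex_Ici (0 : ℝ) (sub_nonneg.2 (hx.1 ℓ).1) (sub_nonneg.2 (hy.1 ℓ).1)
            hb hc hbc
          rw [mem_Ici] at h1
          rw [← sub_nonneg]
          refine h1.trans_eq ?_
          obtain rfl : b = 1 - c := by linarith
          simp
          ring
        · have h1 := convex_Ici (0 : ℝ) (sub_nonneg.2 (hx.1 ℓ).2) (sub_nonneg.2 (hy.1 ℓ).2)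
            hb hc hbc
          rw [mem_Ici] at h1
          rw [← sub_nonneg]
          refine h1.trans_eq ?_
          obtain rfl : b = 1 - c := by linarith
          simp
          ring
    · intro x hx
      have hapex : apex d β j i ∈ convexHull ℝ (insert (apex d β j i) (closedBase d β j i)) :=
        subset_convexHull ℝ _ (mem_insert _ _)
      -- The relative height `t` is the weight of the apex: `x` is `t` times the apex plus `1 - t`
      -- times a point of the base, and `t = 1` forces `x` to be the apex.
      obtain ⟨t, ht⟩ : ∃ t, t = (x (Fin.last d) - a) / h := ⟨_, rfl⟩
      have hxt : x (Fin.last d) = a + h * t := by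
        rw [ht]
        field_simp
        ring
      have ht0 : 0 ≤ t := by
        rw [ht]
        exact div_nonneg (by linarith [hx.2]) hh0.le
      have hx1 (ℓ : Fin d) : t ≤ 2 * (x ℓ.castSucc / s - (i ℓ : ℝ)) ∧
          t ≤ 2 * ((i ℓ : ℝ) + 1 - x ℓ.castSucc / s) := by
        have h1 := hx.1 ℓ
        rw [hxt] at h1
        constructor
        · refine le_of_mul_le_mul_left ?_ hh0
          linarith [h1.1]
        · refine le_of_mul_le_mul_left ?_ hh0
          linarith [h1.2]
      have ht1 : t ≤ 1 := by
        have := hx1 ⟨0, hd⟩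
        linarith [this.1, this.2]
      rcases ht1.lt_or_eq with hlt | heq
      · obtain ⟨r, hr⟩ : ∃ r, r = 1 - t := ⟨_, rfl⟩
        have hr0 : 0 < r := by rw [hr]; linarith
        have hbase : (WithLp.toLp 2 (Fin.snoc (α := fun _ => ℝ)
            (fun ℓ : Fin d => (x ℓ.castSucc - t * (s * ((i ℓ : ℝ) + 1 / 2))) / r) a) : E (d + 1)) ∈
            closedBase d β j i := by
          refine ⟨fun ℓ => ?_, by rw [toLp_snoc_last, ha]⟩
          rw [toLp_snoc_castSucc, hcenter, hhalf, mem_Icc, le_div_iff₀ hr0, div_le_iff₀ hr0]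
          have h1 := hx1 ℓ
          have h2 : x ℓ.castSucc = s * (x ℓ.castSucc / s) := by field_simp
          rw [h2, hr]
          have h3 := mul_le_mul_of_nonneg_left h1.1 hs0.le
          have h4 := mul_le_mul_of_nonneg_left h1.2 hs0.le
          constructor <;> linarith
        have := convex_convexHull ℝ (insert (apex d β j i) (closedBase d β j i)) hapex
          (subset_convexHull ℝ _ (mem_insert_of_mem _ hbase)) ht0 hr0.le (by rw [hr]; ring)
        convert this using 1
        ext k
        refine Fin.lastCases ?_ (fun ℓ => ?_) k
        · simp only [PiLp.add_apply, PiLp.smul_apply, smul_eq_mul, apex, Fin.snoc_last, ← ha, ← hh]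
          rw [hxt, hr]
          ring
        · simp only [PiLp.add_apply, PiLp.smul_apply, smul_eq_mul, apex, Fin.snoc_castSucc,
            hcenter]
          field_simp
          ring
      · convert hapex using 1
        ext k
        refine Fin.lastCases ?_ (fun ℓ => ?_) k
        · rw [apex, toLp_snoc_last, ← ha, ← hh, hxt, heq, mul_one]
        · rw [apex, toLp_snoc_castSucc, hcenter]
          have := hx1 ℓ
          have h2 : x ℓ.castSucc / s = (i ℓ : ℝ) + 1 / 2 := by linarith [this.1, this.2]
          rw [div_eq_iff hs0.ne'] at h2
          rw [h2]
          ring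
  simp only [hpyr]
  rw [← ha, ← hh, ← hs]
  ext x
  constructor
  · rintro (hx | hx)
    · have hx' (k) : x k ∈ Icc 0 a := ha ▸ hx k
      refine ⟨fun ℓ => hx' _, (hx' _).1, fun ℓ => (hx' _).2.trans ?_⟩
      have := latticeDist_nonneg (x ℓ.castSucc / s)
      have : 0 ≤ 2 * h * latticeDist (x ℓ.castSucc / s) := by positivity
      linarith
    · obtain ⟨i, hi⟩ := mem_iUnion.1 hx
      have hcell (ℓ : Fin d) : (i ℓ : ℝ) ≤ x ℓ.castSucc / s ∧ x ℓ.castSucc / s ≤ (i ℓ : ℝ) + 1 := by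
        have h1 := (hi.1 ℓ).1
        have h2 := (hi.1 ℓ).2
        constructor
        · by_contra hcon
          have : 2 * h * (x ℓ.castSucc / s - (i ℓ : ℝ)) < 0 :=
            mul_neg_of_pos_of_neg (by positivity) (by linarith)
          linarith [hi.2]
        · by_contra hcon
          have : 2 * h * ((i ℓ : ℝ) + 1 - x ℓ.castSucc / s) < 0 :=
            mul_neg_of_pos_of_neg (by positivity) (by linarith)
          linarith [hi.2]
      refine ⟨fun ℓ => ?_, by linarith [hi.2], fun ℓ => ?_⟩
      · have h1 := cell_subset hs0 ham (i ℓ)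
        have h2 := hcell ℓ
        rw [le_div_iff₀ hs0, div_le_iff₀ hs0] at h2
        constructor <;> linarith [h1.1, h1.2, h2.1, h2.2]
      · rw [latticeDist_eq_min_nat (hcell ℓ).1 (hcell ℓ).2]
        rcases min_choice (x ℓ.castSucc / s - (i ℓ : ℝ)) ((i ℓ : ℝ) + 1 - x ℓ.castSucc / s) with
          he | he
        · rw [he]
          exact (hi.1 ℓ).1
        · rw [he]
          exact (hi.1 ℓ).2
  · intro hx
    rcases le_or_gt (x (Fin.last d)) a with hle | hlt
    · left
      intro k
      rw [← ha]
      exact Fin.lastCases ⟨hx.2.1, hle⟩ (fun ℓ => hx.1 ℓ) k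
    · right
      have hpos (ℓ : Fin d) : 0 < latticeDist (x ℓ.castSucc / s) := by
        have := hx.2.2 ℓ
        by_contra hcon
        have h0 : latticeDist (x ℓ.castSucc / s) = 0 :=
          le_antisymm (not_lt.1 hcon) (latticeDist_nonneg _)
        rw [h0] at this
        linarith
      obtain ⟨i, hi⟩ := exists_cell_index (t := fun ℓ : Fin d => x ℓ.castSucc) hs0 ham hx.1 hpos
      refine mem_iUnion.2 ⟨i, fun ℓ => ?_, hlt.le⟩
      have h1 := hx.2.2 ℓ
      rw [latticeDist_eq_min_nat (hi ℓ).1.le (hi ℓ).2.le] at h1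
      have h2 := mul_le_mul_of_nonneg_left (min_le_left (x ℓ.castSucc / s - (i ℓ : ℝ))
        ((i ℓ : ℝ) + 1 - x ℓ.castSucc / s)) (by positivity : 0 ≤ 2 * h)
      have h3 := mul_le_mul_of_nonneg_left (min_le_right (x ℓ.castSucc / s - (i ℓ : ℝ))
        ((i ℓ : ℝ) + 1 - x ℓ.castSucc / s)) (by positivity : 0 ≤ 2 * h)
      constructor <;> linarith

lemma pyramidDomain_eq_spikyBox {β : ℝ} {j : ℕ} (hd : 1 ≤ d) (hj : 1 ≤ j) :
    pyramidDomain d β j =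
      spikyBox d (1 / j) (1 / (j : ℝ) ^ pyramidExponent d β) (1 / (j * subdivisions β j)) := by
  rw [pyramidDomain, closedCube_union_closedPyramid hd hj, interior_closedSpikyBox]

end

/-! ### Lipschitz boundary -/

/-- A sublevel set of a Lipschitz function that decreases at a definite rate in a fixed direction
is the strict epigraph of a Lipschitz function in this direction. -/
lemma exists_epigraph_of_decreasing {n : ℕ} {L : ℝ} {F : E n → ℝ}
    (hF : ∀ y z, F y ≤ F z + L * ‖y - z‖) (hL : 0 ≤ L) {v : E n} {c : ℝ} (hc : 0 < c)
    (hv : ∀ y, ∀ t ≥ 0, F (y + t • v) ≤ F y - c * t) :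
    ∃ ν : E n, ‖ν‖ = 1 ∧ ∃ (K : ℝ≥0) (g : E n → ℝ), LipschitzWith K g ∧
      ∀ y, (F y < 0 ↔ g (y - inner ℝ ν y • ν) < inner ℝ ν y) := by
  have hv0 : v ≠ 0 := by
    rintro rfl
    have := hv 0 1 zero_le_one
    simp at this
    linarith
  have hvn : 0 < ‖v‖ := norm_pos_iff.2 hv0
  obtain ⟨ν, hν⟩ : ∃ ν : E n, ν = ‖v‖⁻¹ • v := ⟨_, rfl⟩
  obtain ⟨c', hc'⟩ : ∃ c', c' = c * ‖v‖⁻¹ := ⟨_, rfl⟩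
  have hc'0 : 0 < c' := by rw [hc']; positivity
  have hdec (y : E n) (s t : ℝ) (hst : s ≤ t) :
      F (y + t • ν) ≤ F (y + s • ν) - c' * (t - s) := by
    have h1 := hv (y + s • ν) ((t - s) * ‖v‖⁻¹) (mul_nonneg (by linarith) (by positivity))
    have e : y + s • ν + ((t - s) * ‖v‖⁻¹) • v = y + t • ν := by
      rw [hν]
      module
    rw [e] at h1
    rw [hc']
    linarith
  have hcont : Continuous F := by
    refine (LipschitzWith.of_le_add_mul ⟨L, hL⟩ fun y z => ?_).continuous
    rw [dist_eq_norm]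
    exact hF y z
  have hzero (y : E n) : ∃ t : ℝ, F (y + t • ν) = 0 := by
    have hcy : Continuous fun t : ℝ => F (y + t • ν) := hcont.comp (by fun_prop)
    have hT : 0 ≤ |F y| / c' := by positivity
    have h1 := hdec y 0 (|F y| / c') hT
    have h2 := hdec y (-(|F y| / c')) 0 (by linarith)
    have h3 : c' * (|F y| / c') = |F y| := by field_simp
    simp only [zero_smul, add_zero, sub_zero, zero_sub, neg_neg, h3] at h1 h2
    have := mem_range_of_exists_le_of_exists_ge hcy (c := 0)
      ⟨|F y| / c', by linarith [le_abs_self (F y)]⟩ ⟨-(|F y| / c'), by linarith [neg_abs_le (F y)]⟩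
    exact this
  -- Along each line of direction `ν` the function `F` is strictly decreasing, and `g y` is the
  -- parameter of its only zero.
  choose g hg using hzero
  have hlt (y : E n) (t : ℝ) : F (y + t • ν) < 0 ↔ g y < t := by
    constructor
    · intro h
      by_contra hcon
      have h1 := hdec y t (g y) (not_lt.1 hcon)
      rw [hg] at h1
      have : 0 ≤ c' * (g y - t) := mul_nonneg hc'0.le (by linarith)
      linarith
    · intro h
      have h1 := hdec y (g y) t h.le
      rw [hg] at h1
      have : 0 < c' * (t - g y) := mul_pos hc'0 (by linarith)
      linarith
  refine ⟨ν, ?_, ⟨L / c', by positivity⟩, g, ?_, fun y => ?_⟩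
  · rw [hν, norm_smul, norm_inv, norm_norm, inv_mul_cancel₀ hvn.ne']
  · refine LipschitzWith.of_le_add_mul _ fun y z => ?_
    rw [dist_eq_norm]
    -- At parameter `g z` the value of `F` over `y` is at most `L ‖y - z‖`; decreasing at rate `c'`,
    -- it is nonpositive after a further `L ‖y - z‖ / c'`.
    change g y ≤ g z + L / c' * ‖y - z‖
    by_contra hcon
    push Not at hcon
    have h1 := hdec y (g z + L / c' * ‖y - z‖) (g y) hcon.le
    have h2 := hdec y (g z) (g z + L / c' * ‖y - z‖) (le_add_of_nonneg_right (by positivity))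
    have h3 := hF (y + g z • ν) (z + g z • ν)
    rw [hg, add_sub_add_right_eq_sub] at h3
    rw [hg] at h1
    have h4 : c' * (g z + L / c' * ‖y - z‖ - g z) = L * ‖y - z‖ := by
      field_simp
      ring
    have h5 : 0 < c' * (g y - (g z + L / c' * ‖y - z‖)) := mul_pos hc'0 (by linarith)
    linarith
  · rw [← hlt, sub_add_cancel]

/-- The maximum of the functions keeps the common Lipschitz constant and the common rate of
decrease, and it is attained. -/
lemma exists_epigraph_of_finite {n : ℕ} {ι : Type*} [Finite ι] [Nonempty ι] {L : ℝ}
    {f : ι → E n → ℝ} (hf : ∀ i y z, f i y ≤ f i z + L * ‖y - z‖) (hL : 0 ≤ L) {v : E n} {c : ℝ}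
    (hc : 0 < c) (hv : ∀ i y, ∀ t ≥ 0, f i (y + t • v) ≤ f i y - c * t) :
    ∃ ν : E n, ‖ν‖ = 1 ∧ ∃ (K : ℝ≥0) (g : E n → ℝ), LipschitzWith K g ∧
      ∀ y, ((∀ i, f i y < 0) ↔ g (y - inner ℝ ν y • ν) < inner ℝ ν y) := by
  have hle (i : ι) (y : E n) : f i y ≤ ⨆ i, f i y :=
    le_ciSup (f := fun i => f i y) (Finite.bddAbove_range _) i
  obtain ⟨ν, hν, K, g, hg, h⟩ := exists_epigraph_of_decreasing (F := fun y => ⨆ i, f i y) (L := L)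
    (fun y z => ciSup_le fun i => (hf i y z).trans (by have := hle i z; gcongr)) hL hc
    (v := v) (fun y t ht => ciSup_le fun i => (hv i y t ht).trans (by have := hle i y; gcongr))
  refine ⟨ν, hν, K, g, hg, fun y => ?_⟩
  rw [← h y]
  constructor
  · intro hy
    obtain ⟨i, hi⟩ := exists_eq_ciSup_of_finite (f := fun i => f i y)
    rw [← hi]
    exact hy i
  · exact fun hy i => (hle i y).trans_lt hy

lemma abs_coord_le_norm {n : ℕ} (x : E n) (k : Fin n) : |x k| ≤ ‖x‖ := by
  simpa using PiLp.norm_apply_le x k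

lemma norm_le_of_coord_le {n : ℕ} {x : E n} {b : ℝ} (h : ∀ k, |x k| ≤ b) : ‖x‖ ≤ n * b := by
  rw [← sum_smul_single x]
  refine (norm_sum_le _ _).trans ?_
  calc ∑ i, ‖x i • EuclideanSpace.single i (1 : ℝ)‖ ≤ ∑ _i : Fin n, b :=
        Finset.sum_le_sum fun i _ => by simpa [norm_smul] using h i
    _ = n * b := by simp

section

variable {d m : ℕ} {a h s : ℝ}

/-- In each coordinate only the constraint on the side of `x` (below or above `a / 2`) matters near
`x`, and one inward direction improves all these constraints at unit rate at least. -/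
lemma exists_epigraph_spikyBox (hd : 1 ≤ d) (ha : 0 < a) (hh : 0 < h) (hs : 0 < s)
    (x : E (d + 1)) : ∃ ν : E (d + 1), ‖ν‖ = 1 ∧ ∃ (K : ℝ≥0) (g : E (d + 1) → ℝ), LipschitzWith K g ∧
      ∃ U ∈ 𝓝 x, ∀ y ∈ U, (y ∈ spikyBox d a h s ↔ g (y - inner ℝ ν y • ν) < inner ℝ ν y) := by
  classical
  obtain ⟨S, hS⟩ : ∃ S, S = 2 * h / s := ⟨_, rfl⟩
  have hS0 : 0 < S := by rw [hS]; positivity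
  have hN (y z : ℝ) : 2 * h * latticeDist (y / s) ≤ 2 * h * latticeDist (z / s) + S * |y - z| := by
    have h1 := mul_le_mul_of_nonneg_left (latticeDist_le_add (y / s) (z / s))
      (by positivity : 0 ≤ 2 * h)
    rw [← sub_div, abs_div, abs_of_pos hs] at h1
    refine h1.trans_eq ?_
    rw [hS]
    field_simp
  let f : Fin d ⊕ Fin d → E (d + 1) → ℝ := Sum.elim
    (fun ℓ y => if x ℓ.castSucc < a / 2 then - y ℓ.castSucc else y ℓ.castSucc - a)
    (fun ℓ y => if x (Fin.last d) < a / 2 then - y (Fin.last d)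
      else y (Fin.last d) - (a + 2 * h * latticeDist (y ℓ.castSucc / s)))
  -- Below the roof the vertical component is `-(1 + S)`: the horizontal components `±1` may lower
  -- the roof at rate at most `S`, its slope, and the rest leaves rate one.
  let v : E (d + 1) := WithLp.toLp 2 (Fin.snoc (α := fun _ => ℝ)
    (fun ℓ : Fin d => if x ℓ.castSucc < a / 2 then 1 else -1)
    (if x (Fin.last d) < a / 2 then 1 else -(1 + S)))
  have hvc (ℓ : Fin d) : v ℓ.castSucc = if x ℓ.castSucc < a / 2 then 1 else -1 := by simp [v]
  have hvl : v (Fin.last d) = if x (Fin.last d) < a / 2 then 1 else -(1 + S) := by simp [v]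
  have : Nonempty (Fin d ⊕ Fin d) := ⟨.inl ⟨0, hd⟩⟩
  have hLip (i : Fin d ⊕ Fin d) (y z : E (d + 1)) : f i y ≤ f i z + (1 + S) * ‖y - z‖ := by
    revert i y z
    rintro (ℓ | ℓ) y z
    · have h1 := abs_le.1 (abs_coord_le_norm (y - z) ℓ.castSucc)
      rw [PiLp.sub_apply] at h1
      have h2 : 0 ≤ S * ‖y - z‖ := by positivity
      simp only [f, Sum.elim_inl]
      split_ifs <;> linarith [h1.1, h1.2]
    · have h1 := abs_le.1 (abs_coord_le_norm (y - z) (Fin.last d))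
      rw [PiLp.sub_apply] at h1
      have h2 : 0 ≤ S * ‖y - z‖ := by positivity
      have h3 := hN (z ℓ.castSucc) (y ℓ.castSucc)
      have h4 := mul_le_mul_of_nonneg_left (abs_coord_le_norm (z - y) ℓ.castSucc) hS0.le
      rw [PiLp.sub_apply, norm_sub_rev] at h4
      simp only [f, Sum.elim_inr]
      split_ifs <;> linarith [h1.1, h1.2]
  have hdec (i : Fin d ⊕ Fin d) (y : E (d + 1)) : ∀ t ≥ (0 : ℝ), f i (y + t • v) ≤ f i y - 1 * t := by
    revert i y
    rintro (ℓ | ℓ) y t ht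
    · simp only [f, Sum.elim_inl, PiLp.add_apply, PiLp.smul_apply, smul_eq_mul, hvc]
      split_ifs <;> linarith
    · simp only [f, Sum.elim_inr, PiLp.add_apply, PiLp.smul_apply, smul_eq_mul, hvl]
      split_ifs
      · linarith
      · have h3 := hN (y ℓ.castSucc) (y ℓ.castSucc + t * v ℓ.castSucc)
        have h4 : |y ℓ.castSucc - (y ℓ.castSucc + t * v ℓ.castSucc)| = t := by
          rw [sub_add_cancel_left, abs_neg, abs_mul, abs_of_nonneg ht, hvc]
          split_ifs <;> simp
        rw [h4] at h3
        linarith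
  obtain ⟨ν, hν, K, g, hg, key⟩ :=
    exists_epigraph_of_finite hLip (by positivity) one_pos hdec
  -- On this neighbourhood the constraints omitted from `f` hold automatically; the roof is never
  -- below height `a`.
  refine ⟨ν, hν, K, g, hg, {y | ∀ k, (x k < a / 2 → y k < a) ∧ (a / 2 ≤ x k → 0 < y k)}, ?_, ?_⟩
  · refine eventually_all.2 fun k => Filter.Eventually.and ?_ ?_
    · by_cases hk : x k < a / 2
      · filter_upwards [((continuous_coord k).tendsto x).eventually_lt_const
          (hk.trans (by linarith : a / 2 < a))] with y hy _ using hy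
      · exact .of_forall fun y h' => absurd h' hk
    · by_cases hk : a / 2 ≤ x k
      · filter_upwards [((continuous_coord k).tendsto x).eventually_const_lt
          ((half_pos ha).trans_le hk)] with y hy _ using hy
      · exact .of_forall fun y h' => absurd h' hk
  · intro y hy
    rw [← key y]
    have hNn (ℓ : Fin d) : 0 ≤ 2 * h * latticeDist (y ℓ.castSucc / s) :=
      mul_nonneg (by positivity) (latticeDist_nonneg _)
    constructor
    · rintro hyΩ (ℓ | ℓ)
      · simp only [f, Sum.elim_inl]
        split_ifs
        · linarith [(hyΩ.1 ℓ).1]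
        · linarith [(hyΩ.1 ℓ).2]
      · simp only [f, Sum.elim_inr]
        split_ifs
        · linarith [hyΩ.2.1]
        · linarith [hyΩ.2.2 ℓ]
    · intro hf
      refine ⟨fun ℓ => ?_, ?_, fun ℓ => ?_⟩
      · have h1 := hf (.inl ℓ)
        simp only [f, Sum.elim_inl] at h1
        split_ifs at h1 with h2
        · exact ⟨by linarith, (hy _).1 h2⟩
        · exact ⟨(hy _).2 (not_lt.1 h2), by linarith⟩
      · have h1 := hf (.inr ⟨0, hd⟩)
        simp only [f, Sum.elim_inr] at h1
        split_ifs at h1 with h2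
        · linarith
        · exact (hy _).2 (not_lt.1 h2)
      · have h1 := hf (.inr ℓ)
        simp only [f, Sum.elim_inr] at h1
        split_ifs at h1 with h2
        · linarith [(hy _).1 h2, hNn ℓ]
        · linarith

lemma openCube_nonempty (ha : 0 < a) : (openCube d a).Nonempty :=
  ⟨WithLp.toLp 2 fun _ => a / 2, fun _ => ⟨by simp [ha], by simp [ha]⟩, by simp [ha], by simp [ha]⟩

/-- The box below a pyramid lies both in the cube and in the cell. -/
lemma spikeCell_inter_openCube_nonempty (hs : 0 < s) (hh : 0 < h) (hha : h ≤ a) (hm : a = m * s)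
    (i : Fin d → Fin m) : (spikeCell a h s i ∩ openCube d a).Nonempty := by
  have hcell (ℓ : Fin d) : s * (i ℓ : ℝ) < s * ((i ℓ : ℝ) + 1 / 2) ∧
      s * ((i ℓ : ℝ) + 1 / 2) < s * ((i ℓ : ℝ) + 1) := by
    constructor <;> gcongr
    · linarith
    · norm_num
  refine ⟨WithLp.toLp 2 (Fin.snoc (α := fun _ => ℝ) (fun ℓ => s * ((i ℓ : ℝ) + 1 / 2)) (a - h / 2)),
    ⟨fun ℓ => ?_, ?_⟩, fun ℓ => ?_, ?_⟩
  · simp only [Fin.snoc_castSucc, Fin.snoc_last]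
    have e : s * ((i ℓ : ℝ) + 1 / 2) / s = (i ℓ : ℝ) + 1 / 2 := by field_simp
    rw [e]
    exact ⟨⟨(hcell ℓ).1, (hcell ℓ).2⟩, by linarith, by linarith⟩
  · simp only [Fin.snoc_last]
    linarith
  · simp only [Fin.snoc_castSucc]
    have h1 := cell_subset hs hm (i ℓ)
    exact ⟨h1.1.trans_lt (hcell ℓ).1, (hcell ℓ).2.trans_le h1.2⟩
  · simp only [Fin.snoc_last]
    constructor <;> linarith

lemma isConnected_spikyBox (hs : 0 < s) (hh : 0 < h) (hha : h ≤ a) (hm : a = m * s) :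
    IsConnected (spikyBox d a h s) := by
  have ha : 0 < a := hh.trans_le hha
  rw [spikyBox_eq_union hs hh hha hm]
  obtain ⟨x, hx⟩ := openCube_nonempty (d := d) ha
  refine ⟨⟨x, .inl hx⟩, isPreconnected_of_forall x ?_⟩
  rintro y (hy | hy)
  · exact ⟨_, subset_union_left, hx, hy, convex_openCube.isPreconnected⟩
  · obtain ⟨i, hi⟩ := mem_iUnion.1 hy
    refine ⟨openCube d a ∪ spikeCell a h s i,
      union_subset_union_right _ (subset_iUnion (fun i => spikeCell a h s i) i), .inl hx, .inr hi, ?_⟩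
    refine IsPreconnected.union' ?_ convex_openCube.isPreconnected
      (convex_spikeCell i).isPreconnected
    rw [inter_comm]
    exact spikeCell_inter_openCube_nonempty hs hh hha hm i

lemma closedSpikyBox_subset_closedBall (hd : 1 ≤ d) (hh : 0 < h) (hha : h ≤ a) :
    closedSpikyBox d a h s ⊆ Metric.closedBall 0 ((d + 1) * (2 * a)) := by
  intro x hx
  rw [mem_closedBall_zero_iff]
  have := norm_le_of_coord_le (x := x) (b := 2 * a) fun k => ?_
  · exact_mod_cast this
  · refine Fin.lastCases ?_ (fun ℓ => ?_) k
    · have h1 := hx.2.2 ⟨0, hd⟩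
      have h2 := mul_le_mul_of_nonneg_left (latticeDist_le_half
        (x (Fin.castSucc ⟨0, hd⟩) / s)) (by positivity : 0 ≤ 2 * h)
      rw [abs_of_nonneg hx.2.1]
      linarith
    · rw [abs_of_nonneg (hx.1 ℓ).1]
      linarith [(hx.1 ℓ).2]

lemma isBoundedLipschitzDomain_spikyBox (hd : 1 ≤ d) (hs : 0 < s) (hh : 0 < h) (hha : h ≤ a)
    (hm : a = m * s) : IsBoundedLipschitzDomain (spikyBox d a h s) where
  isOpen := isOpen_spikyBox
  isConnected := isConnected_spikyBox hs hh hha hm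
  isBounded := Metric.isBounded_closedBall.subset
    (spikyBox_subset_closedSpikyBox.trans (closedSpikyBox_subset_closedBall hd hh hha))
  lipschitz_boundary x _ := exists_epigraph_spikyBox hd (hh.trans_le hha) hh hs x

end

/-! ### Hausdorff measure of faces and graphs -/

/-- The graph map `y ↦ (y, g y)`. -/
def graphMap {d : ℕ} (g : E d → ℝ) (y : E d) : E (d + 1) :=
  WithLp.toLp 2 (Fin.snoc (α := fun _ => ℝ) y (g y))

/-- The projection to the first `d` coordinates. -/
def initProj {d : ℕ} (x : E (d + 1)) : E d := WithLp.toLp 2 fun ℓ => x ℓ.castSucc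

/-- The isometric embedding of `ℝᵈ` as the hyperplane `x k = b`. -/
def faceMap {d : ℕ} (k : Fin (d + 1)) (b : ℝ) (y : E d) : E (d + 1) :=
  WithLp.toLp 2 (k.insertNth (α := fun _ => ℝ) b y)

/-- The projection that forgets the coordinate `k`. -/
def faceProj {d : ℕ} (k : Fin (d + 1)) (x : E (d + 1)) : E d :=
  WithLp.toLp 2 fun ℓ => x (k.succAbove ℓ)

section

variable {d : ℕ}

lemma graphMap_castSucc (g : E d → ℝ) (y : E d) (ℓ : Fin d) :
    graphMap g y ℓ.castSucc = y ℓ := by simp [graphMap]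

lemma graphMap_last (g : E d → ℝ) (y : E d) : graphMap g y (Fin.last d) = g y := by
  simp [graphMap]

lemma initProj_graphMap (g : E d → ℝ) (y : E d) : initProj (graphMap g y) = y := by
  ext ℓ
  exact graphMap_castSucc g y ℓ

lemma graphMap_injective (g : E d → ℝ) : Function.Injective (graphMap g) :=
  Function.LeftInverse.injective (initProj_graphMap g)

lemma continuous_graphMap {g : E d → ℝ} (hg : Continuous g) : Continuous (graphMap g) := by
  refine (PiLp.continuous_toLp 2 _).comp (continuous_pi fun k => ?_)
  refine Fin.lastCases ?_ (fun ℓ => ?_) k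
  · simpa using hg
  · simpa using (by fun_prop : Continuous fun y : E d => y ℓ)

lemma faceMap_same (k : Fin (d + 1)) (b : ℝ) (y : E d) : faceMap k b y k = b := by
  simp [faceMap]

lemma faceMap_succAbove (k : Fin (d + 1)) (b : ℝ) (y : E d) (ℓ : Fin d) :
    faceMap k b y (k.succAbove ℓ) = y ℓ := by
  simp [faceMap]

lemma isometry_faceMap (k : Fin (d + 1)) (b : ℝ) : Isometry (faceMap (d := d) k b) := by
  refine Isometry.of_dist_eq fun y z => ?_
  rw [EuclideanSpace.dist_eq, EuclideanSpace.dist_eq, Fin.sum_univ_succAbove _ k]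
  simp only [faceMap_same, faceMap_succAbove]
  simp

lemma faceMap_faceProj {k : Fin (d + 1)} {b : ℝ} {x : E (d + 1)} (hx : x k = b) :
    faceMap k b (faceProj k x) = x := by
  ext i
  refine Fin.succAboveCases k ?_ (fun ℓ => ?_) i
  · rw [faceMap_same, hx]
  · rw [faceMap_succAbove]
    rfl

lemma faceProj_faceMap (k : Fin (d + 1)) (b : ℝ) (y : E d) : faceProj k (faceMap k b y) = y := by
  ext ℓ
  exact faceMap_succAbove k b y ℓ

lemma euclideanHausdorffMeasure_inter_hyperplane (k : Fin (d + 1)) (b : ℝ) (S : Set (E (d + 1))) :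
    Measure.euclideanHausdorffMeasure d ({x | x k = b} ∩ S) = volume (faceMap k b ⁻¹' S) := by
  have e : {x | x k = b} ∩ S = faceMap k b '' (faceMap k b ⁻¹' S) := by
    rw [image_preimage_eq_inter_range, inter_comm]
    congr 1
    ext x
    exact ⟨fun hx => ⟨_, faceMap_faceProj hx⟩, by rintro ⟨y, rfl⟩; exact faceMap_same k b y⟩
  rw [e, (isometry_faceMap k b).euclideanHausdorffMeasure_image,
    EuclideanSpace.euclideanHausdorffMeasure_eq_volume]

lemma dist_initProj_le (x y : E (d + 1)) : dist (initProj x) (initProj y) ≤ dist x y := by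
  rw [EuclideanSpace.dist_eq, EuclideanSpace.dist_eq, Fin.sum_univ_castSucc]
  exact Real.sqrt_le_sqrt (le_add_of_nonneg_right (by positivity))

lemma dist_faceProj_le (k : Fin (d + 1)) (x y : E (d + 1)) :
    dist (faceProj k x) (faceProj k y) ≤ dist x y := by
  rw [EuclideanSpace.dist_eq, EuclideanSpace.dist_eq, Fin.sum_univ_succAbove _ k]
  exact Real.sqrt_le_sqrt (le_add_of_nonneg_left (by positivity))

/-- The area of a graph over a set where the slope is `c` in one coordinate direction and `0` in
the others. -/
lemma euclideanHausdorffMeasure_image_affine_graph (k : Fin d) (b c : ℝ) (S : Set (E d)) :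
    Measure.euclideanHausdorffMeasure d (graphMap (fun y => b + c * y k) '' S) =
      ENNReal.ofReal (√(1 + c ^ 2)) * volume S := by
  obtain ⟨w, hw⟩ : ∃ w, w = √(1 + c ^ 2) := ⟨_, rfl⟩
  have hw0 : 0 < w := by rw [hw]; positivity
  have hw2 : w ^ 2 = 1 + c ^ 2 := by rw [hw, Real.sq_sqrt (by positivity)]
  -- Stretching coordinate `k` by `w` flattens the graph: the graph map composed with the inverse
  -- stretch `B` is an isometry, so the area factor is the determinant `w`.
  let A : E d →ₗ[ℝ] E d := Matrix.toLpLin 2 2 (Matrix.diagonal fun i => if i = k then w else 1)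
  have hA (y : E d) (i : Fin d) : A y i = (if i = k then w else 1) * y i := by
    simp [A, Matrix.toLpLin_apply, Matrix.mulVec_diagonal]
  have hdet : LinearMap.det A = w := by
    simp [A, LinearMap.det_toLpLin, Matrix.det_diagonal]
  let B : E d → E d := fun z => WithLp.toLp 2 fun i => (if i = k then w⁻¹ else 1) * z i
  have hBA (y : E d) : B (A y) = y := by
    ext i
    simp only [B, hA]
    split_ifs
    · field_simp
    · simp
  have hJ : Isometry fun z => graphMap (fun y => b + c * y k) (B z) := by
    refine Isometry.of_dist_eq fun y z => ?_
    rw [EuclideanSpace.dist_eq, EuclideanSpace.dist_eq, Fin.sum_univ_castSucc]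
    congr 1
    simp only [graphMap_castSucc, graphMap_last, Real.dist_eq, sq_abs]
    have h1 (i : Fin d) : (B y i - B z i) ^ 2 =
        (y i - z i) ^ 2 + if i = k then ((w⁻¹) ^ 2 - 1) * (y i - z i) ^ 2 else 0 := by
      simp only [B]
      split_ifs <;> ring
    simp only [h1, Finset.sum_add_distrib, Finset.sum_ite_eq', Finset.mem_univ, if_true]
    have h2 : (w⁻¹) ^ 2 * (1 + c ^ 2) = 1 := by
      rw [← hw2]
      field_simp
    simp only [B, if_true]
    linear_combination (y k - z k) ^ 2 * h2
  have e : graphMap (fun y => b + c * y k) '' S =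
      (fun z => graphMap (fun y => b + c * y k) (B z)) '' (A '' S) := by
    rw [image_image]
    simp only [hBA]
  rw [e, hJ.euclideanHausdorffMeasure_image, EuclideanSpace.euclideanHausdorffMeasure_eq_volume,
    Measure.addHaar_image_linearMap, hdet, abs_of_pos hw0, hw]

/-- The area of a graph that is piecewise of the previous kind. -/
lemma euclideanHausdorffMeasure_image_graph {ι : Type*} [Countable ι] {g : E d → ℝ}
    (hg : Continuous g) {P : ι → Set (E d)} (hU : ⋃ i, P i = univ)
    {w : ℝ} (haff : ∀ i, ∃ (k : Fin d) (b c : ℝ), √(1 + c ^ 2) = w ∧ ∀ y ∈ P i, g y = b + c * y k)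
    (S : Set (E d)) :
    Measure.euclideanHausdorffMeasure d (graphMap g '' S) = ENNReal.ofReal w * volume S := by
  have hemb : MeasurableEmbedding (graphMap g) :=
    (continuous_graphMap hg).measurableEmbedding (graphMap_injective g)
  -- Equality of measures may be checked on each piece of a countable cover, so overlaps of the
  -- pieces do no harm.
  have key : Measure.comap (graphMap g) (Measure.euclideanHausdorffMeasure d) =
      ENNReal.ofReal w • (volume : Measure (E d)) := by
    refine (Measure.ext_iff_of_iUnion_eq_univ hU).2 fun i => Measure.ext fun T hT => ?_
    obtain ⟨k, b, c, hc, hgb⟩ := haff i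
    rw [Measure.restrict_apply hT, Measure.restrict_apply hT, hemb.comap_apply]
    have e : graphMap g '' (T ∩ P i) = graphMap (fun y => b + c * y k) '' (T ∩ P i) :=
      image_congr fun y hy => by simp only [graphMap, hgb y hy.2]
    rw [e, euclideanHausdorffMeasure_image_affine_graph, hc]
    rfl
  rw [← hemb.comap_apply, key]
  rfl

/-- The height of the upper boundary of `spikyBox`. -/
noncomputable def spikeHeight (d : ℕ) (a h s : ℝ) (y : E d) : ℝ := ⨅ ℓ, (a + 2 * h * latticeDist (y ℓ / s))

variable {a h s : ℝ}

lemma spikeHeight_le (y : E d) (ℓ : Fin d) :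
    spikeHeight d a h s y ≤ a + 2 * h * latticeDist (y ℓ / s) :=
  ciInf_le (Finite.bddBelow_range fun ℓ => a + 2 * h * latticeDist (y ℓ / s)) ℓ

lemma spikeHeight_eq {y : E d} {k : Fin d} (hh : 0 ≤ h)
    (hk : ∀ ℓ, latticeDist (y k / s) ≤ latticeDist (y ℓ / s)) :
    spikeHeight d a h s y = a + 2 * h * latticeDist (y k / s) := by
  have : Nonempty (Fin d) := ⟨k⟩
  exact le_antisymm (spikeHeight_le y k) (le_ciInf fun ℓ => by have := hk ℓ; gcongr)

lemma exists_spikeHeight_eq (hd : 1 ≤ d) (y : E d) :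
    ∃ k, spikeHeight d a h s y = a + 2 * h * latticeDist (y k / s) := by
  have : Nonempty (Fin d) := ⟨⟨0, hd⟩⟩
  obtain ⟨k, hk⟩ := exists_eq_ciInf_of_finite (f := fun ℓ => a + 2 * h * latticeDist (y ℓ / s))
  exact ⟨k, hk.symm⟩

lemma continuous_spikeHeight (hd : 1 ≤ d) : Continuous (spikeHeight d a h s) := by
  have : Nonempty (Fin d) := ⟨⟨0, hd⟩⟩
  have hne : (Finset.univ : Finset (Fin d)).Nonempty := ⟨⟨0, hd⟩, Finset.mem_univ _⟩
  have e : spikeHeight d a h s =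
      fun y => Finset.univ.inf' hne fun ℓ => a + 2 * h * latticeDist (y ℓ / s) := by
    ext y
    rw [Finset.inf'_univ_eq_ciInf]
    rfl
  rw [e]
  refine Continuous.finset_inf'_apply hne fun ℓ _ => ?_
  have := continuous_latticeDist
  fun_prop

/-- The pieces are indexed by a coordinate `k` nearest to the grid, the integer part of `y k / s`
and the half of the unit interval containing it. On each one the height depends on `y k` only, with
slope `±2h/s`. -/
lemma euclideanHausdorffMeasure_image_spikeHeight (hd : 1 ≤ d) (hh : 0 ≤ h)
    (S : Set (E d)) :
    Measure.euclideanHausdorffMeasure d (graphMap (spikeHeight d a h s) '' S) =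
      ENNReal.ofReal (√(1 + (2 * h / s) ^ 2)) * volume S := by
  have : Nonempty (Fin d) := ⟨⟨0, hd⟩⟩
  refine euclideanHausdorffMeasure_image_graph (continuous_spikeHeight hd)
    (ι := Fin d × ℤ × Bool)
    (P := fun i => {y | (∀ ℓ, latticeDist (y i.1 / s) ≤ latticeDist (y ℓ / s)) ∧
      y i.1 / s ∈ if i.2.2 then Icc (i.2.1 : ℝ) (i.2.1 + 1 / 2) else Icc (i.2.1 + 1 / 2 : ℝ)
        (i.2.1 + 1)}) ?_ ?_ S
  · refine eq_univ_of_forall fun y => ?_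
    obtain ⟨k, hk⟩ := Finite.exists_min fun ℓ => latticeDist (y ℓ / s)
    have h1 := Int.floor_le (y k / s)
    have h2 := (Int.lt_floor_add_one (y k / s)).le
    rcases le_total (y k / s) (⌊y k / s⌋ + 1 / 2) with h3 | h3
    · exact mem_iUnion.2 ⟨(k, ⌊y k / s⌋, true), hk, by simpa using ⟨h1, by simpa using h3⟩⟩
    · exact mem_iUnion.2 ⟨(k, ⌊y k / s⌋, false), hk, by simpa using ⟨by simpa using h3, h2⟩⟩
  · rintro ⟨k, z, σ⟩
    cases σ
    · refine ⟨k, a + 2 * h * (z + 1), -(2 * h / s), by rw [neg_sq], fun y hy => ?_⟩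
      have h1 : y k / s ∈ Icc (z + 1 / 2 : ℝ) (z + 1) := hy.2
      rw [spikeHeight_eq hh hy.1, latticeDist_eq_min (i := z) (by linarith [h1.1]) h1.2,
        min_eq_right (by linarith [h1.1])]
      ring
    · refine ⟨k, a - 2 * h * z, 2 * h / s, rfl, fun y hy => ?_⟩
      have h1 : y k / s ∈ Icc (z : ℝ) (z + 1 / 2) := hy.2
      rw [spikeHeight_eq hh hy.1, latticeDist_eq_min (i := z) h1.1 (by linarith [h1.2]),
        min_eq_left (by linarith [h1.2])]
      ring

end

/-! ### Perimeter and distortion of cubes with pyramids -/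

section

variable {d m : ℕ} {a h s : ℝ}

lemma volume_pi_cube (ha : 0 ≤ a) :
    volume {y : E d | ∀ ℓ, y ℓ ∈ Icc 0 a} = ENNReal.ofReal (a ^ d) := by
  have e : {y : E d | ∀ ℓ, y ℓ ∈ Icc 0 a} = WithLp.ofLp ⁻¹' (Icc (fun _ => (0 : ℝ)) fun _ => a) := by
    ext y
    exact ⟨fun hy => ⟨fun ℓ => (hy ℓ).1, fun ℓ => (hy ℓ).2⟩, fun hy ℓ => ⟨hy.1 ℓ, hy.2 ℓ⟩⟩
  rw [e, (PiLp.volume_preserving_ofLp (Fin d)).measure_preimage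
    measurableSet_Icc.nullMeasurableSet, Real.volume_Icc_pi]
  simp [ENNReal.ofReal_pow ha]

lemma volume_pi_openCube (ha : 0 ≤ a) :
    volume {y : E d | ∀ ℓ, y ℓ ∈ Ioo 0 a} = ENNReal.ofReal (a ^ d) := by
  have e : {y : E d | ∀ ℓ, y ℓ ∈ Ioo 0 a} = WithLp.ofLp ⁻¹' (univ.pi fun _ => Ioo (0 : ℝ) a) := by
    ext y
    simp
  rw [e, (PiLp.volume_preserving_ofLp (Fin d)).measure_preimage
    (MeasurableSet.univ_pi fun _ => measurableSet_Ioo).nullMeasurableSet, Real.volume_pi_Ioo]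
  simp [ENNReal.ofReal_pow ha]

lemma latticeDist_boundary (hs : 0 < s) (hm : a = m * s) {t : ℝ} (ht : t = 0 ∨ t = a) :
    latticeDist (t / s) = 0 := by
  rcases ht with rfl | rfl
  · simpa using latticeDist_intCast 0
  · rw [hm, mul_div_cancel_right₀ _ hs.ne', latticeDist_natCast]

/-- The boundary consists of the graph of the height function and of subsets of `2n` faces of the
cube. -/
lemma frontier_spikyBox_subset (hd : 1 ≤ d) (hs : 0 < s) (hm : a = m * s) :
    frontier (spikyBox d a h s) ⊆
      graphMap (spikeHeight d a h s) '' {y | ∀ ℓ, y ℓ ∈ Icc 0 a} ∪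
      ⋃ i : Fin (d + 1) × Bool, {x | x i.1 = if i.2 then a else 0} ∩ {x | ∀ k, x k ∈ Icc 0 a} := by
  intro x hx
  rw [isOpen_spikyBox.frontier_eq] at hx
  have hxC := closure_spikyBox_subset hx.1
  have ha : 0 ≤ a := (hxC.1 ⟨0, hd⟩).1.trans (hxC.1 ⟨0, hd⟩).2
  by_cases h1 : ∃ ℓ : Fin d, x ℓ.castSucc = 0 ∨ x ℓ.castSucc = a
  · right
    obtain ⟨ℓ, hℓ⟩ := h1
    -- Over the sides of the cube the roof has height exactly `a`, because `a` is a multiple of `s`;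
    -- no boundary point there rises above the cube.
    have hlast : x (Fin.last d) ∈ Icc 0 a := by
      refine ⟨hxC.2.1, ?_⟩
      have := hxC.2.2 ℓ
      rwa [latticeDist_boundary hs hm hℓ, mul_zero, add_zero] at this
    have hall (k) : x k ∈ Icc 0 a := Fin.lastCases hlast hxC.1 k
    rcases hℓ with h0 | h0
    · exact mem_iUnion.2 ⟨(ℓ.castSucc, false), by simpa using h0, hall⟩
    · exact mem_iUnion.2 ⟨(ℓ.castSucc, true), by simpa using h0, hall⟩
  · push Not at h1
    have h1' (ℓ : Fin d) : x ℓ.castSucc ∈ Ioo 0 a :=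
      ⟨lt_of_le_of_ne (hxC.1 ℓ).1 (h1 ℓ).1.symm, lt_of_le_of_ne (hxC.1 ℓ).2 (h1 ℓ).2⟩
    by_cases h2 : x (Fin.last d) = 0
    · right
      refine mem_iUnion.2 ⟨(Fin.last d, false), by simpa using h2, fun k => ?_⟩
      exact Fin.lastCases (by rw [h2]; exact ⟨le_rfl, ha⟩) hxC.1 k
    · left
      refine ⟨initProj x, hxC.1, ?_⟩
      have : ∃ ℓ : Fin d, a + 2 * h * latticeDist (x ℓ.castSucc / s) ≤ x (Fin.last d) := by
        by_contra hcon
        push Not at hcon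
        exact hx.2 ⟨h1', lt_of_le_of_ne hxC.2.1 (Ne.symm h2), hcon⟩
      obtain ⟨ℓ, hℓ⟩ := this
      have hlast : spikeHeight d a h s (initProj x) = x (Fin.last d) := by
        obtain ⟨k, hk⟩ := exists_spikeHeight_eq (a := a) (h := h) (s := s) hd (initProj x)
        apply le_antisymm
        · exact (spikeHeight_le (initProj x) ℓ).trans hℓ
        · rw [hk]
          exact hxC.2.2 k
      ext k
      refine Fin.lastCases ?_ (fun ℓ => ?_) k
      · rw [graphMap_last, hlast]
      · rw [graphMap_castSucc]
        rfl

lemma graph_subset_frontier (hd : 1 ≤ d) (hh : 0 < h) (ha : 0 < a) :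
    graphMap (spikeHeight d a h s) '' {y | ∀ ℓ, y ℓ ∈ Ioo 0 a} ⊆ frontier (spikyBox d a h s) := by
  rintro _ ⟨y, hy, rfl⟩
  rw [isOpen_spikyBox.frontier_eq]
  obtain ⟨k, hk⟩ := exists_spikeHeight_eq (a := a) (h := h) (s := s) hd y
  have hpos : 0 < spikeHeight d a h s y := by
    have : 0 ≤ 2 * h * latticeDist (y k / s) := mul_nonneg (by positivity) (latticeDist_nonneg _)
    linarith
  constructor
  · refine mem_closure_of_openSegment (y := graphMap (fun _ => 0) y) ?_
    rintro _ ⟨b, c, hb, hc, hbc, rfl⟩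
    obtain rfl : b = 1 - c := by linarith
    have e1 (ℓ : Fin d) : ((1 - c) • graphMap (spikeHeight d a h s) y +
        c • graphMap (fun _ => 0) y) ℓ.castSucc = y ℓ := by
      simp only [PiLp.add_apply, PiLp.smul_apply, smul_eq_mul, graphMap_castSucc]
      ring
    have e2 : ((1 - c) • graphMap (spikeHeight d a h s) y + c • graphMap (fun _ => 0) y)
        (Fin.last d) = (1 - c) * spikeHeight d a h s y := by
      simp only [PiLp.add_apply, PiLp.smul_apply, smul_eq_mul, graphMap_last]
      ring
    refine ⟨fun ℓ => by rw [e1]; exact hy ℓ, by rw [e2]; positivity, fun ℓ => ?_⟩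
    rw [e1, e2]
    refine lt_of_lt_of_le ?_ (spikeHeight_le y ℓ)
    linarith [mul_pos hc hpos]
  · intro hmem
    have := hmem.2.2 k
    rw [graphMap_castSucc, graphMap_last, hk] at this
    exact lt_irrefl _ this

/-- A common bound for the measure of the part of the boundary in a set. -/
lemma boundaryMeasure_spikyBox_le (hd : 1 ≤ d) (hh : 0 < h) (hs : 0 < s) (hm : a = m * s)
    {S : Set (E (d + 1))} (hS : MeasurableSet S) {V : ℝ≥0∞}
    (hV1 : volume ({y | ∀ ℓ, y ℓ ∈ Icc 0 a} ∩ graphMap (spikeHeight d a h s) ⁻¹' S) ≤ V)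
    (hV2 : ∀ k b, volume (faceMap k b ⁻¹' ({x | ∀ k, x k ∈ Icc 0 a} ∩ S)) ≤ V) :
    boundaryMeasure (spikyBox d a h s) S ≤
      ENNReal.ofReal (√(1 + (2 * h / s) ^ 2) + 2 * (d + 1)) * V := by
  rw [boundaryMeasure, Measure.restrict_apply hS]
  have hsub : S ∩ frontier (spikyBox d a h s) ⊆
      graphMap (spikeHeight d a h s) '' ({y | ∀ ℓ, y ℓ ∈ Icc 0 a} ∩
        graphMap (spikeHeight d a h s) ⁻¹' S) ∪
      ⋃ i : Fin (d + 1) × Bool, {x | x i.1 = if i.2 then a else 0} ∩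
        ({x | ∀ k, x k ∈ Icc 0 a} ∩ S) := by
    rintro x ⟨hxS, hx⟩
    rcases frontier_spikyBox_subset hd hs hm hx with ⟨y, hy, rfl⟩ | hx
    · exact .inl ⟨y, ⟨hy, hxS⟩, rfl⟩
    · obtain ⟨i, hi⟩ := mem_iUnion.1 hx
      exact .inr (mem_iUnion.2 ⟨i, hi.1, hi.2, hxS⟩)
  refine (measure_mono hsub).trans ((measure_union_le _ _).trans ?_)
  rw [ENNReal.ofReal_add (by positivity) (by positivity), add_mul]
  refine add_le_add ?_ ((measure_iUnion_le _).trans ?_)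
  · rw [euclideanHausdorffMeasure_image_spikeHeight hd hh.le]
    gcongr
  · rw [tsum_fintype]
    calc _ ≤ ∑ _i : Fin (d + 1) × Bool, V := Finset.sum_le_sum fun i _ => by
          rw [euclideanHausdorffMeasure_inter_hyperplane]
          exact hV2 _ _
      _ = _ := by
          rw [Finset.sum_const, nsmul_eq_mul]
          congr 1
          have : (2 * ((d : ℝ) + 1)) = ((2 * (d + 1) : ℕ) : ℝ) := by push_cast; ring
          rw [this, ENNReal.ofReal_natCast]
          simp [mul_comm]

lemma perimeter_spikyBox_le (hd : 1 ≤ d) (hh : 0 < h) (hs : 0 < s) (hm : a = m * s) :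
    perimeter (spikyBox d a h s) ≤
      ENNReal.ofReal ((√(1 + (2 * h / s) ^ 2) + 2 * (d + 1)) * a ^ d) := by
  have ha : 0 ≤ a := by rw [hm]; positivity
  rw [ENNReal.ofReal_mul (by positivity)]
  refine boundaryMeasure_spikyBox_le hd hh hs hm .univ ?_ fun k b => ?_
  · rw [preimage_univ, inter_univ, volume_pi_cube ha]
  · rw [← volume_pi_cube (d := d) ha]
    refine measure_mono fun y hy ℓ => ?_
    have := hy.1 (k.succAbove ℓ)
    rwa [faceMap_succAbove] at this

lemma le_perimeter_spikyBox (hd : 1 ≤ d) (hh : 0 < h) (ha : 0 < a) :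
    ENNReal.ofReal (√(1 + (2 * h / s) ^ 2) * a ^ d) ≤ perimeter (spikyBox d a h s) := by
  rw [ENNReal.ofReal_mul (by positivity), ← volume_pi_openCube ha.le,
    ← euclideanHausdorffMeasure_image_spikeHeight (a := a) hd hh.le, perimeter, boundaryMeasure,
    Measure.restrict_apply_univ]
  exact measure_mono (graph_subset_frontier hd hh ha)

/-- The relevant coordinate projections are `1`-Lipschitz, so the part of the roof or of a face in a
ball of radius `r` lies over a `d`-dimensional ball of radius `r`. The area factors do not depend on
`r`. -/
lemma distortion_spikyBox_le (hd : 1 ≤ d) (hh : 0 < h) (hs : 0 < s) (hm : a = m * s) :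
    distortion (spikyBox d a h s) ≤
      ENNReal.ofReal (√(1 + (2 * h / s) ^ 2) + 2 * (d + 1)) := by
  refine iSup_le fun x => iSup_le fun r => iSup_le fun hr => ?_
  have hball (y : E d) : volume (Metric.ball y r) =
      volume (Metric.ball (0 : E d) 1) * ENNReal.ofReal r ^ d := by
    rw [Measure.addHaar_ball_of_pos _ _ hr, finrank_euclideanSpace_fin, ENNReal.ofReal_pow hr.le,
      mul_comm]
  refine ENNReal.div_le_of_le_mul ?_
  refine boundaryMeasure_spikyBox_le hd hh hs hm Metric.isOpen_ball.measurableSet ?_ fun k b => ?_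
  · rw [← hball (initProj x)]
    refine measure_mono fun y hy => ?_
    rw [Metric.mem_ball, ← initProj_graphMap (spikeHeight d a h s) y]
    exact (dist_initProj_le _ _).trans_lt hy.2
  · rw [← hball (faceProj k x)]
    refine measure_mono fun y hy => ?_
    rw [Metric.mem_ball, ← faceProj_faceMap k b y]
    exact (dist_faceProj_le _ _ _).trans_lt hy.2

/-- A single ball suffices: one of radius `3 (d + 1) a` contains the whole boundary, and `a ^ d`
cancels against the lower bound for the perimeter. -/
lemma le_distortion_spikyBox (hd : 1 ≤ d) (hh : 0 < h) (hha : h ≤ a) :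
    ENNReal.ofReal (√(1 + (2 * h / s) ^ 2) /
      ((volume : Measure (E d)).real (Metric.ball 0 1) * (3 * (d + 1)) ^ d)) ≤
      distortion (spikyBox d a h s) := by
  have ha : 0 < a := hh.trans_le hha
  have hr : 0 < 3 * (d + 1) * a := by positivity
  refine le_trans ?_ (le_iSup_of_le 0 (le_iSup_of_le (3 * (d + 1) * a) (le_iSup_of_le hr le_rfl)))
  have hsub : frontier (spikyBox d a h s) ⊆ Metric.ball 0 (3 * (d + 1) * a) := by
    refine frontier_subset_closure.trans (closure_spikyBox_subset.trans
      ((closedSpikyBox_subset_closedBall hd hh hha).trans (Metric.closedBall_subset_ball ?_)))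
    have : 0 < (d + 1) * a := by positivity
    linarith
  have e : boundaryMeasure (spikyBox d a h s) (Metric.ball 0 (3 * (d + 1) * a)) =
      perimeter (spikyBox d a h s) := by
    rw [perimeter, boundaryMeasure, Measure.restrict_apply Metric.isOpen_ball.measurableSet,
      inter_eq_self_of_subset_right hsub, Measure.restrict_apply_univ]
  rw [e]
  have hv := volume_real_ball_pos d
  refine le_trans ?_ (ENNReal.div_le_div_right (le_perimeter_spikyBox (s := s) hd hh ha) _)
  have e2 : volume (Metric.ball (0 : E d) 1) =
      ENNReal.ofReal ((volume : Measure (E d)).real (Metric.ball 0 1)) :=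
    (ENNReal.ofReal_toReal measure_ball_lt_top.ne).symm
  rw [e2, ← ENNReal.ofReal_pow hr.le, ← ENNReal.ofReal_mul hv.le,
    ← ENNReal.ofReal_div_of_pos (by positivity)]
  refine ENNReal.ofReal_le_ofReal (le_of_eq ?_)
  rw [mul_pow _ a]
  field_simp

end

/-! ### Lower bound for the second Steklov eigenvalue -/

/-- A weighted mean is the pairing with an element of the dual `L^q`. Continuity makes it an
admissible odd map for the genus. -/
lemma continuous_integral_mul {n : ℕ} {Ω : Set (E n)} {p : ℝ} [hp : Fact (1 < p)] {φ : E n → ℝ}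
    (hφ : Continuous φ) (hc : HasCompactSupport φ) :
    Continuous fun w : LpPair Ω p => ∫ x in Ω, w.fst x * φ x := by
  obtain ⟨q, hq⟩ : ∃ q, p.HolderConjugate q := ⟨_, Real.HolderConjugate.conjExponent hp.out⟩
  have : (ENNReal.ofReal p).HolderConjugate (ENNReal.ofReal q) := hq.ennrealOfReal
  have : Fact (1 ≤ ENNReal.ofReal q) := ⟨ENNReal.one_le_ofReal.2 hq.symm.lt.le⟩
  have hmem : MemLp φ (ENNReal.ofReal q) (volume.restrict Ω) :=
    (hφ.memLp_of_hasCompactSupport hc).restrict Ω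
  have e (w : LpPair Ω p) : ∫ x in Ω, w.fst x * φ x =
      (ContinuousLinearMap.mul ℝ ℝ).lpPairing (volume.restrict Ω) (ENNReal.ofReal p)
        (ENNReal.ofReal q) w.fst (hmem.toLp φ) := by
    rw [ContinuousLinearMap.lpPairing_eq_integral]
    refine integral_congr_ae ?_
    filter_upwards [hmem.coeFn_toLp] with x hx
    simp [hx]
  simp_rw [e]
  have h1 : Continuous fun w : LpPair Ω p => w.fst := by fun_prop
  exact (((ContinuousLinearMap.mul ℝ ℝ).lpPairing (volume.restrict Ω) (ENNReal.ofReal p)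
    (ENNReal.ofReal q)).flip (hmem.toLp φ)).continuous.comp h1

/-- A set of genus at least two meets the zero set of every continuous odd function. -/
lemma exists_eq_zero_of_two_le_genus {V : Type*} [TopologicalSpace V] [Neg V] {F : Set V}
    (hF : 2 ≤ genus F) {f : V → ℝ} (hf : Continuous f) (hodd : ∀ v, f (-v) = - f v) :
    ∃ v ∈ F, f v = 0 := by
  by_contra hcon
  push Not at hcon
  have h1 : genus F ≤ 1 := by
    refine iInf₂_le_of_le 1 ⟨le_rfl, fun v => WithLp.toLp 2 fun _ => f v, ?_, ?_, ?_⟩ le_rfl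
    · fun_prop
    · intro u _
      ext i
      simp [hodd]
    · intro u hu h0
      refine hcon u hu ?_
      simpa using congrArg (fun x : E 1 => x 0) h0
  have h2 : (2 : ℕ∞) ≤ 1 := hF.trans h1
  exact absurd h2 (by decide)

lemma energy_eq_ofReal {n : ℕ} {Ω : Set (E n)} {p : ℝ} (hp : 0 < p)
    (G : Lp (E n) (ENNReal.ofReal p) (volume.restrict Ω)) :
    ∫⁻ x in Ω, ‖G x‖ₑ ^ p = ENNReal.ofReal (∫ x in Ω, ‖G x‖ ^ p) := by
  have hint := (Lp.memLp G).integrable_norm_rpow (by simpa using hp) ENNReal.ofReal_ne_top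
  rw [ENNReal.toReal_ofReal hp.le] at hint
  rw [ofReal_integral_eq_lintegral_ofReal hint (.of_forall fun x => by positivity)]
  congr 1
  ext x
  rw [← ENNReal.ofReal_rpow_of_nonneg (norm_nonneg _) hp.le, ofReal_norm]

/-- If every Sobolev function with vanishing weighted mean is bounded by a multiple of the norm of
its gradient, and has traces, then the second eigenvalue is bounded from below. -/
lemma inv_le_steklovEigenvalue {d : ℕ} {Ω : Set (E (d + 1))} {p : ℝ} [hp : Fact (1 < p)]
    {φ : E (d + 1) → ℝ} (hφ : Continuous φ) (hc : HasCompactSupport φ) {κ : ℝ} (hκ : 0 ≤ κ)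
    (hbd : ∀ w ∈ sobolevSpace Ω p, ∫ x in Ω, w.fst x * φ x = 0 →
      ∀ᵐ x ∂(volume.restrict Ω), |w.fst x| ≤ κ * (∫ x in Ω, ‖w.snd x‖ ^ p) ^ (1 / p))
    (htr : ∀ w ∈ sobolevSpace Ω p, ∀ M, (∀ᵐ x ∂(volume.restrict Ω), |w.fst x| ≤ M) →
      ∀ x ∈ frontier Ω, |trace Ω (fun y => w.fst y) x| ≤ M) :
    (ENNReal.ofReal (κ ^ p) * perimeter Ω)⁻¹ ≤ steklovEigenvalue Ω p 2 := by
  have hp0 : 0 < p := zero_lt_one.trans hp.out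
  refine le_iInf₂ fun F hF => ?_
  obtain ⟨w, hwF, hw0⟩ := exists_eq_zero_of_two_le_genus (by exact_mod_cast hF.2.2.2)
    (continuous_integral_mul (Ω := Ω) (p := p) hφ hc) (fun w => by
      rw [← integral_neg]
      refine integral_congr_ae ?_
      filter_upwards [Lp.coeFn_neg w.fst] with x hx
      rw [WithLp.neg_fst, hx]
      simp)
  refine le_iSup₂_of_le w hwF ?_
  have hwS := (hF.1 hwF).1
  have hwne : w ≠ 0 := fun h => (hF.1 hwF).2 h
  obtain ⟨I, hI⟩ : ∃ I, I = ∫ x in Ω, ‖w.snd x‖ ^ p := ⟨_, rfl⟩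
  have hI0 : 0 ≤ I := by
    rw [hI]
    exact integral_nonneg fun x => by positivity
  have hen : energy Ω p w = ENNReal.ofReal I := by
    rw [hI]
    exact energy_eq_ofReal hp0 w.snd
  have hsup := hbd w hwS hw0
  rw [← hI] at hsup
  have hbE : boundaryEnergy Ω p w ≤ ENNReal.ofReal (κ ^ p) * perimeter Ω * ENNReal.ofReal I := by
    have hfr : MeasurableSet (frontier Ω) := isClosed_frontier.measurableSet
    calc boundaryEnergy Ω p w ≤ ∫⁻ _x, ENNReal.ofReal ((κ * I ^ (1 / p)) ^ p) ∂(boundaryMeasure Ω) := by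
          refine setLIntegral_mono' hfr fun x hx => ?_
          have h1 := htr w hwS _ hsup x hx
          rw [← ENNReal.ofReal_rpow_of_nonneg (by positivity) hp0.le, ← ofReal_norm,
            Real.norm_eq_abs]
          gcongr
      _ = ENNReal.ofReal ((κ * I ^ (1 / p)) ^ p) * perimeter Ω := lintegral_const _
      _ = _ := by
          rw [Real.mul_rpow hκ (by positivity), ← Real.rpow_mul hI0, one_div,
            inv_mul_cancel₀ hp0.ne', Real.rpow_one, ENNReal.ofReal_mul (by positivity)]
          ring
  -- In `ℝ≥0∞` the quotient `0 / 0` is `0`, which would break the bound. Zero energy forces `u = 0`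
  -- and `∇u = 0`, but `0` is not in `F`.
  have hI' : I ≠ 0 := by
    intro h0
    rw [h0, Real.zero_rpow (by positivity : 1 / p ≠ 0), mul_zero] at hsup
    apply hwne
    have hint := (Lp.memLp w.snd).integrable_norm_rpow (by simpa using hp0) ENNReal.ofReal_ne_top
    rw [ENNReal.toReal_ofReal hp0.le] at hint
    have hz := (integral_eq_zero_iff_of_nonneg (fun x => by positivity) hint).1 (hI ▸ h0)
    have h1 : w.fst = 0 := by
      refine Lp.ext ?_
      filter_upwards [hsup, Lp.coeFn_zero ℝ (ENNReal.ofReal p) (volume.restrict Ω)] with x hx h0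
      rw [h0]
      exact abs_nonpos_iff.1 hx
    have h2 : w.snd = 0 := by
      refine Lp.ext ?_
      filter_upwards [hz, Lp.coeFn_zero (E (d + 1)) (ENNReal.ofReal p) (volume.restrict Ω)]
        with x hx h0
      rw [h0]
      exact norm_eq_zero.1 ((Real.rpow_eq_zero (norm_nonneg _) hp0.ne').1 hx)
    exact WithLp.ofLp_injective _ (Prod.ext h1 h2)
  rw [rayleigh, hen]
  rw [ENNReal.le_div_iff_mul_le (.inr (by simpa using lt_of_le_of_ne hI0 hI'.symm))
    (.inr ENNReal.ofReal_ne_top)]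
  calc _ ≤ (ENNReal.ofReal (κ ^ p) * perimeter Ω)⁻¹ *
        (ENNReal.ofReal (κ ^ p) * perimeter Ω * ENNReal.ofReal I) := by gcongr
    _ = (ENNReal.ofReal (κ ^ p) * perimeter Ω)⁻¹ *
        (ENNReal.ofReal (κ ^ p) * perimeter Ω) * ENNReal.ofReal I := by ring
    _ ≤ 1 * ENNReal.ofReal I := by
        gcongr
        exact ENNReal.inv_mul_le_one _
    _ = _ := one_mul _

section

variable {d m : ℕ} {a h s : ℝ}

/-- The covering of `spikyBox` by convex sets. -/
def spikyPiece {d m : ℕ} (a h s : ℝ) : Option (Fin d → Fin m) → Set (E (d + 1))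
  | none => openCube d a
  | some i => spikeCell a h s i

lemma iUnion_spikyPiece (hs : 0 < s) (hh : 0 < h) (hha : h ≤ a) (hm : a = m * s) :
    ⋃ i : Option (Fin d → Fin m), spikyPiece a h s i = spikyBox d a h s := by
  rw [spikyBox_eq_union hs hh hha hm, iUnion_option]
  rfl

lemma isOpen_spikyPiece (i : Option (Fin d → Fin m)) : IsOpen (spikyPiece a h s i) := by
  cases i
  · exact isOpen_openCube
  · exact isOpen_spikeCell _

lemma convex_spikyPiece (i : Option (Fin d → Fin m)) : Convex ℝ (spikyPiece a h s i) := by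
  cases i
  · exact convex_openCube
  · exact convex_spikeCell _

/-- All pieces whose closure contains a given point overlap near this point. -/
lemma exists_mem_closure_inter_spikyPiece (hs : 0 < s) (hh : 0 < h) (hha : h ≤ a) (hm : a = m * s)
    {x : E (d + 1)} (hx : x ∈ closure (spikyBox d a h s)) :
    ∃ i₀ : Option (Fin d → Fin m), ∀ i : Option (Fin d → Fin m),
      x ∈ closure (spikyPiece a h s i) →
        x ∈ closure (spikyPiece a h s i ∩ spikyPiece a h s i₀) := by
  have ha : 0 < a := hh.trans_le hha
  -- If `x` is in the closed cube, the cube overlaps every cell and serves as `i₀`. Otherwise `x`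
  -- lies above height `a`, strictly inside the horizontal extent of one cell, and only that piece
  -- touches it.
  by_cases hQ : x ∈ closure (openCube d a)
  · refine ⟨none, fun i hi => ?_⟩
    cases i with
    | none => simpa using hi
    | some i =>
      exact mem_closure_inter_of_convex (isOpen_spikeCell i) isOpen_openCube (convex_spikeCell i)
        convex_openCube (spikeCell_inter_openCube_nonempty hs hh hha hm i) hi hQ
  · rw [← iUnion_spikyPiece hs hh hha hm, closure_iUnion_of_finite] at hx
    obtain ⟨i₀, hi₀⟩ := mem_iUnion.1 hx
    refine ⟨i₀, fun i hi => ?_⟩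
    suffices i = i₀ by simpa [this] using hi₀
    rcases i₀ with _ | i₀
    · exact absurd hi₀ hQ
    rcases i with _ | i
    · exact absurd hi hQ
    have hbox (i : Fin d → Fin m) (h1 : x ∈ closure (spikeCell a h s i)) (ℓ : Fin d) :
        (i ℓ : ℝ) < x ℓ.castSucc / s ∧ x ℓ.castSucc / s < (i ℓ : ℝ) + 1 := by
      have h1 := closure_spikeCell_subset _ h1
      have hgt : a < x (Fin.last d) := by
        by_contra hcon
        refine hQ (mem_closure_openCube ha (fun ℓ => ?_) ⟨by linarith [h1.2], not_lt.1 hcon⟩)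
        have h3 := cell_subset hs hm (i ℓ)
        exact ⟨h3.1.trans (h1.1 ℓ).1.1, (h1.1 ℓ).1.2.trans h3.2⟩
      have h4 := (h1.1 ℓ).2
      constructor
      · by_contra hcon
        have : 2 * h * (x ℓ.castSucc / s - (i ℓ : ℝ)) ≤ 0 :=
          mul_nonpos_of_nonneg_of_nonpos (by positivity) (by linarith)
        linarith [h4.1]
      · by_contra hcon
        have : 2 * h * ((i ℓ : ℝ) + 1 - x ℓ.castSucc / s) ≤ 0 :=
          mul_nonpos_of_nonneg_of_nonpos (by positivity) (by linarith)
        linarith [h4.2]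
    congr 1
    ext ℓ
    have h5 := hbox i hi ℓ
    have h6 := hbox i₀ hi₀ ℓ
    have h7 : ((i ℓ : ℕ) : ℝ) < ((i₀ ℓ : ℕ) : ℝ) + 1 := by linarith
    have h8 : ((i₀ ℓ : ℕ) : ℝ) < ((i ℓ : ℕ) : ℝ) + 1 := by linarith
    norm_cast at h7 h8
    omega

lemma norm_sub_le_of_coord {x y : E (d + 1)} {b : ℝ}
    (h1 : ∀ ℓ : Fin d, |x ℓ.castSucc - y ℓ.castSucc| ≤ b)
    (h2 : |x (Fin.last d) - y (Fin.last d)| ≤ b) : ‖x - y‖ ≤ (d + 1) * b := by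
  have := norm_le_of_coord_le (x := x - y) (b := b) fun k =>
    Fin.lastCases (by simpa using h2) (fun ℓ => by simpa using h1 ℓ) k
  exact_mod_cast this

lemma norm_sub_le_openCube {x y : E (d + 1)} (hx : x ∈ openCube d a) (hy : y ∈ openCube d a) :
    ‖x - y‖ ≤ (d + 1) * a := by
  refine norm_sub_le_of_coord (fun ℓ => abs_le.2 ?_) (abs_le.2 ?_)
  · constructor <;> linarith [(hx.1 ℓ).1, (hx.1 ℓ).2, (hy.1 ℓ).1, (hy.1 ℓ).2]
  · constructor <;> linarith [hx.2.1, hx.2.2, hy.2.1, hy.2.2]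

/-- The two roof inequalities of one coordinate add up to `x_n < a + h`, so the cell has vertical
extent at most `2 h`; its width is `s ≤ h`. -/
lemma norm_sub_le_spikeCell (hd : 1 ≤ d) (hsh : s ≤ h) {i : Fin d → Fin m}
    {x y : E (d + 1)} (hx : x ∈ spikeCell a h s i) (hy : y ∈ spikeCell a h s i) :
    ‖x - y‖ ≤ (d + 1) * (2 * h) := by
  refine norm_sub_le_of_coord (fun ℓ => abs_le.2 ?_) (abs_le.2 ?_)
  · have h1 := (hx.1 ℓ).1
    have h2 := (hy.1 ℓ).1
    constructor <;> linarith [h1.1, h1.2, h2.1, h2.2]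
  · have h1 := (hx.1 ⟨0, hd⟩).2
    have h2 := (hy.1 ⟨0, hd⟩).2
    constructor <;> linarith [h1.1, h1.2, h2.1, h2.2, hx.2, hy.2]

lemma ball_subset_openCube :
    Metric.ball (WithLp.toLp 2 fun _ => a / 2 : E (d + 1)) (a / 2) ⊆ openCube d a := by
  intro x hx
  have key (k) : x k ∈ Ioo 0 a := by
    have := abs_lt.1 ((abs_coord_le_norm _ k).trans_lt (mem_ball_iff_norm.1 hx))
    simp only [PiLp.sub_apply] at this
    constructor <;> linarith [this.1, this.2]
  exact ⟨fun ℓ => key _, key _⟩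

/-- The ball sits in the box below the pyramid, at depth `h / 2`, where the cell has its full width
`s`. -/
lemma exists_ball_subset_spikeCell (hs : 0 < s) (hsh : s ≤ h) (hh : 0 < h) (i : Fin d → Fin m) :
    ∃ c : E (d + 1), Metric.ball c (s / 2) ⊆ spikeCell a h s i := by
  refine ⟨WithLp.toLp 2 (Fin.snoc (α := fun _ => ℝ) (fun ℓ => s * ((i ℓ : ℝ) + 1 / 2))
    (a - h / 2)), fun x hx => ?_⟩
  have key (k) := abs_lt.1 ((abs_coord_le_norm _ k).trans_lt (mem_ball_iff_norm.1 hx))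
  simp only [PiLp.sub_apply] at key
  have hlast := key (Fin.last d)
  simp only [Fin.snoc_last] at hlast
  refine ⟨fun ℓ => ?_, by linarith [hlast.1]⟩
  have h1 := key ℓ.castSucc
  simp only [Fin.snoc_castSucc] at h1
  have h2 : s * (i ℓ : ℝ) < x ℓ.castSucc := by linarith [h1.1]
  have h3 : x ℓ.castSucc < s * ((i ℓ : ℝ) + 1) := by linarith [h1.2]
  have h4 : (i ℓ : ℝ) < x ℓ.castSucc / s := by
    rw [lt_div_iff₀ hs]
    linarith
  have h5 : x ℓ.castSucc / s < (i ℓ : ℝ) + 1 := by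
    rw [div_lt_iff₀ hs]
    linarith
  have h6 : 0 < 2 * h * (x ℓ.castSucc / s - (i ℓ : ℝ)) := mul_pos (by positivity) (by linarith)
  have h7 : 0 < 2 * h * ((i ℓ : ℝ) + 1 - x ℓ.castSucc / s) := mul_pos (by positivity) (by linarith)
  exact ⟨⟨h2, h3⟩, by linarith [hlast.2], by linarith [hlast.2]⟩

/-- The constant in the `L^∞` estimate on `spikyBox`. -/
noncomputable def spikyConst (d : ℕ) (p a h s : ℝ) : ℝ :=
  morreyConst (d + 1) p * ((d + 1) * a * (((a / 2) ^ (d + 1))⁻¹) ^ (1 / p) +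
    2 * ((d + 1) * (2 * h) * (((s / 2) ^ (d + 1))⁻¹) ^ (1 / p)))

/-- Mean zero gives `|u| ≤ M1` on the cube. On a cell `u` stays within `M2` of some constant, and
one point of the overlap with the cube bounds that constant by `M1 + M2`; hence `M1 + 2 M2`, the
factor `2` in `spikyConst`. -/
lemma ae_abs_le_of_mean_zero (hd : 1 ≤ d) (hs : 0 < s) (hsh : s ≤ h) (hha : h ≤ a)
    (hm : a = m * s) {p : ℝ} (hp : (d : ℝ) + 1 < p) {u : E (d + 1) → ℝ}
    {G : E (d + 1) → E (d + 1)} (hw : HasWeakGradient (spikyBox d a h s) u G)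
    (hu : IntegrableOn u (spikyBox d a h s))
    (hG : MemLp G (ENNReal.ofReal p) (volume.restrict (spikyBox d a h s)))
    {φ : E (d + 1) → ℝ} (hφ : IsBallWeight (WithLp.toLp 2 fun _ => a / 2) (a / 2) φ)
    (hmean : ∫ x in spikyBox d a h s, u x * φ x = 0) :
    ∀ᵐ x ∂(volume.restrict (spikyBox d a h s)), |u x| ≤
      spikyConst d p a h s * (∫ x in spikyBox d a h s, ‖G x‖ ^ p) ^ (1 / p) := by
  have hh : 0 < h := hs.trans_le hsh
  have ha : 0 < a := hh.trans_le hha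
  have hp1 : 1 < p := by
    have : (0 : ℝ) ≤ d := by positivity
    linarith
  have hpn : ((d + 1 : ℕ) : ℝ) < p := by exact_mod_cast hp
  have hp0 : 0 < p := by linarith
  obtain ⟨Ω, hΩ⟩ : ∃ Ω, Ω = spikyBox d a h s := ⟨_, rfl⟩
  rw [← hΩ] at hw hu hG hmean ⊢
  have hΩo : IsOpen Ω := hΩ ▸ isOpen_spikyBox
  obtain ⟨N, hN⟩ : ∃ N, N = (∫ x in Ω, ‖G x‖ ^ p) ^ (1 / p) := ⟨_, rfl⟩
  have hGint : IntegrableOn (fun z => ‖G z‖ ^ p) Ω := by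
    have := hG.integrable_norm_rpow (by simpa using hp0) ENNReal.ofReal_ne_top
    rwa [ENNReal.toReal_ofReal hp0.le] at this
  have hN0 : 0 ≤ N := by
    have : 0 ≤ ∫ z in Ω, ‖G z‖ ^ p := integral_nonneg fun z => by positivity
    rw [hN]
    positivity
  have hpiece {D : Set (E (d + 1))} (hD : D ⊆ Ω) (hDo : IsOpen D) (hDc : Convex ℝ D) {R ρ : ℝ}
      (hR0 : 0 < R) (hR : ∀ y ∈ D, ∀ z ∈ D, ‖y - z‖ ≤ R) (hρ : 0 < ρ) {c : E (d + 1)}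
      (hc : Metric.ball c ρ ⊆ D) {ψ : E (d + 1) → ℝ} (hψ : IsBallWeight c ρ ψ) :
      ∀ᵐ x ∂(volume.restrict D), |u x - ∫ z in D, u z * ψ z| ≤
        morreyConst (d + 1) p * (R * ((ρ ^ (d + 1))⁻¹) ^ (1 / p)) * N := by
    refine ((hw.mono hD hΩo.measurableSet).ae_abs_sub_ballWeight_le (hu.mono_set hD) hp1 hpn
      (hG.mono_measure (Measure.restrict_mono_set _ hD)) hDo hDc hR0 hR hρ hc hψ).mono
      fun x hx => hx.trans ?_
    have hmc := morreyConst_pos hp0 hpn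
    have : (∫ z in D, ‖G z‖ ^ p) ^ (1 / p) ≤ N := by
      rw [hN]
      refine Real.rpow_le_rpow (integral_nonneg fun z => by positivity) ?_ (by positivity)
      exact setIntegral_mono_set hGint (.of_forall fun z => by positivity) hD.eventuallyLE
    refine le_trans ?_ (mul_assoc _ _ _).ge
    exact mul_le_mul_of_nonneg_left (mul_le_mul_of_nonneg_left this (by positivity)) hmc.le
  obtain ⟨M1, hM1⟩ : ∃ M1, M1 = morreyConst (d + 1) p *
    ((d + 1) * a * (((a / 2) ^ (d + 1))⁻¹) ^ (1 / p)) * N := ⟨_, rfl⟩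
  obtain ⟨M2, hM2⟩ : ∃ M2, M2 = morreyConst (d + 1) p *
    ((d + 1) * (2 * h) * (((s / 2) ^ (d + 1))⁻¹) ^ (1 / p)) * N := ⟨_, rfl⟩
  have hM20 : 0 ≤ M2 := by
    have hmc := morreyConst_pos hp0 hpn
    rw [hM2]
    positivity
  have hM : spikyConst d p a h s * (∫ x in Ω, ‖G x‖ ^ p) ^ (1 / p) = M1 + 2 * M2 := by
    rw [hM1, hM2, ← hN, spikyConst]
    ring
  rw [hM]
  have hQΩ : openCube d a ⊆ Ω := by
    rw [hΩ, spikyBox_eq_union hs hh hha hm]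
    exact subset_union_left
  have hcellΩ (i : Fin d → Fin m) : spikeCell a h s i ⊆ Ω := by
    rw [hΩ, spikyBox_eq_union hs hh hha hm]
    exact (subset_iUnion (fun i : Fin d → Fin m => spikeCell a h s i) i).trans subset_union_right
  have hQ : ∀ᵐ x ∂(volume.restrict (openCube d a)), |u x| ≤ M1 := by
    have h1 := hpiece hQΩ isOpen_openCube convex_openCube (R := (d + 1) * a) (by positivity)
      (fun y hy z hz => norm_sub_le_openCube hy hz) (half_pos ha) ball_subset_openCube hφ
    have h2 : ∫ z in openCube d a, u z * φ z = 0 := by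
      rw [← hmean]
      refine (setIntegral_eq_of_subset_of_forall_sdiff_eq_zero hΩo.measurableSet hQΩ ?_).symm
      intro x hx
      rw [image_eq_zero_of_notMem_tsupport (f := φ), mul_zero]
      exact fun hx' => hx.2 (ball_subset_openCube (hφ.tsupport_subset hx'))
    rw [h2, ← hM1] at h1
    simpa using h1
  rw [hΩ, spikyBox_eq_union hs hh hha hm, ae_restrict_union_iff, ae_restrict_iUnion_iff]
  refine ⟨hQ.mono fun x hx => hx.trans (by linarith), fun i => ?_⟩
  obtain ⟨c, hc⟩ := exists_ball_subset_spikeCell (a := a) hs hsh hh i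
  obtain ⟨ψ, hψ⟩ := exists_isBallWeight c (half_pos hs)
  have h1 := hpiece (hcellΩ i) (isOpen_spikeCell i) (convex_spikeCell i) (R := (d + 1) * (2 * h))
    (by positivity) (fun y hy z hz => norm_sub_le_spikeCell hd hsh hy hz) (half_pos hs) hc hψ
  rw [← hM2] at h1
  have h2 : ∀ᵐ x ∂(volume.restrict (spikeCell a h s i ∩ openCube d a)),
      |u x - ∫ z in spikeCell a h s i, u z * ψ z| ≤ M2 ∧ |u x| ≤ M1 :=
    (ae_restrict_of_ae_restrict_of_subset inter_subset_left h1).and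
      (ae_restrict_of_ae_restrict_of_subset inter_subset_right hQ)
  have : (ae (volume.restrict (spikeCell a h s i ∩ openCube d a))).NeBot :=
    ae_restrict_neBot.2 (((isOpen_spikeCell i).inter isOpen_openCube).measure_pos volume
      (spikeCell_inter_openCube_nonempty hs hh hha hm i)).ne'
  obtain ⟨y, hy1, hy2⟩ := h2.exists
  refine h1.mono fun x hx => ?_
  rw [abs_le] at *
  constructor <;> linarith [hy1.1, hy1.2, hy2.1, hy2.2, hx.1, hx.2]

theorem inv_le_steklovEigenvalue_spikyBox (hd : 1 ≤ d) (hs : 0 < s) (hsh : s ≤ h) (hha : h ≤ a)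
    (hm : a = m * s) {p : ℝ} [hp1 : Fact (1 < p)] (hp : (d : ℝ) + 1 < p) :
    (ENNReal.ofReal (spikyConst d p a h s ^ p) * perimeter (spikyBox d a h s))⁻¹ ≤
      steklovEigenvalue (spikyBox d a h s) p 2 := by
  have hh : 0 < h := hs.trans_le hsh
  have ha : 0 < a := hh.trans_le hha
  have hp0 : 0 < p := zero_lt_one.trans hp1.out
  have hpn : ((d + 1 : ℕ) : ℝ) < p := by exact_mod_cast hp
  have hΩb : Bornology.IsBounded (spikyBox d a h s) := Metric.isBounded_closedBall.subset
    (spikyBox_subset_closedSpikyBox.trans (closedSpikyBox_subset_closedBall hd hh hha))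
  have : IsFiniteMeasure (volume.restrict (spikyBox d a h s)) :=
    ⟨by simpa using hΩb.measure_lt_top⟩
  have hint (w : LpPair (spikyBox d a h s) p) : IntegrableOn w.fst (spikyBox d a h s) :=
    (Lp.memLp w.fst).integrable (ENNReal.one_le_ofReal.2 hp1.out.le)
  obtain ⟨φ, hφ⟩ := exists_isBallWeight (WithLp.toLp 2 fun _ => a / 2 : E (d + 1)) (half_pos ha)
  refine inv_le_steklovEigenvalue hφ.contDiff.continuous hφ.hasCompactSupport ?_
    (fun w hw hmean => ?_) fun w hw M hM x hx => ?_
  · have := morreyConst_pos hp0 hpn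
    unfold spikyConst
    positivity
  · exact ae_abs_le_of_mean_zero hd hs hsh hha hm hp (u := w.fst) (G := w.snd) hw (hint w)
      (Lp.memLp w.snd) hφ hmean
  · have hxc := frontier_subset_closure hx
    refine abs_trace_le isOpen_spikyBox (hint w) hxc (fun ε hε => ?_) hM
    obtain ⟨i₀, hi₀⟩ := exists_mem_closure_inter_spikyPiece hs hh hha hm hxc
    have hsub (i : Option (Fin d → Fin m)) : spikyPiece a h s i ⊆ spikyBox d a h s := by
      rw [← iUnion_spikyPiece hs hh hha hm]
      exact subset_iUnion (fun i : Option (Fin d → Fin m) => spikyPiece a h s i) i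
    suffices h : ∃ r > 0, ∃ b : ℝ, ∀ᵐ y ∂(volume.restrict
        ((⋃ i : Option (Fin d → Fin m), spikyPiece a h s i) ∩ Metric.ball x r)),
          |w.fst y - b| ≤ ε by
      rwa [iUnion_spikyPiece hs hh hha hm] at h
    refine exists_ae_abs_sub_le_iUnion isOpen_spikyPiece (fun i hi ε hε => ?_) hi₀ hε
    exact (HasWeakGradient.mono (G := w.snd) hw (hsub i)
      isOpen_spikyBox.measurableSet).exists_ae_abs_sub_le ((hint w).mono_set (hsub i)) hp1.out hpn
      ((Lp.memLp w.snd).mono_measure (Measure.restrict_mono_set _ (hsub i))) (isOpen_spikyPiece i)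
      (convex_spikyPiece i) (hΩb.subset (hsub i)) hi hε

end

/-! ### The parameters of the domains `Ω_j` -/

section

variable {d : ℕ} {p : ℝ}

/-- The form `(β - 1)(p - n) = n (n - 1)(p - 1)` in which the choice of `β` is used, both for its
size and in the exponent comparison for the cells. -/
lemma betaChoice_sub_one_mul (hp : (d : ℝ) + 1 < p) :
    (betaChoice d p - 1) * (p - (d + 1)) = (d + 1) * d * (p - 1) := by
  have : p - ((d : ℝ) + 1) ≠ 0 := by linarith
  rw [betaChoice]
  field_simp
  ring

/-- This makes the height `j^(d-β)` at most `1/j`, and makes the rounding in `m(j)` negligible as `j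
→ ∞`. -/
lemma le_betaChoice_sub_one (hd : 1 ≤ d) (hp : (d : ℝ) + 1 < p) :
    (d : ℝ) + 1 ≤ betaChoice d p - 1 := by
  have hd' : (1 : ℝ) ≤ d := by exact_mod_cast hd
  have h1 := betaChoice_sub_one_mul hp
  have h2 : 0 < p - ((d : ℝ) + 1) := by linarith
  refine le_of_mul_le_mul_right ?_ h2
  rw [h1]
  have h3 : p - ((d : ℝ) + 1) ≤ d * (p - 1) := by nlinarith
  have h4 : 0 ≤ (d : ℝ) + 1 := by positivity
  nlinarith [mul_le_mul_of_nonneg_left h3 h4]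

/-- The rounding error of `m(j)` is recorded in `θ = m(j) / j^(β-1)`. Then `1/s = θ j^β`, and in the
slope `2h/s` the powers of `j` involving `β` cancel, leaving `2 θ j^d`. -/
lemma counterDomain_eq_spikyBox (hd : 1 ≤ d) (hp : (d : ℝ) + 1 < p) {j : ℕ} (hj : 1 ≤ j) :
    ∃ (h s θ : ℝ) (m : ℕ), counterDomain d p j = spikyBox d (1 / j) h s ∧ 0 < s ∧ s ≤ h ∧
      h ≤ 1 / j ∧ (1 / j : ℝ) = m * s ∧ 1 ≤ θ ∧ θ ≤ 1 + ((j : ℝ) ^ (betaChoice d p - 1))⁻¹ ∧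
      2 * h / s = 2 * θ * (j : ℝ) ^ d ∧ h = (j : ℝ) ^ (d - betaChoice d p) ∧
      s⁻¹ = θ * (j : ℝ) ^ betaChoice d p := by
  have hj1 : (1 : ℝ) ≤ j := by exact_mod_cast hj
  have hj0 : (0 : ℝ) < j := by linarith
  obtain ⟨b, hb⟩ : ∃ b, b = betaChoice d p := ⟨_, rfl⟩
  have hb1 : (d : ℝ) + 1 ≤ b - 1 := hb ▸ le_betaChoice_sub_one hd hp
  obtain ⟨X, hX⟩ : ∃ X, X = (j : ℝ) ^ (b - 1) := ⟨_, rfl⟩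
  have hX0 : 0 < X := by rw [hX]; positivity
  obtain ⟨m, hm⟩ : ∃ m, m = subdivisions b j := ⟨_, rfl⟩
  have hm1 : X ≤ m := by
    rw [hm, subdivisions, ← hX]
    push_cast
    exact (Nat.lt_floor_add_one X).le
  have hm2 : (m : ℝ) ≤ X + 1 := by
    rw [hm, subdivisions, ← hX]
    push_cast
    linarith [Nat.floor_le hX0.le]
  have hm0 : (0 : ℝ) < m := hX0.trans_le hm1
  have hjb : (j : ℝ) ^ b = j * X := by
    rw [hX, ← Real.rpow_one_add' hj0.le (by linarith)]
    congr 1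
    ring
  have hh : 1 / (j : ℝ) ^ pyramidExponent d b = (j : ℝ) ^ (d - b) := by
    rw [one_div, ← Real.rpow_neg hj0.le, pyramidExponent]
    congr 1
    ring
  have hjd : (j : ℝ) ^ ((d : ℝ) - b) = (j : ℝ) ^ d / (j * X) := by
    rw [Real.rpow_sub hj0, Real.rpow_natCast, hjb]
  have hjd1 : (1 : ℝ) ≤ (j : ℝ) ^ d := one_le_pow₀ hj1
  refine ⟨(j : ℝ) ^ ((d : ℝ) - b), 1 / (j * m), m / X, m, ?_, by positivity, ?_, ?_, ?_, ?_, ?_, ?_,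
    by rw [hb], ?_⟩
  · rw [counterDomain, ← hb, pyramidDomain_eq_spikyBox hd hj, hh, hm]
  · rw [hjd, div_le_div_iff₀ (by positivity) (by positivity), one_mul]
    calc j * X ≤ 1 * (j * m) := by rw [one_mul]; gcongr
      _ ≤ _ := by gcongr
  · rw [one_div, ← Real.rpow_neg_one]
    exact Real.rpow_le_rpow_of_exponent_le hj1 (by linarith)
  · field_simp
  · rwa [one_le_div hX0]
  · rw [← hb, ← hX, div_le_iff₀ hX0]
    field_simp
    exact hm2
  · rw [hjd]
    field_simp
  · rw [← hb, hjb]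
    field_simp

lemma sqrt_one_add_sq_bounds {L : ℝ} (hL : 0 ≤ L) : L ≤ √(1 + L ^ 2) ∧ √(1 + L ^ 2) ≤ L + 1 :=
  ⟨Real.le_sqrt_of_sq_le (by linarith), Real.sqrt_le_iff.2 ⟨by linarith, by nlinarith⟩⟩

lemma isBoundedLipschitzDomain_counterDomain (hd : 1 ≤ d) (hp : (d : ℝ) + 1 < p) {j : ℕ}
    (hj : 1 ≤ j) : IsBoundedLipschitzDomain (counterDomain d p j) := by
  obtain ⟨h, s, θ, m, e, hs, hsh, hha, hm, -⟩ := counterDomain_eq_spikyBox hd hp hj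
  rw [e]
  exact isBoundedLipschitzDomain_spikyBox hd hs (hs.trans_le hsh) hha hm

/-- Slope times the area of the base is `2 θ`. The remaining `2 d + 3` is `1` from `√(1 + L²) ≤ L +
1` and `2 (d + 1)` from the faces of the cube. -/
lemma perimeter_counterDomain_bounds (hd : 1 ≤ d) (hp : (d : ℝ) + 1 < p) {j : ℕ} (hj : 1 ≤ j) :
    ENNReal.ofReal 2 ≤ perimeter (counterDomain d p j) ∧
    perimeter (counterDomain d p j) ≤ ENNReal.ofReal
      (2 * (1 + ((j : ℝ) ^ (betaChoice d p - 1))⁻¹) + (2 * d + 3) * ((j : ℝ) ^ d)⁻¹) := by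
  have hj0 : (0 : ℝ) < j := by exact_mod_cast hj
  obtain ⟨h, s, θ, m, e, hs, hsh, hha, hm, hθ1, hθ2, hL, -, -⟩ :=
    counterDomain_eq_spikyBox hd hp hj
  have hh := hs.trans_le hsh
  have hw := sqrt_one_add_sq_bounds (L := 2 * h / s) (by positivity)
  have hJ : (0 : ℝ) < (j : ℝ) ^ d := by positivity
  rw [e]
  constructor
  · refine le_trans (ENNReal.ofReal_le_ofReal ?_) (le_perimeter_spikyBox (s := s) hd hh
      (hh.trans_le hha))
    rw [one_div_pow, mul_one_div, le_div_iff₀ hJ]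
    refine le_trans ?_ hw.1
    rw [hL]
    gcongr
    linarith
  · refine (perimeter_spikyBox_le hd hh hs hm).trans (ENNReal.ofReal_le_ofReal ?_)
    rw [one_div_pow, one_div]
    calc _ ≤ (2 * θ * (j : ℝ) ^ d + 1 + 2 * (d + 1)) * ((j : ℝ) ^ d)⁻¹ := by
          gcongr
          rw [← hL]
          exact hw.2
      _ = 2 * θ + (2 * d + 3) * ((j : ℝ) ^ d)⁻¹ := by
          field_simp
          ring
      _ ≤ _ := by gcongr

lemma tendsto_perimeter_counterDomain (hd : 1 ≤ d) (hp : (d : ℝ) + 1 < p) :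
    Tendsto (fun j : ℕ => perimeter (counterDomain d p j)) atTop (𝓝 2) := by
  have h1 : Tendsto (fun j : ℕ => ((j : ℝ) ^ (betaChoice d p - 1))⁻¹) atTop (𝓝 0) := by
    have := le_betaChoice_sub_one hd hp
    have hpos : 0 < betaChoice d p - 1 := by
      have : (0 : ℝ) ≤ d := by positivity
      linarith
    exact ((tendsto_rpow_atTop hpos).comp tendsto_natCast_atTop_atTop).inv_tendsto_atTop
  have h2 : Tendsto (fun j : ℕ => ((j : ℝ) ^ d)⁻¹) atTop (𝓝 0) :=
    ((tendsto_pow_atTop (by omega)).comp tendsto_natCast_atTop_atTop).inv_tendsto_atTop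
  have h3 : Tendsto (fun j : ℕ => ENNReal.ofReal (2 * (1 + ((j : ℝ) ^ (betaChoice d p - 1))⁻¹) +
      (2 * d + 3) * ((j : ℝ) ^ d)⁻¹)) atTop (𝓝 2) := by
    have := ENNReal.tendsto_ofReal (((h1.const_add 1).const_mul 2).add
      (h2.const_mul (2 * (d : ℝ) + 3)))
    simpa using this
  refine tendsto_of_tendsto_of_tendsto_of_le_of_le' tendsto_const_nhds h3 ?_ ?_
  · filter_upwards [eventually_ge_atTop 1] with j hj
    simpa using (perimeter_counterDomain_bounds hd hp hj).1
  · filter_upwards [eventually_ge_atTop 1] with j hj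
    exact (perimeter_counterDomain_bounds hd hp hj).2

lemma exists_distortion_bounds (hd : 1 ≤ d) (hp : (d : ℝ) + 1 < p) :
    ∃ c₁ c₂ : ℝ, 0 < c₁ ∧ 0 < c₂ ∧ ∀ j : ℕ, 1 ≤ j →
      ENNReal.ofReal (c₁ * (j : ℝ) ^ d) ≤ distortion (counterDomain d p j) ∧
      distortion (counterDomain d p j) ≤ ENNReal.ofReal (c₂ * (j : ℝ) ^ d) := by
  obtain ⟨v, hv⟩ : ∃ v, v = (volume : Measure (E d)).real (Metric.ball 0 1) * (3 * (d + 1)) ^ d :=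
    ⟨_, rfl⟩
  have hv0 : 0 < v := by
    have := volume_real_ball_pos d
    rw [hv]
    positivity
  -- Here `2 d + 7` is `4`, from the slope with `θ ≤ 2`, plus `1 + 2 (d + 1)`, absorbed using `j^d ≥
  -- 1`.
  refine ⟨2 / v, 2 * d + 7, by positivity, by positivity, fun j hj => ?_⟩
  have hj1 : (1 : ℝ) ≤ j := by exact_mod_cast hj
  obtain ⟨h, s, θ, m, e, hs, hsh, hha, hm, hθ1, hθ2, hL, -, -⟩ :=
    counterDomain_eq_spikyBox hd hp hj
  have hh := hs.trans_le hsh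
  have hw := sqrt_one_add_sq_bounds (L := 2 * h / s) (by positivity)
  have hJ : (1 : ℝ) ≤ (j : ℝ) ^ d := one_le_pow₀ hj1
  have hθ3 : θ ≤ 2 := by
    have h1 := le_betaChoice_sub_one hd hp
    have h2 : (1 : ℝ) ≤ (j : ℝ) ^ (betaChoice d p - 1) := Real.one_le_rpow hj1 (by
      have : (0 : ℝ) ≤ d := by positivity
      linarith)
    linarith [inv_le_one_of_one_le₀ h2]
  rw [hL] at hw
  rw [e]
  constructor
  · refine le_trans (ENNReal.ofReal_le_ofReal ?_) (le_distortion_spikyBox (s := s) hd hh hha)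
    rw [← hv, hL, div_mul_eq_mul_div]
    gcongr
    refine le_trans ?_ hw.1
    gcongr
    linarith
  · refine (distortion_spikyBox_le hd hh hs hm).trans (ENNReal.ofReal_le_ofReal ?_)
    rw [hL]
    have h1 : 2 * θ * (j : ℝ) ^ d ≤ 4 * (j : ℝ) ^ d := by gcongr; linarith
    have h2 : 1 + 2 * ((d : ℝ) + 1) ≤ (1 + 2 * ((d : ℝ) + 1)) * (j : ℝ) ^ d :=
      le_mul_of_one_le_right (by positivity) hJ
    linarith [hw.2]

/-- The cube term scales exactly as `j^(n/p-1)`. The cell term `h s^(-n/p)` has order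
`j^(d-β+βn/p)`, and `β` is large enough for this to be no bigger. -/
lemma exists_spikyConst_le (hd : 1 ≤ d) (hp : (d : ℝ) + 1 < p) :
    ∃ C > 0, ∀ (j : ℕ) (h s θ : ℝ), 1 ≤ j → 0 < s → 1 ≤ θ → θ ≤ 2 →
      h = (j : ℝ) ^ (d - betaChoice d p) → s⁻¹ = θ * (j : ℝ) ^ betaChoice d p →
      spikyConst d p (1 / j) h s ≤ C * (j : ℝ) ^ (((d : ℝ) + 1) / p - 1) := by
  have hd' : (1 : ℝ) ≤ d := by exact_mod_cast hd
  have hp0 : 0 < p := by linarith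
  have hmc : 0 < morreyConst (d + 1) p := morreyConst_pos hp0 (by exact_mod_cast hp)
  obtain ⟨b, hb⟩ : ∃ b, b = betaChoice d p := ⟨_, rfl⟩
  have hb1 : (b - 1) * (p - (d + 1)) = (d + 1) * d * (p - 1) := hb ▸ betaChoice_sub_one_mul hp
  obtain ⟨γ, hγ⟩ : ∃ γ, γ = ((d : ℝ) + 1) / p := ⟨_, rfl⟩
  have hγ0 : 0 < γ := by rw [hγ]; positivity
  have hpow {t : ℝ} (ht : 0 < t) : (((t / 2) ^ (d + 1))⁻¹) ^ (1 / p) = (2 * t⁻¹) ^ γ := by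
    have e : ((t / 2) ^ (d + 1))⁻¹ = (2 * t⁻¹) ^ ((d : ℝ) + 1) := by
      have : ((d : ℝ) + 1) = ((d + 1 : ℕ) : ℝ) := by push_cast; ring
      rw [this, Real.rpow_natCast, ← inv_pow]
      congr 1
      field_simp
    rw [e, ← Real.rpow_mul (by positivity), hγ]
    congr 1
    ring
  -- After multiplication by `p` this reads `d p ≤ (β - 1)(p - n)`, which follows from `p ≤ n (p -
  -- 1)`.
  have hexp : (d - b) + b * γ ≤ γ - 1 := by
    have h1 : d * p ≤ (b - 1) * (p - (d + 1)) := by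
      have h3 : p ≤ (d + 1) * (p - 1) := by
        linarith [mul_le_mul_of_nonneg_right hd' hp0.le]
      rw [hb1]
      linarith [mul_le_mul_of_nonneg_left h3 (by positivity : (0 : ℝ) ≤ d)]
    have h2 : γ * p = d + 1 := by rw [hγ]; field_simp
    refine le_of_mul_le_mul_right ?_ hp0
    have h4 : (d - b + b * γ) * p = d * p - b * p + b * (γ * p) := by ring
    rw [h4, sub_mul, h2]
    linarith
  refine ⟨morreyConst (d + 1) p * ((d + 1) * 2 ^ γ + 2 * ((d + 1) * 2 * 4 ^ γ)), by positivity,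
    fun j h s θ hj hs hθ1 hθ2 hh hs' => ?_⟩
  have hj1 : (1 : ℝ) ≤ j := by exact_mod_cast hj
  have hj0 : (0 : ℝ) < j := by linarith
  rw [← hb] at hh hs'
  rw [spikyConst, hpow (by positivity), hpow hs, ← hγ,
    mul_assoc (morreyConst (d + 1) p) _ ((j : ℝ) ^ (γ - 1))]
  refine mul_le_mul_of_nonneg_left ?_ hmc.le
  rw [add_mul (((d : ℝ) + 1) * 2 ^ γ)]
  refine add_le_add (le_of_eq ?_) ?_
  · rw [one_div, inv_inv, Real.mul_rpow (by positivity) hj0.le, Real.rpow_sub_one hj0.ne']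
    field_simp
  · rw [mul_assoc (2 : ℝ) _ ((j : ℝ) ^ (γ - 1))]
    refine mul_le_mul_of_nonneg_left ?_ zero_le_two
    calc (d + 1) * (2 * h) * (2 * s⁻¹) ^ γ
        ≤ (d + 1) * (2 * (j : ℝ) ^ (d - b)) * (4 * (j : ℝ) ^ b) ^ γ := by
          rw [hh, hs']
          refine mul_le_mul_of_nonneg_left (Real.rpow_le_rpow (by positivity) ?_ hγ0.le)
            (by positivity)
          linarith [mul_le_mul_of_nonneg_right hθ2 (by positivity : 0 ≤ (j : ℝ) ^ b)]
      _ = (d + 1) * 2 * 4 ^ γ * (j : ℝ) ^ ((d - b) + b * γ) := by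
          rw [Real.mul_rpow (by positivity) (by positivity), ← Real.rpow_mul hj0.le,
            Real.rpow_add hj0]
          ring
      _ ≤ _ := by gcongr

lemma exists_le_steklovEigenvalue (hd : 1 ≤ d) [hp1 : Fact (1 < p)] (hp : (d : ℝ) + 1 < p) :
    ∃ C : ℝ, 0 < C ∧ ∀ j : ℕ, 1 ≤ j →
      ENNReal.ofReal (C * (j : ℝ) ^ (p - ((d : ℝ) + 1))) ≤
        steklovEigenvalue (counterDomain d p j) p 2 := by
  have hp0 : 0 < p := zero_lt_one.trans hp1.out
  obtain ⟨C, hC, hκ⟩ := exists_spikyConst_le hd hp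
  refine ⟨(C ^ p * (2 * d + 7))⁻¹, by positivity, fun j hj => ?_⟩
  have hj1 : (1 : ℝ) ≤ j := by exact_mod_cast hj
  have hj0 : (0 : ℝ) < j := by linarith
  have hper := (perimeter_counterDomain_bounds hd hp hj).2
  obtain ⟨h, s, θ, m, e, hs, hsh, hha, hm, hθ1, hθ2, hL, hh, hs'⟩ :=
    counterDomain_eq_spikyBox hd hp hj
  have hX : ((j : ℝ) ^ (betaChoice d p - 1))⁻¹ ≤ 1 := by
    have h1 := le_betaChoice_sub_one hd hp
    refine inv_le_one_of_one_le₀ (Real.one_le_rpow hj1 ?_)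
    have : (0 : ℝ) ≤ d := by positivity
    linarith
  have hY : ((j : ℝ) ^ d)⁻¹ ≤ 1 := inv_le_one_of_one_le₀ (one_le_pow₀ hj1)
  -- The worst case of the perimeter bound has both inverse powers of `j` equal to `1`: `2 · 2 + (2
  -- d + 3)`.
  have hper' : perimeter (counterDomain d p j) ≤ ENNReal.ofReal (2 * d + 7) := by
    refine hper.trans (ENNReal.ofReal_le_ofReal ?_)
    have : (2 * (d : ℝ) + 3) * ((j : ℝ) ^ d)⁻¹ ≤ 2 * (d : ℝ) + 3 :=
      mul_le_of_le_one_right (by positivity) hY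
    linarith
  have hκ1 := hκ j h s θ hj hs hθ1 (by linarith) hh hs'
  have hκ0 : 0 ≤ spikyConst d p (1 / j) h s := by
    have := morreyConst_pos (n := d + 1) hp0 (by exact_mod_cast hp)
    have : 0 < h := hs.trans_le hsh
    unfold spikyConst
    positivity
  have hκ2 : spikyConst d p (1 / j) h s ^ p ≤ C ^ p * (j : ℝ) ^ (((d : ℝ) + 1) - p) := by
    refine (Real.rpow_le_rpow hκ0 hκ1 hp0.le).trans_eq ?_
    rw [Real.mul_rpow hC.le (by positivity), ← Real.rpow_mul hj0.le]
    congr 2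
    field_simp
  rw [e] at hper' ⊢
  refine le_trans ?_ (inv_le_steklovEigenvalue_spikyBox hd hs hsh hha hm hp)
  calc ENNReal.ofReal ((C ^ p * (2 * d + 7))⁻¹ * (j : ℝ) ^ (p - ((d : ℝ) + 1)))
      = (ENNReal.ofReal (C ^ p * (j : ℝ) ^ (((d : ℝ) + 1) - p) * (2 * d + 7)))⁻¹ := by
        rw [← ENNReal.ofReal_inv_of_pos (by positivity)]
        congr 1
        have : (j : ℝ) ^ (p - ((d : ℝ) + 1)) = ((j : ℝ) ^ (((d : ℝ) + 1) - p))⁻¹ := by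
          rw [← Real.rpow_neg hj0.le]
          congr 1
          ring
        rw [this]
        field_simp
    _ ≤ _ := by
        rw [ENNReal.ofReal_mul (by positivity)]
        gcongr

/-! ### Divergence of the eigenvalues and sharpness of the distortion exponent -/

lemma tendsto_rpow_natCast_atTop {y : ℝ} (hy : 0 < y) :
    Tendsto (fun j : ℕ => (j : ℝ) ^ y) atTop atTop :=
  (tendsto_rpow_atTop hy).comp tendsto_natCast_atTop_atTop

lemma tendsto_steklovEigenvalue_counterDomain (hd : 1 ≤ d) [Fact (1 < p)]
    (hp : (d : ℝ) + 1 < p) :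
    Tendsto (fun j : ℕ => steklovEigenvalue (counterDomain d p j) p 2) atTop (𝓝 ⊤) := by
  obtain ⟨C, hC, h⟩ := exists_le_steklovEigenvalue hd hp
  have h1 : Tendsto (fun j : ℕ => ENNReal.ofReal (C * (j : ℝ) ^ (p - ((d : ℝ) + 1)))) atTop (𝓝 ⊤) :=
    ENNReal.tendsto_ofReal_atTop.comp
      ((tendsto_rpow_natCast_atTop (by linarith)).const_mul_atTop hC)
  refine tendsto_nhds_top_mono h1 ?_
  filter_upwards [eventually_ge_atTop 1] with j hj using h j hj

/-- For `q ≥ 0` the upper bound for the distortion gives `r = d q`. For `q < 0` the power reverses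
order, and the lower bound `c₁ j^d ≥ c₁` gives `r = 0`. -/
lemma exists_distortion_rpow_le (hd : 1 ≤ d) (hp : (d : ℝ) + 1 < p) {q : ℝ}
    (hq : q < (p - ((d : ℝ) + 1)) / d) :
    ∃ K r : ℝ, 0 ≤ K ∧ r < p - ((d : ℝ) + 1) ∧ ∀ j : ℕ, 1 ≤ j →
      distortion (counterDomain d p j) ^ q ≤ ENNReal.ofReal (K * (j : ℝ) ^ r) := by
  have hd' : (0 : ℝ) < d := by exact_mod_cast hd
  obtain ⟨c₁, c₂, hc₁, hc₂, h⟩ := exists_distortion_bounds hd hp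
  rcases le_or_gt 0 q with hq0 | hq0
  · refine ⟨c₂ ^ q, d * q, by positivity, by rwa [lt_div_iff₀ hd', mul_comm] at hq,
      fun j hj => ?_⟩
    have hj0 : (0 : ℝ) < j := by exact_mod_cast hj
    refine (ENNReal.rpow_le_rpow (h j hj).2 hq0).trans_eq ?_
    rw [ENNReal.ofReal_rpow_of_pos (by positivity), Real.mul_rpow hc₂.le (by positivity),
      ← Real.rpow_natCast, ← Real.rpow_mul hj0.le]
  · refine ⟨c₁ ^ q, 0, by positivity, by linarith, fun j hj => ?_⟩
    have hj1 : (1 : ℝ) ≤ j := by exact_mod_cast hj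
    rw [Real.rpow_zero, mul_one, ← ENNReal.ofReal_rpow_of_pos hc₁]
    rw [← neg_neg q, ENNReal.rpow_neg, ENNReal.rpow_neg _ (-q), ENNReal.inv_le_inv]
    refine ENNReal.rpow_le_rpow (le_trans (ENNReal.ofReal_le_ofReal ?_) (h j hj).1) (by linarith)
    exact le_mul_of_one_le_right hc₁.le (one_le_pow₀ hj1)

/-- The perimeters are at least one, so their positive power can be dropped. A bound would then keep
`j^(p-n-r)` bounded for all `j`, although `r < p - n`. -/
lemma not_exists_bound (hd : 1 ≤ d) [hp1 : Fact (1 < p)] (hp : (d : ℝ) + 1 < p) {q : ℝ}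
    (hq : q < (p - ((d : ℝ) + 1)) / d) :
    ¬ ∃ C : ℝ≥0, ∀ Ω : Set (E (d + 1)), IsBoundedLipschitzDomain Ω →
      perimeter Ω ^ ((p - 1) / d) * steklovEigenvalue Ω p 2 ≤ C * distortion Ω ^ q := by
  rintro ⟨C, hC⟩
  obtain ⟨c, hc, hσ⟩ := exists_le_steklovEigenvalue hd hp
  obtain ⟨K, r, hK, hr, hD⟩ := exists_distortion_rpow_le hd hp hq
  have hbound (j : ℕ) (hj : 1 ≤ j) : (j : ℝ) ^ (p - ((d : ℝ) + 1) - r) ≤ C * K / c := by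
    have hj0 : (0 : ℝ) < j := by exact_mod_cast hj
    have hper : 1 ≤ perimeter (counterDomain d p j) ^ ((p - 1) / d) := by
      have h1 : (1 : ℝ≥0∞) ≤ perimeter (counterDomain d p j) := by
        refine le_trans ?_ (perimeter_counterDomain_bounds hd hp hj).1
        simp
      refine ENNReal.one_le_rpow h1 ?_
      have : (0 : ℝ) < d := by exact_mod_cast hd
      have := hp1.out
      exact div_pos (by linarith) (by positivity)
    have h1 : ENNReal.ofReal (c * (j : ℝ) ^ (p - ((d : ℝ) + 1))) ≤
        ENNReal.ofReal (C * (K * (j : ℝ) ^ r)) := by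
      calc _ ≤ steklovEigenvalue (counterDomain d p j) p 2 := hσ j hj
        _ ≤ perimeter (counterDomain d p j) ^ ((p - 1) / d) *
            steklovEigenvalue (counterDomain d p j) p 2 := le_mul_of_one_le_left' hper
        _ ≤ C * distortion (counterDomain d p j) ^ q :=
            hC _ (isBoundedLipschitzDomain_counterDomain hd hp hj)
        _ ≤ C * ENNReal.ofReal (K * (j : ℝ) ^ r) := by gcongr; exact hD j hj
        _ = _ := by rw [ENNReal.ofReal_mul C.coe_nonneg, ENNReal.ofReal_coe_nnreal]
    rw [ENNReal.ofReal_le_ofReal_iff (by positivity)] at h1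
    rw [Real.rpow_sub hj0, le_div_iff₀ hc, div_mul_eq_mul_div, div_le_iff₀ (by positivity)]
    linarith
  have := tendsto_rpow_natCast_atTop (y := p - ((d : ℝ) + 1) - r) (by linarith)
  obtain ⟨j, hj1, hj2⟩ := ((this.eventually_gt_atTop (C * K / c)).and
    (eventually_ge_atTop 1)).exists
  exact absurd (hbound j hj2) (not_le.2 hj1)

end

end Steklov

/-- The dimension is `n = d + 1 ≥ 2`, so that `(p - n) / (n - 1)` is `(p - (d + 1)) / d`. -/
theorem theorem4p1 (d : ℕ) (hd : 1 ≤ d) (p : ℝ) [Fact (1 < p)] (hp : (d : ℝ) + 1 < p) :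
    (∀ j : ℕ, 1 ≤ j → IsBoundedLipschitzDomain (counterDomain d p j)) ∧
    Tendsto (fun j : ℕ => perimeter (counterDomain d p j)) atTop (𝓝 2) ∧
    (∃ C : ℝ, 0 < C ∧ ∀ j : ℕ, 1 ≤ j →
      ENNReal.ofReal (C * (j : ℝ) ^ (p - ((d : ℝ) + 1))) ≤
        steklovEigenvalue (counterDomain d p j) p 2) ∧
    Tendsto (fun j : ℕ => steklovEigenvalue (counterDomain d p j) p 2) atTop (𝓝 ⊤) ∧
    (∃ c₁ c₂ : ℝ, 0 < c₁ ∧ 0 < c₂ ∧ ∀ j : ℕ, 1 ≤ j →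
      ENNReal.ofReal (c₁ * (j : ℝ) ^ d) ≤ distortion (counterDomain d p j) ∧
      distortion (counterDomain d p j) ≤ ENNReal.ofReal (c₂ * (j : ℝ) ^ d)) ∧
    (∀ q : ℝ, q < (p - ((d : ℝ) + 1)) / d →
      ¬ ∃ C : ℝ≥0, ∀ Ω : Set (E (d + 1)), IsBoundedLipschitzDomain Ω →
        perimeter Ω ^ ((p - 1) / d) * steklovEigenvalue Ω p 2 ≤ C * distortion Ω ^ q) :=
  ⟨fun _ hj => isBoundedLipschitzDomain_counterDomain hd hp hj,
    tendsto_perimeter_counterDomain hd hp, exists_le_steklovEigenvalue hd hp,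
    tendsto_steklovEigenvalue_counterDomain hd hp, exists_distortion_bounds hd hp,
    fun _ hq => not_exists_bound hd hp hq⟩
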